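/- Let $G$ be a real Lie group of dimension $n$ with Lie algebra $\mathfrak g$ and Haar measure $dm$ (left invariant). Assume that $G$ is weakly exponential: there is an open neighbourhood $\mathcal O$ of $0$ in $\mathfrak g$, star-shaped and symmetric ($tX\in\mathcal O$ for $X\in\mathcal O$, $-1\le t\le 1$), such that $\exp|_{\mathcal O}$ is a diffeomorphism onto $\mathcal U=\exp(\mathcal O)$ and $G\setminus\mathcal U$ has measure zero; assume moreover that $\exp^{-1}\colon\mathcal U\to\mathcal O$ maps sets that are precompact in $G$ onto sets that are precompact in $\mathfrak g$. Let $M=G\times\mathfrak g^*\cong T^*G$ and $0\neq\hbar\in\mathbb R$. Let $dX$ be the Lebesgue measure on $\mathfrak g$ induced by $dm$ (so that $dm(\exp)/dX=1$ at $X=0$), $dp$ the dual measure on $\mathfrak g^*$, and $dx=dm(q)\times dp$. Put $V_a(b)=\exp^{-1}(a^{-1}b)$, $X\diamond Y=\exp^{-1}(\exp(X)\exp(Y))$, $F(X)=\sqrt{|\det\lambda(\mathrm{ad}_X)|}$ with $\lambda(x)=\frac2x\sinh\frac x2$, and $L(X,Y)=F(X)F(Y)/F(X\diamond Y)$ if $X,Y\in\mathcal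 O$ and $\exp(X)\exp(Y)\in\mathcal U$, $L(X,Y)=0$ otherwise. Let $\widetilde{\mathcal F}(M)$ be the space of square integrable functions $\tilde f$ on $G\times\mathfrak g$ supported in $G\times\mathcal O$ for which $\mathsf f(a,b)=\tilde f\bigl(a\exp(\tfrac12V_a(b)),V_a(b)\bigr)F(V_a(b))^{-1}$, $a^{-1}b\in\mathcal U$, extends to a function $\mathsf f\in C_c^\infty(G\times G)$, and let $\mathcal F(M)$ be the space of the functions $f(q,p)=\int_{\mathfrak g}\tilde f(q,X)e^{-\frac i\hbar\langle p,X\rangle}\,dX$ with $\tilde f\in\widetilde{\mathcal F}(M)$. The star-product of $f,g\in\mathcal F(M)$ is $$(f\star g)(q,p)=\int_{\mathfrak g\times\mathfrak g}\tilde f\bigl(q\exp(-\tfrac12(X\diamond Y))\exp(\tfrac12X),X\bigr)\,\tilde g\bigl(q\exp(\tfrac12(X\diamond Y))\exp(-\tfrac12Y),Y\bigr)\,e^{-\frac i\hbar\langle p,X\diamond Y\rangle}L(X,Y)\,dX\,dY ,$$ and it is an element of $\mathcal F(M)$. If $G$ is compact, $\mathcal F(M)$ carries the topology of the semi-norms $\|f\|_{k,l}=\sup_{a,b\in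 G}|D^{k,l}\mathsf f(a,b)|$, where $k,l\in\mathbb N^n$ and $D^{k,l}$ is the corresponding product of powers of the left invariant vector fields $L_{X_1},\dots,L_{X_n}$ of a basis of $\mathfrak g$ acting on the first and on the second variable. Let $\mathcal F'(M)$ be the space of linear functionals on $\mathcal F(M)$, continuous if $G$ is compact. A function $u$ on $M$ is identified with the functional $h\mapsto\int_M u(x)h(x)\,dx$, provided that for every $h\in\mathcal F(M)$ this integral exists as the improper integral $\lim_{\varepsilon\to0^+}\int_M\chi(\varepsilon p)\,u(q,p)\,h(q,p)\,dx$, for all $\chi\in C_c^\infty(\mathfrak g^*)$ with $\chi(0)=1$ and independently of $\chi$. For $T\in\mathcal F'(M)$ and $g\in\mathcal F(M)$ put $\langle T\star g,h\rangle=\langle T,g\star h\rangle$ and $\langle g\star T,h\rangle=\langle T,h\star g\rangle$, and let $$\mathcal F_\star(M)=\{T\in\mathcal F'(M)\mid T\star g\in\mathcal F(M)\text{ and }g\star T\in\mathcal F(M)\text{ for every }g\in\mathcal F(M)\}.$$ Then: 1. every smooth function $f(q)$ on $G$, regarded as a function on $M$, belongs to $\mathcal F_\star(M)$; 2. for every basis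 $X_1,\dots,X_n$ of $\mathfrak g$, the fiber variables $p_j(q,p)=\langle p,X_j\rangle$ belong to $\mathcal F_\star(M)$; 3. more generally, every smooth function on $M$ that is polynomial in the fiber variables, $\sum_{l=0}^{d}f^{i_1\cdots i_l}(q)\,p_{i_1}\cdots p_{i_l}$ with $f^{i_1\cdots i_l}\in C^\infty(G)$, belongs to $\mathcal F_\star(M)$. -/

import Mathlib

open MeasureTheory Set Filter Topology Function
open scoped Manifold ContDiff ENNReal

noncomputable section

namespace StarLie

/-! ### Lie group basics

`G` is a real Lie group modelled on the finite-dimensional space `E`. Its Lie algebra is Mathlib's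
`GroupLieAlgebra 𝓘(ℝ, E) G`, the tangent space at the unit, whose underlying vector space is `E`. -/

section LieBasics

variable {E : Type*} [NormedAddCommGroup E] [NormedSpace ℝ E]
  {G : Type*} [Group G] [TopologicalSpace G] [ChartedSpace E G]

/-- The left invariant vector field `L_X` on `G`, `L_X(q) = T_e L_q X`. -/
def leftField (X : E) (q : G) : TangentSpace 𝓘(ℝ, E) q :=
  mulInvariantVectorField (I := 𝓘(ℝ, E)) (G := G) X q

open Classical in
/-- The exponential map of `G`: the value at time `1` of the integral curve of the left invariant
vector field `L_X` that starts at the unit element. -/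
def lieExp (X : E) : G :=
  if h : ∃ γ : ℝ → G, γ 0 = 1 ∧ IsMIntegralCurve (I := 𝓘(ℝ, E)) γ (leftField X) then
    h.choose 1
  else 1

/-- `exp⁻¹ : exp(O) → O`. -/
def lieLog (O : Set E) (g : G) : E := invFunOn (lieExp (G := G)) O g

/-- `V_a(b) = exp⁻¹(a⁻¹ b)`. -/
def logAt (O : Set E) (a b : G) : E := lieLog O (a⁻¹ * b)

/-- The Baker-Campbell-Hausdorff product `X ⋄ Y = exp⁻¹(exp(X) exp(Y))`. -/
def bch (G : Type*) [Group G] [TopologicalSpace G] [ChartedSpace E G] (O : Set E) (X Y : E) : E :=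
  lieLog (G := G) O (lieExp X * lieExp Y)

/-- The domain `𝒱` of the Baker-Campbell-Hausdorff product. -/
def bchDomain (G : Type*) [Group G] [TopologicalSpace G] [ChartedSpace E G] (O : Set E) :
    Set (E × E) :=
  {z | z.1 ∈ O ∧ z.2 ∈ O ∧ lieExp (G := G) z.1 * lieExp z.2 ∈ lieExp (G := G) '' O}

/-- `O` exhibits `G` as a weakly exponential Lie group (with `m` a Haar measure of `G`): it is an
open, star-shaped and symmetric neighbourhood of `0`, the exponential map restricts to a
diffeomorphism of `O` onto the open set `exp(O)`, the complement of `exp(O)` is null, and `exp⁻¹`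
maps subsets of `exp(O)` that are precompact in `G` onto precompact subsets of the Lie algebra. -/
structure IsWeaklyExponential [MeasurableSpace G] (m : Measure G) (O : Set E) : Prop where
  isOpen : IsOpen O
  zero_mem : (0 : E) ∈ O
  smul_mem : ∀ X ∈ O, ∀ t : ℝ, t ∈ Icc (-1 : ℝ) 1 → t • X ∈ O
  diffeo : ∃ Φ : PartialDiffeomorph 𝓘(ℝ, E) 𝓘(ℝ, E) E G ∞,
    Φ.source = O ∧ ∀ X ∈ O, Φ X = lieExp X
  null_compl : m (lieExp '' O)ᶜ = 0
  precompact : ∀ S ⊆ (lieExp '' O : Set G), IsCompact (closure S) →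
    IsCompact (closure (lieLog O '' S))

variable [FiniteDimensional ℝ E]

/-- The operator `ad_X` on the Lie algebra of `G`. -/
def lieAd (G : Type*) [Group G] [TopologicalSpace G] [ChartedSpace E G]
    [LieGroup 𝓘(ℝ, E) ∞ G] (X : E) : E →L[ℝ] E :=
  haveI : LieGroup 𝓘(ℝ, E) (minSmoothness ℝ 3) G := by
    rw [minSmoothness_of_isRCLikeNormedField]; infer_instance
  haveI : CompleteSpace E := FiniteDimensional.complete ℝ E
  LinearMap.toContinuousLinearMap
    (LieAlgebra.ad ℝ (GroupLieAlgebra 𝓘(ℝ, E) G) X : E →ₗ[ℝ] E)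

/-- `F(X) = √|det λ(ad_X)|` with `λ(x) = (2/x) sinh(x/2) = ∑ₙ x²ⁿ / (4ⁿ (2n+1)!)`. -/
def densF (G : Type*) [Group G] [TopologicalSpace G] [ChartedSpace E G]
    [LieGroup 𝓘(ℝ, E) ∞ G] (X : E) : ℝ :=
  Real.sqrt |(∑' n : ℕ, ((4 : ℝ) ^ n * (Nat.factorial (2 * n + 1) : ℝ))⁻¹ • (lieAd G X) ^ (2 * n)).det|

open Classical in
/-- `L(X, Y) = F(X) F(Y) / F(X ⋄ Y)` on `𝒱`, and `0` off `𝒱`. -/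
def densL (G : Type*) [Group G] [TopologicalSpace G] [ChartedSpace E G]
    [LieGroup 𝓘(ℝ, E) ∞ G] (O : Set E) (X Y : E) : ℝ :=
  if (X, Y) ∈ bchDomain G O then densF G X * densF G Y / densF G (bch G O X Y) else 0

end LieBasics

/-! ### Measures -/

section Measures

variable {E : Type*} [NormedAddCommGroup E] [NormedSpace ℝ E] [FiniteDimensional ℝ E]
  [MeasurableSpace E] [BorelSpace E]
  {G : Type*} [Group G] [TopologicalSpace G] [ChartedSpace E G] [MeasurableSpace G]

/-- The measure `dX` on the Lie algebra that is induced by the Haar measure `m` of `G`: the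
translation invariant measure whose value on an infinitesimal volume element at `0` is the value of
`m` on the corresponding volume element at the unit, that is, such that the Jacobian `dm(exp)/dX`
is `1` at `X = 0`. -/
def algMeasure (m : Measure G) : Measure E :=
  (limUnder (𝓝[>] (0 : ℝ)) fun r =>
    m (lieExp '' Metric.ball (0 : E) r) / (Measure.addHaar : Measure E) (Metric.ball 0 r)) •
    (Measure.addHaar : Measure E)

/-- The measure `dp` on the dual of the Lie algebra, dual to `dX`: if `dX` is `c` times the
Lebesgue measure of the coordinates of a basis, then `dp` is `c⁻¹` times the Lebesgue measure of
the coordinates of the dual basis, so that the Fourier transform with respect to `dX` is inverted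
by `(2π)⁻ⁿ` times the one with respect to `dp`. -/
def dualMeasure (m : Measure G) : Measure (E →L[ℝ] ℝ) :=
  (algMeasure m (_root_.parallelepiped (Module.finBasis ℝ E)))⁻¹ •
    ((Module.finBasis ℝ E).dualBasis.map LinearMap.toContinuousLinearMap).addHaar

/-- The Liouville measure `dx = dm(q) × dp` on the phase space `M = G × 𝔤*`. -/
def liouville (m : Measure G) : Measure (G × (E →L[ℝ] ℝ)) := m.prod (dualMeasure m)

/-- `∫_M u dx = v` as an improper integral: for every smooth compactly supported `χ` on `𝔤*` with
`χ(0) = 1`, the function `χ(ε p) u(q, p)` is integrable for `ε > 0`, and its integral tends to `v`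
as `ε → 0⁺`. -/
def HasImproperIntegral (m : Measure G) (u : G × (E →L[ℝ] ℝ) → ℂ) (v : ℂ) : Prop :=
  ∀ χ : (E →L[ℝ] ℝ) → ℝ, ContDiff ℝ ∞ χ → HasCompactSupport χ → χ 0 = 1 →
    (∀ ε : ℝ, 0 < ε → Integrable (fun x => (χ (ε • x.2) : ℂ) * u x) (liouville m)) ∧
    Tendsto (fun ε : ℝ => ∫ x, (χ (ε • x.2) : ℂ) * u x ∂(liouville m)) (𝓝[>] 0) (𝓝 v)

end Measures

section Phase

variable {E : Type*} [NormedAddCommGroup E] [NormedSpace ℝ E]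

/-- The phase `e^{-(i/ħ)⟨p, X⟩}`. -/
def phase (ħ : ℝ) (p : E →L[ℝ] ℝ) (X : E) : ℂ :=
  Complex.exp (-(Complex.I / (ħ : ℂ)) * ((p X : ℝ) : ℂ))

theorem phase_integrable [MeasurableSpace E] [BorelSpace E] {μ : Measure E}
    (ħ : ℝ) (p : E →L[ℝ] ℝ) {f : E → ℂ}
    (hf : Integrable f μ) : Integrable (fun X => f X * phase ħ p X) μ := by
  have hc : Continuous fun X : E => phase ħ p X := by
    unfold phase; fun_prop
  refine hf.mul_bdd (c := 1) hc.aestronglyMeasurable (Eventually.of_forall fun X => ?_)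
  have h : -(Complex.I / (ħ : ℂ)) * ((p X : ℝ) : ℂ) =
      ((-(p X / ħ) : ℝ) : ℂ) * Complex.I := by push_cast; ring
  exact (by rw [phase, h, Complex.norm_exp_ofReal_mul_I] : ‖phase ħ p X‖ = 1).le

end Phase

/-! ### The space of test functions and its star-product -/

section TestSpace

variable {E : Type*} [NormedAddCommGroup E] [NormedSpace ℝ E] [FiniteDimensional ℝ E]
  [MeasurableSpace E] [BorelSpace E]
  {G : Type*} [Group G] [TopologicalSpace G] [ChartedSpace E G] [LieGroup 𝓘(ℝ, E) ∞ G]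
  [MeasurableSpace G]

/-- `k ∈ C^∞_c(G × G)` extends `(a, b) ↦ φ(a exp(½ V_a(b)), V_a(b)) F(V_a(b))⁻¹`, which is defined
for `a⁻¹ b ∈ exp(O)`. -/
structure IsKernel (O : Set E) (φ : G × E → ℂ) (k : G × G → ℂ) : Prop where
  smooth : ContMDiff (𝓘(ℝ, E).prod 𝓘(ℝ, E)) 𝓘(ℝ, ℂ) ∞ k
  compact : HasCompactSupport k
  extends' : ∀ a b : G, a⁻¹ * b ∈ (lieExp '' O : Set G) →
    k (a, b) = φ (a * lieExp ((1 / 2 : ℝ) • logAt O a b), logAt O a b) *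
      ((densF G (logAt O a b) : ℂ))⁻¹

/-- The space `F̃(M)` of square integrable functions on `G × 𝔤`, supported in `G × O`, whose kernel
extends to a smooth compactly supported function on `G × G`. The integrability on the fibres holds
for all these functions and is recorded so that the inverse Fourier transform makes sense. -/
def tildeF (m : Measure G) (O : Set E) : Submodule ℂ (G × E → ℂ) where
  carrier := {φ | MemLp φ 2 (m.prod (algMeasure m)) ∧ (∀ q, ∀ X ∉ O, φ (q, X) = 0) ∧
    (∀ q, Integrable (fun X => φ (q, X)) (algMeasure m)) ∧ ∃ k, IsKernel O φ k}
  add_mem' := by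
    rintro φ ψ ⟨h1, h2, h3, k, hk⟩ ⟨h1', h2', h3', k', hk'⟩
    refine ⟨h1.add h1', fun q X hX => by simp [h2 q X hX, h2' q X hX],
      fun q => (h3 q).add (h3' q), k + k', hk.smooth.add hk'.smooth,
      hk.compact.add hk'.compact, fun a b hab => ?_⟩
    simp only [Pi.add_apply, hk.extends' a b hab, hk'.extends' a b hab]
    ring
  zero_mem' := ⟨MemLp.zero, fun _ _ _ => rfl, fun _ => integrable_zero _ _ _,
    0, contMDiff_const, HasCompactSupport.zero, fun a b _ => by simp⟩
  smul_mem' := by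
    rintro c φ ⟨h1, h2, h3, k, hk⟩
    refine ⟨h1.const_smul c, fun q X hX => by simp [h2 q X hX], fun q => (h3 q).smul c,
      c • k, ?_, ?_, fun a b hab => ?_⟩
    · exact (contDiff_const_smul c).contMDiff.comp hk.smooth
    · exact hk.compact.comp_left (g := fun z : ℂ => c • z) (by simp)
    · simp only [Pi.smul_apply, hk.extends' a b hab, smul_eq_mul]
      ring

/-- The inverse momentum Fourier transform `f(q, p) = ∫ f̃(q, X) e^{-(i/ħ)⟨p, X⟩} dX`. -/
def invFourier (m : Measure G) (ħ : ℝ) (O : Set E) :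
    tildeF m O →ₗ[ℂ] (G × (E →L[ℝ] ℝ) → ℂ) where
  toFun φ x := ∫ X, φ.1 (x.1, X) * phase ħ x.2 X ∂(algMeasure m)
  map_add' φ ψ := by
    funext x
    simp only [Submodule.coe_add, Pi.add_apply, add_mul]
    exact integral_add (phase_integrable ħ x.2 (φ.2.2.2.1 x.1))
      (phase_integrable ħ x.2 (ψ.2.2.2.1 x.1))
  map_smul' c φ := by
    funext x
    simp only [Submodule.coe_smul, Pi.smul_apply, smul_eq_mul, mul_assoc, RingHom.id_apply]
    exact integral_const_mul c _

/-- The space `F(M)` of test functions: the image of `F̃(M)` under the inverse momentum Fourier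
transform. -/
def testF (m : Measure G) (ħ : ℝ) (O : Set E) : Submodule ℂ (G × (E →L[ℝ] ℝ) → ℂ) :=
  LinearMap.range (invFourier m ħ O)

variable {m : Measure G} {ħ : ℝ} {O : Set E}

/-- `f̃`, the element of `F̃(M)` whose inverse momentum Fourier transform is `f ∈ F(M)`. -/
def tilde (f : testF m ħ O) : tildeF m O := (LinearMap.mem_range.1 f.2).choose

/-- The integral kernel in `C^∞_c(G × G)` that corresponds to `f ∈ F(M)`. -/
def kernel (f : testF m ħ O) : G × G → ℂ := (tilde f).2.2.2.2.choose

/-- The star-product of two elements of `F(M)`. -/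
def starProd (f g : testF m ħ O) : G × (E →L[ℝ] ℝ) → ℂ := fun x =>
  ∫ z : E × E,
    (tilde f).1 (x.1 * lieExp (-(1 / 2 : ℝ) • bch G O z.1 z.2) * lieExp ((1 / 2 : ℝ) • z.1), z.1) *
    (tilde g).1 (x.1 * lieExp ((1 / 2 : ℝ) • bch G O z.1 z.2) * lieExp (-(1 / 2 : ℝ) • z.2), z.2) *
    phase ħ x.2 (bch G O z.1 z.2) * (densL G O z.1 z.2 : ℂ)
  ∂((algMeasure m).prod (algMeasure m))

/-! ### The topology of the test space, for compact `G` -/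

/-- `L_X^{(1)}`: the left invariant vector field `L_X` acting on the first variable. -/
def field₁ (X : E) (k : G × G → ℂ) : G × G → ℂ := fun x =>
  mfderiv 𝓘(ℝ, E) 𝓘(ℝ, ℂ) (fun a => k (a, x.2)) x.1 (leftField X x.1)

/-- `L_X^{(2)}`: the left invariant vector field `L_X` acting on the second variable. -/
def field₂ (X : E) (k : G × G → ℂ) : G × G → ℂ := fun x =>
  mfderiv 𝓘(ℝ, E) 𝓘(ℝ, ℂ) (fun b => k (x.1, b)) x.2 (leftField X x.2)

/-- The operator `D^{k,l} = (L_{X₁}^{(1)})^{k₁} ⋯ (L_{Xₙ}^{(1)})^{kₙ} (L_{X₁}^{(2)})^{l₁} ⋯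
(L_{Xₙ}^{(2)})^{lₙ}` for a basis `X₁, …, Xₙ` of the Lie algebra. -/
def diffOp {n : ℕ} (X : Module.Basis (Fin n) ℝ E) (k l : Fin n → ℕ) (K : G × G → ℂ) :
    G × G → ℂ :=
  (List.finRange n).foldr (fun i => (field₁ (X i))^[k i])
    ((List.finRange n).foldr (fun i => (field₂ (X i))^[l i]) K)

/-- The semi-norm `‖f‖_{k,l} = sup |D^{k,l} 𝖿|`, with `𝖿` the integral kernel of `f`. -/
def snorm {n : ℕ} (X : Module.Basis (Fin n) ℝ E) (k l : Fin n → ℕ) (f : testF m ħ O) : ℝ :=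
  ⨆ x : G × G, ‖diffOp X k l (kernel f) x‖

/-- The topology of `F(M)` given by the semi-norms `‖·‖_{k,l}`: the coarsest one for which all the
functions `f ↦ ‖f - g‖_{k,l}` are continuous. -/
@[reducible] def testTopology {n : ℕ} (X : Module.Basis (Fin n) ℝ E) : TopologicalSpace (testF m ħ O) :=
  ⨅ (k : Fin n → ℕ) (l : Fin n → ℕ) (g : testF m ħ O),
    TopologicalSpace.induced (fun f => snorm X k l (f - g)) inferInstance

/-! ### Distributions -/

/-- The space `F'(M)` of distributions: the linear functionals on `F(M)`, required to be continuous
when `G` is compact (for non-compact `G` the space `F(M)` carries no topology). -/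
def distributions {n : ℕ} (X : Module.Basis (Fin n) ℝ E) (m : Measure G) (ħ : ℝ) (O : Set E) :
    Set (Module.Dual ℂ (testF m ħ O)) :=
  {T | CompactSpace G → @Continuous _ _ (testTopology X) inferInstance T}

/-- The function `u` on `M` defines the functional `T`, `⟨T, h⟩ = ∫_M u(x) h(x) dx`, the integral
being an improper one. -/
def Represents (u : G × (E →L[ℝ] ℝ) → ℂ) (T : Module.Dual ℂ (testF m ħ O)) : Prop :=
  ∀ h : testF m ħ O, HasImproperIntegral m (fun x => u x * h.1 x) (T h)

/-- `S = T ⋆ g`, that is `⟨S, h⟩ = ⟨T, g ⋆ h⟩` for every test function `h` (where `g ⋆ h` is a test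
function). -/
def IsStarRight (T : Module.Dual ℂ (testF m ħ O)) (g : testF m ħ O)
    (S : Module.Dual ℂ (testF m ħ O)) : Prop :=
  ∀ h : testF m ħ O, ∃ w : testF m ħ O, w.1 = starProd g h ∧ S h = T w

/-- `S = g ⋆ T`, that is `⟨S, h⟩ = ⟨T, h ⋆ g⟩` for every test function `h` (where `h ⋆ g` is a test
function). -/
def IsStarLeft (T : Module.Dual ℂ (testF m ħ O)) (g : testF m ħ O)
    (S : Module.Dual ℂ (testF m ħ O)) : Prop :=
  ∀ h : testF m ħ O, ∃ w : testF m ħ O, w.1 = starProd h g ∧ S h = T w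

/-- The algebra `F_⋆(M)` of the distributions `T` such that `T ⋆ g` and `g ⋆ T` are (the
distributions defined by) elements of `F(M)` for every `g ∈ F(M)`. -/
def starAlgebra {n : ℕ} (X : Module.Basis (Fin n) ℝ E) (m : Measure G) (ħ : ℝ) (O : Set E) :
    Set (Module.Dual ℂ (testF m ħ O)) :=
  {T | T ∈ distributions X m ħ O ∧ ∀ g : testF m ħ O,
    (∃ S ∈ distributions X m ħ O, IsStarRight T g S ∧ ∃ k : testF m ħ O, Represents k.1 S) ∧
    (∃ S ∈ distributions X m ħ O, IsStarLeft T g S ∧ ∃ k : testF m ħ O, Represents k.1 S)}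

/-- The function `u` on `M` belongs to `F_⋆(M)`: it defines a functional on `F(M)`, and this
functional is an element of `F_⋆(M)`. -/
def MemStarAlgebra {n : ℕ} (X : Module.Basis (Fin n) ℝ E) (m : Measure G) (ħ : ℝ) (O : Set E)
    (u : G × (E →L[ℝ] ℝ) → ℂ) : Prop :=
  ∃ T ∈ starAlgebra X m ħ O, Represents u T

end TestSpace

section Functions

variable {E : Type*} [NormedAddCommGroup E] [NormedSpace ℝ E]
  {G : Type*} [TopologicalSpace G] [ChartedSpace E G]

/-- The fiber variable `p_j(q, p) = ⟨p, X_j⟩`. -/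
def fiberVar {n : ℕ} (G : Type*) (X : Module.Basis (Fin n) ℝ E) (j : Fin n) :
    G × (E →L[ℝ] ℝ) → ℂ :=
  fun x => ((x.2 (X j) : ℝ) : ℂ)

/-- The smooth functions on `M` that are polynomial in the fiber variables:
`u(q, p) = ∑_{l ≤ d} ∑_{i₁, …, i_l} c^{i₁ ⋯ i_l}(q) p_{i₁} ⋯ p_{i_l}`
with smooth coefficients. -/
def IsFiberPolynomial {n : ℕ} (X : Module.Basis (Fin n) ℝ E) (u : G × (E →L[ℝ] ℝ) → ℂ) : Prop :=
  ∃ (d : ℕ) (c : (l : ℕ) → (Fin l → Fin n) → G → ℂ),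
    (∀ l i, ContMDiff 𝓘(ℝ, E) 𝓘(ℝ, ℂ) ∞ (c l i)) ∧
    ∀ x, u x = ∑ l ∈ Finset.range (d + 1), ∑ i : Fin l → Fin n,
      c l i x.1 * ∏ t, fiberVar G X (i t) x

end Functions

end StarLie

end

set_option linter.unusedSectionVars false
set_option linter.style.haveILetI false

noncomputable section

namespace StarLie

/-! ### The exponential map -/

section Exponential

variable {E : Type*} [NormedAddCommGroup E] [NormedSpace ℝ E] [FiniteDimensional ℝ E]
  {G : Type*} [Group G] [TopologicalSpace G] [ChartedSpace E G] [LieGroup 𝓘(ℝ, E) ∞ G]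

/-! Test functions are Weyl-type symbols of integral operators on `G`. On `O` the symbol is f̃(q, X)
= F(X) k(q exp(-X/2), q exp(X/2)) (`kernelSymbol`), where k is the kernel, and every k in C_c^∞(G ×
G) is the kernel of exactly one test function (`kernelSymbol_mem_tildeF`, `invFourier_injective`,
`kernel_ofKernel`). In terms of kernels, the star-product is composition, (a, b) ↦ ∫ g(a, c) h(c, b)
dm(c) (`starProd_eq`), and the pairing ∫_M f h dx is a constant C times the trace ∫∫ k_f(a, b)
k_h(b, a) (`hasImproperIntegral_mul`). Symbols need not be continuous at the boundary of `O`, so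
integrals over p are taken with cut-offs; the Fourier transform of a cut-off acts as an approximate
delta, and only the behaviour of symbols inside `O` matters.

For a monomial c(q)⟨p, Y⟩ˡ, Fourier inversion in p localizes at X = 0, and the functional is h ↦ C
(-iħ)ˡ times the l-th derivative at t = 0 of F(tY) ∫ c(q) k_h(q exp(-tY/2), q exp(tY/2)) dm(q)
(`hasImproperIntegral_monomial`). Now replace h by g ⋆ h and translate q on the right: the integral
becomes ∫∫ W_t(a, b) k_h(b, a), where W_t is an explicit family built from F, c and the translates
of the kernel of g (`fiberIntegral_kernelComp_right`). The family is smooth in t with a common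
compact support, so its l-th derivative at t = 0 is again a test kernel κ. By the trace formula T ⋆
g is the test function with kernel (-iħ)ˡ κ. The constant C is the same in both formulas, so its
value never matters. The product g ⋆ T is treated symmetrically, and polarization together with
additivity passes from powers of one linear form to all fiber polynomials
(`memStarAlgebra_mul_prod`).

The densities match because λ(ad_X) = Ad(exp(X/2)) dexp(X) (`tsum_lieAd_eq`), which comes from a
linear ordinary differential equation. Hence F(X)² is the Jacobian of exp times the root of the
modular function at exp X (`densF_sq`), and the Haar measure is the Lebesgue measure of `O` weighted
by that Jacobian (`expMeasure_algMeasure`).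

For compact G the functionals must also be continuous. The t-derivatives above are powers of one
left invariant field on G × G, whereas the semi-norms involve only ordered products of basis fields;
a Poincaré–Birkhoff–Witt reordering closes the gap (`adjoin_le_span_ordered`,
`isDominated_fiberIntegral`). -/

theorem lieGroup_minSmoothness (n : ℕ) : LieGroup 𝓘(ℝ, E) (minSmoothness ℝ n) G := by
  rw [minSmoothness_of_isRCLikeNormedField]; infer_instance

theorem contMDiff_leftField (X : E) :
    ContMDiff 𝓘(ℝ, E) 𝓘(ℝ, E).tangent 1
      (fun g : G => (⟨g, leftField X g⟩ : TangentBundle 𝓘(ℝ, E) G)) := by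
  haveI : LieGroup 𝓘(ℝ, E) (minSmoothness ℝ 3) G := lieGroup_minSmoothness 3
  refine (contMDiff_mulInvariantVectorField (I := 𝓘(ℝ, E)) (G := G) X).of_le ?_
  rw [minSmoothness_of_isRCLikeNormedField]
  exact one_le_two

theorem mfderiv_mul_left_leftField (g h : G) (X : E) :
    mfderiv 𝓘(ℝ, E) 𝓘(ℝ, E) (fun x : G => g * x) h (leftField X h) = leftField X (g * h) := by
  unfold leftField mulInvariantVectorField
  have h1 : MDifferentiableAt 𝓘(ℝ, E) 𝓘(ℝ, E) (fun x : G => g * x) (h * 1) :=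
    (contMDiff_mul_left (I := 𝓘(ℝ, E)) (n := ∞)).mdifferentiableAt (by simp)
  have h2 : MDifferentiableAt 𝓘(ℝ, E) 𝓘(ℝ, E) (fun x : G => h * x) 1 :=
    (contMDiff_mul_left (I := 𝓘(ℝ, E)) (n := ∞)).mdifferentiableAt (by simp)
  have h3 := mfderiv_comp (1 : G) h1 h2
  have h4 : (fun x : G => g * x) ∘ (fun x : G => h * x) = fun x => g * h * x := by
    funext x; simp [mul_assoc]
  rw [h4] at h3
  rw [h3, mul_one]
  rfl

theorem leftField_smul (c : ℝ) (X : E) :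
    (leftField (c • X) : ∀ q : G, TangentSpace 𝓘(ℝ, E) q) = c • leftField X := by
  funext q
  exact congrFun (mulInvariantVectorField_smul (I := 𝓘(ℝ, E)) (G := G) c X) q

theorem isMIntegralCurve_mul_left {γ : ℝ → G} {X : E}
    (hγ : IsMIntegralCurve (I := 𝓘(ℝ, E)) γ (leftField X)) (g : G) :
    IsMIntegralCurve (I := 𝓘(ℝ, E)) (fun t => g * γ t) (leftField X) := by
  intro t
  have h1 : HasMFDerivAt 𝓘(ℝ, E) 𝓘(ℝ, E) (fun x : G => g * x) (γ t) _ :=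
    ((contMDiff_mul_left (I := 𝓘(ℝ, E)) (n := ∞) (a := g)).mdifferentiableAt
      (by simp)).hasMFDerivAt
  have h2 := h1.comp t (hγ t)
  have h3 : (mfderiv 𝓘(ℝ, E) 𝓘(ℝ, E) (fun x : G => g * x) (γ t)).comp
      ((1 : ℝ →L[ℝ] ℝ).smulRight (leftField X (γ t))) =
      (1 : ℝ →L[ℝ] ℝ).smulRight (leftField X (g * γ t)) := by
    refine ContinuousLinearMap.ext fun r => ?_
    have := mfderiv_mul_left_leftField g (γ t) X
    change mfderiv 𝓘(ℝ, E) 𝓘(ℝ, E) (fun x : G => g * x) (γ t) (r • leftField X (γ t)) =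
      r • leftField X (g * γ t)
    rw [map_smul]
    exact congrArg (r • ·) this
  rw [← h3]
  exact h2

variable [T2Space G]

theorem isMIntegralCurve_unique {γ γ' : ℝ → G} {X : E}
    (hγ : IsMIntegralCurve (I := 𝓘(ℝ, E)) γ (leftField X))
    (hγ' : IsMIntegralCurve (I := 𝓘(ℝ, E)) γ' (leftField X)) (h : γ 0 = γ' 0) : γ = γ' := by
  haveI : CompleteSpace E := FiniteDimensional.complete ℝ E
  haveI : IsManifold 𝓘(ℝ, E) 1 G := inferInstance
  exact isMIntegralCurve_Ioo_eq_of_contMDiff_boundaryless (contMDiff_leftField X) hγ hγ' h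

/-- Uniqueness of integral curves makes the choice in `lieExp` immaterial, and rescaling time turns
a curve for `X` into one for `t • X`. -/
theorem lieExp_smul_eq {γ : ℝ → G} {X : E} (h0 : γ 0 = 1)
    (hγ : IsMIntegralCurve (I := 𝓘(ℝ, E)) γ (leftField X)) (t : ℝ) :
    lieExp (t • X) = γ t := by
  have h1 : IsMIntegralCurve (I := 𝓘(ℝ, E)) (γ ∘ (· * t)) (leftField (t • X)) := by
    rw [leftField_smul]; exact hγ.comp_mul t
  have hex : ∃ γ : ℝ → G, γ 0 = 1 ∧ IsMIntegralCurve (I := 𝓘(ℝ, E)) γ (leftField (t • X)) :=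
    ⟨_, by simp [h0], h1⟩
  have h2 : hex.choose = γ ∘ (· * t) :=
    isMIntegralCurve_unique hex.choose_spec.2 h1 (by rw [hex.choose_spec.1]; simp [h0])
  rw [lieExp, dif_pos hex, h2]
  simp

theorem lieExp_zero : lieExp (0 : E) = (1 : G) := by
  have h : IsMIntegralCurve (I := 𝓘(ℝ, E)) (fun _ => (1 : G)) (leftField (0 : E)) :=
    isMIntegralCurve_const (by
      have := congrFun (leftField_smul (G := G) 0 (0 : E)) 1
      simpa using this)
  simpa using lieExp_smul_eq rfl h 0

variable [MeasurableSpace G] {m : Measure G} {O : Set E}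

namespace IsWeaklyExponential

theorem injOn (hO : IsWeaklyExponential m O) : InjOn (lieExp (G := G)) O := by
  obtain ⟨Φ, hs, hΦ⟩ := hO.diffeo
  intro X hX Y hY h
  rw [← hΦ X hX, ← hΦ Y hY] at h
  exact Φ.injOn (hs ▸ hX) (hs ▸ hY) h

theorem mem_nhds (hO : IsWeaklyExponential m O) : O ∈ 𝓝 (0 : E) :=
  hO.isOpen.mem_nhds hO.zero_mem

theorem exists_smul_mem (hO : IsWeaklyExponential m O) (X : E) :
    ∃ t : ℝ, 0 < t ∧ t • X ∈ O := by
  have h1 : Tendsto (fun t : ℝ => t • X) (𝓝 0) (𝓝 0) := by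
    have h : Continuous fun t : ℝ => t • X := by fun_prop
    simpa using h.tendsto 0
  have h2 : ∀ᶠ t : ℝ in 𝓝[>] 0, t • X ∈ O :=
    (h1.mono_left nhdsWithin_le_nhds) hO.mem_nhds
  obtain ⟨t, ht, ht'⟩ := (h2.and self_mem_nhdsWithin).exists
  exact ⟨t, ht', ht⟩

/-- Completeness of left invariant fields is hidden in the hypotheses: the default value of `lieExp`
is `1`, so a `Y ∈ O` without an integral curve would satisfy exp Y = 1 = exp 0. Injectivity on `O`
then forces `Y = 0`, which has the constant curve. Scaling into `O` and rescaling time reach every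
`X`. -/
theorem exists_curve (hO : IsWeaklyExponential m O) (X : E) :
    ∃ γ : ℝ → G, γ 0 = 1 ∧ IsMIntegralCurve (I := 𝓘(ℝ, E)) γ (leftField X) := by
  have key : ∀ Y ∈ O, ∃ γ : ℝ → G, γ 0 = 1 ∧
      IsMIntegralCurve (I := 𝓘(ℝ, E)) γ (leftField Y) := by
    intro Y hY
    by_contra hcon
    have h1 : lieExp Y = (1 : G) := by rw [lieExp, dif_neg hcon]
    have h2 : Y = 0 := hO.injOn hY hO.zero_mem (by rw [h1, lieExp_zero])
    subst h2
    refine hcon ⟨fun _ => 1, rfl, isMIntegralCurve_const ?_⟩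
    simpa using congrFun (leftField_smul (G := G) 0 (0 : E)) 1
  obtain ⟨t, ht, htX⟩ := hO.exists_smul_mem X
  obtain ⟨γ, h0, hγ⟩ := key _ htX
  refine ⟨γ ∘ (· * t⁻¹), by simp [h0], ?_⟩
  have := hγ.comp_mul t⁻¹
  rwa [← leftField_smul, inv_smul_smul₀ ht.ne'] at this

theorem isMIntegralCurve (hO : IsWeaklyExponential m O) (X : E) :
    IsMIntegralCurve (I := 𝓘(ℝ, E)) (fun t : ℝ => (lieExp (t • X) : G)) (leftField X) := by
  obtain ⟨γ, h0, hγ⟩ := hO.exists_curve X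
  have : (fun t : ℝ => (lieExp (t • X) : G)) = γ := funext (lieExp_smul_eq h0 hγ)
  rwa [this]

theorem exp_add_smul (hO : IsWeaklyExponential m O) (s t : ℝ) (X : E) :
    (lieExp ((s + t) • X) : G) = lieExp (s • X) * lieExp (t • X) := by
  have h1 := (hO.isMIntegralCurve X).comp_add s
  have h2 := isMIntegralCurve_mul_left (hO.isMIntegralCurve X) (lieExp (s • X))
  have h3 := isMIntegralCurve_unique h1 h2 (by simp [lieExp_zero])
  have h4 := congrFun h3 t
  simpa [add_comm] using h4

theorem exp_neg (hO : IsWeaklyExponential m O) (X : E) :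
    (lieExp (-X) : G) = (lieExp X)⁻¹ := by
  have h := hO.exp_add_smul (-1) 1 X
  simp only [neg_add_cancel, zero_smul, one_smul, neg_smul, lieExp_zero] at h
  exact eq_inv_of_mul_eq_one_left h.symm

theorem exp_half_mul_half (hO : IsWeaklyExponential m O) (X : E) :
    (lieExp ((1 / 2 : ℝ) • X) : G) * lieExp ((1 / 2 : ℝ) • X) = lieExp X := by
  rw [← hO.exp_add_smul]; norm_num

theorem exp_nat_smul (hO : IsWeaklyExponential m O) (n : ℕ) (X : E) :
    (lieExp ((n : ℝ) • X) : G) = lieExp X ^ n := by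
  induction n with
  | zero => simp [lieExp_zero]
  | succ n ih => rw [Nat.cast_succ, hO.exp_add_smul, ih, one_smul, pow_succ]

theorem contMDiffOn_exp (hO : IsWeaklyExponential m O) :
    ContMDiffOn 𝓘(ℝ, E) 𝓘(ℝ, E) ∞ (lieExp (G := G)) O := by
  obtain ⟨Φ, hs, hΦ⟩ := hO.diffeo
  have := Φ.contMDiffOn
  rw [hs] at this
  exact this.congr fun X hX => (hΦ X hX).symm

/-- Smoothness is given only on `O`; elsewhere use exp Y = exp(Y/(n+1))^(n+1) with n so large that
X/(n+1) lies in `O`. -/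
theorem contMDiff_exp (hO : IsWeaklyExponential m O) :
    ContMDiff 𝓘(ℝ, E) 𝓘(ℝ, E) ∞ (lieExp (G := G) : E → G) := by
  intro X
  have h0 : Tendsto (fun n : ℕ => ((n : ℝ) + 1)⁻¹ • X) atTop (𝓝 0) := by
    have h : Tendsto (fun n : ℕ => ((n : ℝ) + 1)⁻¹) atTop (𝓝 0) := by
      simpa using tendsto_one_div_add_atTop_nhds_zero_nat (𝕜 := ℝ)
    simpa using h.smul_const X
  obtain ⟨n, hn⟩ := (h0.eventually hO.mem_nhds).exists
  have h1 : (lieExp (G := G) : E → G) =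
      fun Y => lieExp (((n : ℝ) + 1)⁻¹ • Y) ^ (n + 1) := by
    funext Y
    rw [← hO.exp_nat_smul, smul_smul, Nat.cast_succ, mul_inv_cancel₀ (by positivity), one_smul]
  rw [h1]
  have h2 : ContMDiffAt 𝓘(ℝ, E) 𝓘(ℝ, E) ∞ (fun Y : E => ((n : ℝ) + 1)⁻¹ • Y) X :=
    (contDiff_const_smul _).contMDiff.contMDiffAt
  have h3 : ContMDiffAt 𝓘(ℝ, E) 𝓘(ℝ, E) ∞ (lieExp (G := G)) (((n : ℝ) + 1)⁻¹ • X) :=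
    (hO.contMDiffOn_exp _ hn).contMDiffAt (hO.isOpen.mem_nhds hn)
  have h4 : ContMDiffAt 𝓘(ℝ, E) 𝓘(ℝ, E) ∞
      (fun Y : E => (lieExp (((n : ℝ) + 1)⁻¹ • Y) : G)) X := h3.comp X h2
  exact (contMDiff_pow (I := 𝓘(ℝ, E)) (n := ∞) (G := G) (n + 1)).contMDiffAt.comp X h4

theorem continuous_exp (hO : IsWeaklyExponential m O) : Continuous (lieExp (G := G) : E → G) :=
  hO.contMDiff_exp.continuous

theorem isOpen_image (hO : IsWeaklyExponential m O) : IsOpen (lieExp (G := G) '' O) := by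
  obtain ⟨Φ, hs, hΦ⟩ := hO.diffeo
  have : lieExp (G := G) '' O = Φ.target := by
    rw [← Φ.image_source_eq_target, hs]
    exact image_congr fun X hX => (hΦ X hX).symm
  rw [this]
  exact Φ.open_target

theorem log_exp (hO : IsWeaklyExponential m O) {X : E} (hX : X ∈ O) :
    lieLog O (lieExp X : G) = X :=
  hO.injOn.leftInvOn_invFunOn hX

theorem log_mem {g : G} (hg : g ∈ (lieExp '' O : Set G)) : lieLog O g ∈ O :=
  invFunOn_mem hg

theorem exp_log {g : G} (hg : g ∈ (lieExp '' O : Set G)) : lieExp (lieLog O g) = g :=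
  invFunOn_eq hg

theorem contMDiffOn_log (hO : IsWeaklyExponential m O) :
    ContMDiffOn 𝓘(ℝ, E) 𝓘(ℝ, E) ∞ (lieLog (G := G) O) (lieExp '' O) := by
  obtain ⟨Φ, hs, hΦ⟩ := hO.diffeo
  have h : lieExp (G := G) '' O = Φ.target := by
    rw [← Φ.image_source_eq_target, hs]
    exact image_congr fun X hX => (hΦ X hX).symm
  have h2 := Φ.contMDiffOn_invFun
  rw [← h] at h2
  refine h2.congr ?_
  rintro _ ⟨X, hX, rfl⟩
  rw [hO.log_exp hX, ← hΦ X hX]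
  exact (Φ.left_inv (hs ▸ hX)).symm

theorem contMDiffAt_log (hO : IsWeaklyExponential m O) {g : G}
    (hg : g ∈ (lieExp '' O : Set G)) :
    ContMDiffAt 𝓘(ℝ, E) 𝓘(ℝ, E) ∞ (lieLog (G := G) O) g :=
  (hO.contMDiffOn_log g hg).contMDiffAt (hO.isOpen_image.mem_nhds hg)

theorem one_mem (hO : IsWeaklyExponential m O) : (1 : G) ∈ (lieExp '' O : Set G) :=
  ⟨0, hO.zero_mem, lieExp_zero⟩

theorem neg_mem (hO : IsWeaklyExponential m O) {X : E} (hX : X ∈ O) : -X ∈ O := by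
  simpa using hO.smul_mem X hX (-1) (by simp)

theorem log_one (hO : IsWeaklyExponential m O) : lieLog O (1 : G) = 0 := by
  rw [← lieExp_zero (E := E), hO.log_exp hO.zero_mem]

end IsWeaklyExponential

end Exponential

/-! ### Left invariant derivatives -/

section LeftDerivative

variable {E : Type*} [NormedAddCommGroup E] [NormedSpace ℝ E] [FiniteDimensional ℝ E]
  {G : Type*} [Group G] [TopologicalSpace G] [ChartedSpace E G] [LieGroup 𝓘(ℝ, E) ∞ G]
  {F : Type*} [NormedAddCommGroup F] [NormedSpace ℝ F]

/-- The derivative of `f` along the left invariant vector field `L_X`, in terms of the one-parameter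
subgroup generated by `X`. -/
def lder (X : E) (f : G → F) (q : G) : F := deriv (fun t : ℝ => f (q * lieExp (t • X))) 0

theorem fderiv_fderiv_apply_sub {f : E → F} {V W : E → E} {x : E} (hf : ContDiffAt ℝ 2 f x)
    (hV : DifferentiableAt ℝ V x) (hW : DifferentiableAt ℝ W x) :
    fderiv ℝ (fun y => fderiv ℝ f y (W y)) x (V x) - fderiv ℝ (fun y => fderiv ℝ f y (V y)) x (W x)
      = fderiv ℝ f x (VectorField.lieBracket ℝ V W x) := by
  have hd : DifferentiableAt ℝ (fderiv ℝ f) x :=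
    (hf.fderiv_right (m := 1) (by norm_num)).differentiableAt (by norm_num)
  have hs : IsSymmSndFDerivAt ℝ f x := hf.isSymmSndFDerivAt (by simp)
  rw [fderiv_clm_apply hd hW, fderiv_clm_apply hd hV, VectorField.lieBracket]
  simp only [add_apply, ContinuousLinearMap.comp_apply,
    ContinuousLinearMap.flip_apply, map_sub]
  rw [hs.eq (V x) (W x)]
  abel

variable [T2Space G] [MeasurableSpace G] {m : Measure G} {O : Set E}

namespace IsWeaklyExponential

theorem hasDerivAt_exp_smul (hO : IsWeaklyExponential m O) {f : G → F} {q g : G} {X : E} {t : ℝ}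
    (hg : q * lieExp (t • X) = g) (hf : MDifferentiableAt 𝓘(ℝ, E) 𝓘(ℝ, F) f g) :
    HasDerivAt (fun s : ℝ => f (q * lieExp (s • X)))
      (mfderiv 𝓘(ℝ, E) 𝓘(ℝ, F) f g (leftField X g) : F) t := by
  subst hg
  have h1 := isMIntegralCurve_mul_left (hO.isMIntegralCurve X) q t
  let L : E →L[ℝ] F := mfderiv 𝓘(ℝ, E) 𝓘(ℝ, F) f (q * lieExp (t • X))
  let v : E := leftField X (q * lieExp (t • X))
  have h2 : HasFDerivAt (fun s : ℝ => f (q * lieExp (s • X)))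
      (L.comp ((1 : ℝ →L[ℝ] ℝ).smulRight v)) t :=
    hasMFDerivAt_iff_hasFDerivAt.1 (hf.hasMFDerivAt.comp t h1)
  have h3 := h2.hasDerivAt
  have h4 : (L.comp ((1 : ℝ →L[ℝ] ℝ).smulRight v)) 1 = L v := by simp
  rw [h4] at h3
  exact h3

theorem lder_eq_mfderiv (hO : IsWeaklyExponential m O) {f : G → F} {q : G}
    (hf : MDifferentiableAt 𝓘(ℝ, E) 𝓘(ℝ, F) f q) (X : E) :
    lder X f q = (mfderiv 𝓘(ℝ, E) 𝓘(ℝ, F) f q (leftField X q) : F) :=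
  (hO.hasDerivAt_exp_smul (t := 0) (by simp [lieExp_zero]) hf).deriv

theorem contMDiffAt_mul_exp (hO : IsWeaklyExponential m O) {P : Type*} [NormedAddCommGroup P]
    [NormedSpace ℝ P] {u : P → E} {g : P → G} {p : P} (hg : ContMDiffAt 𝓘(ℝ, P) 𝓘(ℝ, E) ∞ g p)
    (hu : ContDiffAt ℝ ∞ u p) :
    ContMDiffAt 𝓘(ℝ, P) 𝓘(ℝ, E) ∞ (fun p => g p * lieExp (u p)) p :=
  hg.mul (hO.contMDiff_exp.contMDiffAt.comp p hu.contMDiffAt)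

theorem contMDiffAt_exp_comp (hO : IsWeaklyExponential m O) {P : Type*} [NormedAddCommGroup P]
    [NormedSpace ℝ P] {u : P → E} {p : P}
    (hu : ContDiffAt ℝ ∞ u p) :
    ContMDiffAt 𝓘(ℝ, P) 𝓘(ℝ, E) ∞ (fun p => (lieExp (u p) : G)) p :=
  hO.contMDiff_exp.contMDiffAt.comp p hu.contMDiffAt

theorem contDiffAt_log_comp (hO : IsWeaklyExponential m O) {P : Type*} [NormedAddCommGroup P]
    [NormedSpace ℝ P] {g : P → G} {p : P} (hg : ContMDiffAt 𝓘(ℝ, P) 𝓘(ℝ, E) ∞ g p)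
    (hp : g p ∈ (lieExp '' O : Set G)) : ContDiffAt ℝ ∞ (fun p => lieLog O (g p)) p :=
  contMDiffAt_iff_contDiffAt.1 ((hO.contMDiffAt_log hp).comp p hg)

theorem contDiffAt_comp_mul_exp (hO : IsWeaklyExponential m O) {f : G → F} {q : G} {Z : E}
    (hf : ContMDiffAt 𝓘(ℝ, E) 𝓘(ℝ, F) ∞ f (q * lieExp Z)) :
    ContDiffAt ℝ ∞ (fun Y : E => f (q * lieExp Y)) Z :=
  contMDiffAt_iff_contDiffAt.1 (hf.comp Z (hO.contMDiffAt_mul_exp contMDiffAt_const contDiffAt_id))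

/-- The derivative along `L_X` in exponential coordinates. -/
theorem lder_eq_fderiv (hO : IsWeaklyExponential m O) {f : G → F} {q : G}
    (hf : ContMDiffAt 𝓘(ℝ, E) 𝓘(ℝ, F) ∞ f q) (X : E) :
    lder X f q = fderiv ℝ (fun Y : E => f (q * lieExp Y)) 0 X := by
  have h1 : DifferentiableAt ℝ (fun Y : E => f (q * lieExp Y)) ((0 : ℝ) • X) := by
    refine (hO.contDiffAt_comp_mul_exp ?_).differentiableAt (by simp)
    simpa [lieExp_zero] using hf
  have h2 : HasDerivAt (fun t : ℝ => t • X) X 0 := by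
    simpa using (hasDerivAt_id (0 : ℝ)).smul_const X
  have h3 := h1.hasFDerivAt.comp_hasDerivAt (0 : ℝ) h2
  have h4 := h3.deriv
  simp only [zero_smul] at h4
  exact h4

theorem mfderiv_exp_zero (hO : IsWeaklyExponential m O) (X : E) :
    mfderiv 𝓘(ℝ, E) 𝓘(ℝ, E) (lieExp (G := G)) (0 : E) X = leftField X (lieExp (0 : E) : G) := by
  have key : ∀ Z : E, Z = (0 : ℝ) • X → mfderiv 𝓘(ℝ, E) 𝓘(ℝ, E) (lieExp (G := G)) Z X =
      leftField X (lieExp Z : G) := by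
    rintro Z rfl
    have h1 : HasMFDerivAt 𝓘(ℝ, E) 𝓘(ℝ, E) (lieExp (G := G)) ((0 : ℝ) • X) _ :=
      (hO.contMDiff_exp.mdifferentiableAt (by simp)).hasMFDerivAt
    have h2 : HasFDerivAt (fun t : ℝ => t • X) ((1 : ℝ →L[ℝ] ℝ).smulRight X) 0 := by
      have : HasDerivAt (fun t : ℝ => t • X) X 0 := by
        simpa using (hasDerivAt_id (0 : ℝ)).smul_const X
      exact this.hasFDerivAt
    let L : E →L[ℝ] E := mfderiv 𝓘(ℝ, E) 𝓘(ℝ, E) (lieExp (G := G)) ((0 : ℝ) • X)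
    let v : E := leftField X (lieExp ((0 : ℝ) • X) : G)
    have h5 : L.comp ((1 : ℝ →L[ℝ] ℝ).smulRight X) = (1 : ℝ →L[ℝ] ℝ).smulRight v :=
      hasMFDerivAt_unique (h1.comp (0 : ℝ) h2.hasMFDerivAt) (hO.isMIntegralCurve X 0)
    have h6 := congrArg (fun (T : ℝ →L[ℝ] E) => T 1) h5
    have h7 : L X = v := by simpa using h6
    exact h7
  exact key 0 (zero_smul ℝ X).symm

theorem mfderiv_exp_comp (hO : IsWeaklyExponential m O) {X : E} (hX : X ∈ O) :
    (mfderiv 𝓘(ℝ, E) 𝓘(ℝ, E) (lieExp (G := G)) X).IsInvertible := by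
  have h1 : HasMFDerivAt 𝓘(ℝ, E) 𝓘(ℝ, E) (lieExp (G := G)) X _ :=
    (hO.contMDiff_exp.mdifferentiableAt (by simp)).hasMFDerivAt
  have hU : (lieExp X : G) ∈ (lieExp '' O : Set G) := mem_image_of_mem _ hX
  have h2 : HasMFDerivAt 𝓘(ℝ, E) 𝓘(ℝ, E) (lieLog (G := G) O) (lieExp X) _ :=
    ((hO.contMDiffAt_log hU).mdifferentiableAt (by simp)).hasMFDerivAt
  have hlog := hO.log_exp (G := G) hX
  have h3 : HasMFDerivAt 𝓘(ℝ, E) 𝓘(ℝ, E) (lieExp (G := G)) (lieLog O (lieExp X : G))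
      (mfderiv 𝓘(ℝ, E) 𝓘(ℝ, E) (lieExp (G := G)) X) := by rw [hlog]; exact h1
  have h4 := (h2.comp X h1).congr_of_eventuallyEq (f₁ := id) (by
    filter_upwards [hO.isOpen.mem_nhds hX] with Y hY
    exact (hO.log_exp hY).symm)
  have h5 := (h3.comp (lieExp X : G) h2).congr_of_eventuallyEq (f₁ := id) (by
    filter_upwards [hO.isOpen_image.mem_nhds hU] with g hg
    exact (exp_log hg).symm)
  exact ContinuousLinearMap.IsInvertible.of_inverse
    (g := mfderiv 𝓘(ℝ, E) 𝓘(ℝ, E) (lieLog (G := G) O) (lieExp X))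
    (hasMFDerivAt_unique h5 (hasMFDerivAt_id _)) (hasMFDerivAt_unique h4 (hasMFDerivAt_id _))

/-- Ties the manifold Lie bracket behind `lieAd` to the commutator of derivations. The left
invariant fields are pulled back by exp to vector fields on `E`, where symmetry of the second
derivative computes the commutator; pullback respects brackets, and the pulled-back field of `X` has
value `X` at `0`. -/
theorem lder_comm_one (hO : IsWeaklyExponential m O) {f : G → F} {U : Set G} (hU : IsOpen U)
    (h1U : 1 ∈ U) (hf : ContMDiffOn 𝓘(ℝ, E) 𝓘(ℝ, F) ∞ f U) (X Y : E)
    (hX : DifferentiableAt ℝ (fun Z : E => lder X f (lieExp Z)) 0)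
    (hY : DifferentiableAt ℝ (fun Z : E => lder Y f (lieExp Z)) 0) :
    lder X (lder Y f) 1 - lder Y (lder X f) 1 = lder (lieAd G X Y) f 1 := by
  haveI : CompleteSpace E := FiniteDimensional.complete ℝ E
  haveI : LieGroup 𝓘(ℝ, E) (minSmoothness ℝ 3) G := lieGroup_minSmoothness 3
  have hfa : ∀ g ∈ U, ContMDiffAt 𝓘(ℝ, E) 𝓘(ℝ, F) ∞ f g := fun g hg =>
    (hf g hg).contMDiffAt (hU.mem_nhds hg)
  let V (X : E) : E → E := VectorField.mpullback 𝓘(ℝ, E) 𝓘(ℝ, E) (lieExp (G := G)) (leftField X)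
  have hinv := fun {Z : E} (hZ : Z ∈ O) => hO.mfderiv_exp_comp (G := G) hZ
  have hnear : ∀ᶠ Z : E in 𝓝 0, (lieExp Z : G) ∈ U :=
    hO.continuous_exp.continuousAt.eventually_mem (hU.mem_nhds (by rwa [lieExp_zero]))
  have hfe : ContDiffAt ℝ ∞ (fun Y : E => f (lieExp Y)) 0 := by
    have := hO.contDiffAt_comp_mul_exp (f := f) (q := 1) (Z := (0 : E))
      (by rw [lieExp_zero, mul_one]; exact hfa 1 h1U)
    simpa using this
  have hV0 : ∀ X : E, V X 0 = X := by
    intro X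
    have h := hO.mfderiv_exp_zero (G := G) X
    change (mfderiv 𝓘(ℝ, E) 𝓘(ℝ, E) (lieExp (G := G)) 0).inverse (leftField X (lieExp 0)) = X
    rw [← h]
    exact (hinv hO.zero_mem).inverse_apply_self X
  have hVd : ∀ X : E, DifferentiableAt ℝ (V X) 0 := by
    intro X
    have h1 : ContMDiffAt 𝓘(ℝ, E) 𝓘(ℝ, E).tangent 1
        (fun g : G => (⟨g, leftField X g⟩ : TangentBundle 𝓘(ℝ, E) G)) (lieExp (0 : E)) :=
      (contMDiff_leftField X).contMDiffAt
    have h2 := ContMDiffAt.mpullback_vectorField_preimage (n := ∞) h1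
      hO.contMDiff_exp.contMDiffAt (hinv hO.zero_mem)
      (by rw [one_add_one_eq_two]; exact ENat.LEInfty.out)
    exact (contMDiffAt_vectorSpace_iff_contDiffAt.1 h2).differentiableAt one_ne_zero
  have hVl : ∀ X : E, (fun Z : E => fderiv ℝ (fun Y : E => f (lieExp Y)) Z (V X Z)) =ᶠ[𝓝 0]
      fun Z => lder X f (lieExp Z) := by
    intro X
    filter_upwards [hO.mem_nhds, hnear] with Z hZ hZU
    have hfd := (hfa _ hZU).mdifferentiableAt (by simp)
    have hed : MDifferentiableAt 𝓘(ℝ, E) 𝓘(ℝ, E) (lieExp (G := G)) Z :=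
      hO.contMDiff_exp.mdifferentiableAt (by simp)
    rw [hO.lder_eq_mfderiv hfd, ← mfderiv_eq_fderiv]
    have h3 := mfderiv_comp Z hfd hed
    have h4 : mfderiv 𝓘(ℝ, E) 𝓘(ℝ, E) (lieExp (G := G)) Z (V X Z) = leftField X (lieExp Z : G) :=
      (hinv hZ).self_apply_inverse _
    rw [← h4]
    exact congrArg (fun (T : E →L[ℝ] F) => T (V X Z)) h3
  have hl : ∀ X Y : E, DifferentiableAt ℝ (fun Z : E => lder Y f (lieExp Z)) 0 →
      lder X (lder Y f) 1 =
      fderiv ℝ (fun Z : E => fderiv ℝ (fun Y : E => f (lieExp Y)) Z (V Y Z)) 0 (V X 0) := by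
    intro X Y hY
    rw [(hVl Y).fderiv_eq, hV0]
    have h2 : HasDerivAt (fun t : ℝ => t • X) X 0 := by
      simpa using (hasDerivAt_id (0 : ℝ)).smul_const X
    have hY' : DifferentiableAt ℝ (fun Z : E => lder Y f (lieExp Z)) ((0 : ℝ) • X) := by
      simpa using hY
    have h4 := (hY'.hasFDerivAt.comp_hasDerivAt (0 : ℝ) h2).deriv
    simp only [zero_smul] at h4
    rw [← h4, lder]
    simp only [one_mul, Function.comp_def]
  rw [hl X Y hY, hl Y X hX, fderiv_fderiv_apply_sub (hfe.of_le (by exact ENat.LEInfty.out))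
    (hVd X) (hVd Y)]
  have hb : VectorField.lieBracket ℝ (V X) (V Y) 0 = lieAd G X Y := by
    have h5 := VectorField.mpullback_mlieBracket (I := 𝓘(ℝ, E)) (I' := 𝓘(ℝ, E)) (n := ∞)
      (f := lieExp (G := G)) (V := leftField X) (W := leftField Y) (x₀ := (0 : E))
      ((contMDiff_leftField X).mdifferentiableAt (by simp))
      ((contMDiff_leftField Y).mdifferentiableAt (by simp)) hO.contMDiff_exp.contMDiffAt
      (by rw [minSmoothness_of_isRCLikeNormedField]; exact ENat.LEInfty.out)
    rw [← VectorField.lieBracketWithin_univ, ← VectorField.mlieBracketWithin_eq_lieBracketWithin,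
      VectorField.mlieBracketWithin_univ]
    refine h5.symm.trans ?_
    have h6 : VectorField.mlieBracket 𝓘(ℝ, E) (leftField X) (leftField Y) =
        (leftField (lieAd G X Y) : ∀ q : G, TangentSpace 𝓘(ℝ, E) q) :=
      (mulInvariantVector_mlieBracket (I := 𝓘(ℝ, E)) (G := G) X Y).symm
    rw [h6]
    exact hV0 _
  rw [hb, hO.lder_eq_fderiv (hfa 1 h1U)]
  simp only [one_mul]

end IsWeaklyExponential

end LeftDerivative

/-! ### The adjoint representation and the derivative of the exponential map -/

section PartialDerivatives

variable {P : Type*} [NormedAddCommGroup P] [NormedSpace ℝ P]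
  {F : Type*} [NormedAddCommGroup F] [NormedSpace ℝ F]

theorem contDiffAt_partialDeriv {H : P → ℝ → F} {p₀ : P} {t₀ : P → ℝ}
    (hH : ContDiffAt ℝ ∞ (uncurry H) (p₀, t₀ p₀)) (ht : ContDiffAt ℝ ∞ t₀ p₀) :
    ContDiffAt ℝ ∞ (fun p => deriv (H p) (t₀ p)) p₀ := by
  have h := ContDiffAt.fderiv (m := ∞) (n := ∞) hH ht (by simp)
  exact h.clm_apply contDiffAt_const

theorem hasDerivAt_partial_right {H : ℝ → ℝ → F} {s t : ℝ}
    (h : DifferentiableAt ℝ (uncurry H) (s, t)) :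
    HasDerivAt (fun w => H s w) (fderiv ℝ (uncurry H) (s, t) (0, 1)) t :=
  h.hasFDerivAt.comp_hasDerivAt t ((hasDerivAt_const t s).prodMk (hasDerivAt_id t))

theorem hasDerivAt_partial_left {H : ℝ → ℝ → F} {s t : ℝ}
    (h : DifferentiableAt ℝ (uncurry H) (s, t)) :
    HasDerivAt (fun w => H w t) (fderiv ℝ (uncurry H) (s, t) (1, 0)) s :=
  HasFDerivAt.comp_hasDerivAt (f := fun w => (w, t)) s h.hasFDerivAt
    ((hasDerivAt_id s).prodMk (hasDerivAt_const s t))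

theorem deriv_deriv_comm {H : ℝ → ℝ → F} {s t : ℝ} (hH : ContDiffAt ℝ 2 (uncurry H) (s, t)) :
    deriv (fun x => deriv (fun y => H x y) t) s = deriv (fun y => deriv (fun x => H x y) s) t := by
  have hd : DifferentiableAt ℝ (fderiv ℝ (uncurry H)) (s, t) :=
    (hH.fderiv_right (m := 1) (by norm_num)).differentiableAt (by norm_num)
  have hs : IsSymmSndFDerivAt ℝ (uncurry H) (s, t) := hH.isSymmSndFDerivAt (by simp)
  have he : ∀ᶠ z in 𝓝 (s, t), DifferentiableAt ℝ (uncurry H) z := by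
    filter_upwards [(hH.of_le (m := 1) (by norm_num)).eventually (by simp)] with z hz
    exact hz.differentiableAt (by norm_num)
  have he1 : ∀ᶠ x in 𝓝 s, DifferentiableAt ℝ (uncurry H) (x, t) :=
    (Continuous.prodMk_left t).continuousAt.eventually he
  have he2 : ∀ᶠ y in 𝓝 t, DifferentiableAt ℝ (uncurry H) (s, y) :=
    (Continuous.prodMk_right s).continuousAt.eventually he
  have h1 : (fun x => deriv (fun y => H x y) t) =ᶠ[𝓝 s]
      fun x => fderiv ℝ (uncurry H) (x, t) (0, 1) :=
    he1.mono fun x hx => (hasDerivAt_partial_right hx).deriv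
  have h2 : (fun y => deriv (fun x => H x y) s) =ᶠ[𝓝 t]
      fun y => fderiv ℝ (uncurry H) (s, y) (1, 0) :=
    he2.mono fun x hx => (hasDerivAt_partial_left hx).deriv
  have h3 : HasDerivAt (fun x => fderiv ℝ (uncurry H) (x, t) (0, 1))
      (fderiv ℝ (fderiv ℝ (uncurry H)) (s, t) (1, 0) (0, 1)) s := by
    have := hd.hasFDerivAt.comp_hasDerivAt s ((hasDerivAt_id s).prodMk (hasDerivAt_const s t))
    simpa using this.clm_apply (hasDerivAt_const s ((0 : ℝ), (1 : ℝ)))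
  have h4 : HasDerivAt (fun y => fderiv ℝ (uncurry H) (s, y) (1, 0))
      (fderiv ℝ (fderiv ℝ (uncurry H)) (s, t) (0, 1) (1, 0)) t := by
    have := hd.hasFDerivAt.comp_hasDerivAt t ((hasDerivAt_const t s).prodMk (hasDerivAt_id t))
    simpa using this.clm_apply (hasDerivAt_const t ((1 : ℝ), (0 : ℝ)))
  rw [h1.deriv_eq, h2.deriv_eq, h3.deriv, h4.deriv, hs.eq]

end PartialDerivatives

/-! ### The adjoint representation -/

section Adjoint

variable {E : Type*} [NormedAddCommGroup E] [NormedSpace ℝ E] [FiniteDimensional ℝ E]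
  {G : Type*} [Group G] [TopologicalSpace G] [ChartedSpace E G]
  {F : Type*} [NormedAddCommGroup F] [NormedSpace ℝ F]

/-- The adjoint representation of `G`, in exponential coordinates. -/
def Ad (O : Set E) (g : G) : E →L[ℝ] E := fderiv ℝ (fun Y : E => lieLog O (g * lieExp Y * g⁻¹)) 0

/-- The left trivialized derivative of the exponential map at `X`. -/
def dexp (G : Type*) [Group G] [TopologicalSpace G] [ChartedSpace E G] (O : Set E) (X : E) :
    E →L[ℝ] E :=
  fderiv ℝ (fun Y : E => lieLog O ((lieExp X)⁻¹ * lieExp Y : G)) X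

variable [LieGroup 𝓘(ℝ, E) ∞ G] [T2Space G] [MeasurableSpace G] {m : Measure G} {O : Set E}

namespace IsWeaklyExponential

/-- The charts Y ↦ q exp Y, inverted by the logarithm, reduce smoothness on `G` to calculus on `E`.
-/
theorem contMDiffAt_of_comp_exp (hO : IsWeaklyExponential m O) {f : G → F} {q : G}
    (hf : ContDiffAt ℝ ∞ (fun Y : E => f (q * lieExp Y)) 0) :
    ContMDiffAt 𝓘(ℝ, E) 𝓘(ℝ, F) ∞ f q := by
  have h1 : ContMDiffAt 𝓘(ℝ, E) 𝓘(ℝ, E) ∞ (fun x : G => q⁻¹ * x) q :=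
    contMDiff_mul_left.contMDiffAt
  have h2 : ContMDiffAt 𝓘(ℝ, E) 𝓘(ℝ, E) ∞ (fun x : G => lieLog O (q⁻¹ * x)) q :=
    (hO.contMDiffAt_log (by simpa using hO.one_mem)).comp q h1
  have h3 : ContMDiffAt 𝓘(ℝ, E) 𝓘(ℝ, F) ∞ (fun Y : E => f (q * lieExp Y)) (lieLog O (q⁻¹ * q)) := by
    rw [inv_mul_cancel, hO.log_one]; exact hf.contMDiffAt
  refine (h3.comp q h2).congr_of_eventuallyEq ?_
  have h4 : ∀ᶠ x in 𝓝 q, q⁻¹ * x ∈ (lieExp '' O : Set G) :=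
    h1.continuousAt.eventually_mem (hO.isOpen_image.mem_nhds (by simpa using hO.one_mem))
  filter_upwards [h4] with x hx
  simp [exp_log hx]

theorem contMDiffAt_lder (hO : IsWeaklyExponential m O) {f : G → F} {q : G}
    (hf : ContMDiffAt 𝓘(ℝ, E) 𝓘(ℝ, F) ∞ f q) (X : E) :
    ContMDiffAt 𝓘(ℝ, E) 𝓘(ℝ, F) ∞ (lder X f) q := by
  refine hO.contMDiffAt_of_comp_exp ?_
  refine contDiffAt_partialDeriv (H := fun Z t => f (q * lieExp Z * lieExp (t • X))) (t₀ := fun _ => 0)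
    (contMDiffAt_iff_contDiffAt.1 ?_) contDiffAt_const
  have h1 : ContMDiffAt 𝓘(ℝ, E × ℝ) 𝓘(ℝ, E) ∞
      (fun z : E × ℝ => q * lieExp z.1 * lieExp (z.2 • X)) (0, 0) :=
    hO.contMDiffAt_mul_exp (hO.contMDiffAt_mul_exp contMDiffAt_const contDiffAt_fst)
      (contDiffAt_snd.smul contDiffAt_const)
  exact ContMDiffAt.comp (g := f) ((0, 0) : E × ℝ) (by simpa [lieExp_zero] using hf) h1

theorem lder_comm_one_of_contMDiffOn (hO : IsWeaklyExponential m O) {f : G → F} {U : Set G}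
    (hU : IsOpen U) (h1U : 1 ∈ U) (hf : ContMDiffOn 𝓘(ℝ, E) 𝓘(ℝ, F) ∞ f U) (X Y : E) :
    lder X (lder Y f) 1 - lder Y (lder X f) 1 = lder (lieAd G X Y) f 1 := by
  have hfa : ContMDiffAt 𝓘(ℝ, E) 𝓘(ℝ, F) ∞ f 1 := (hf 1 h1U).contMDiffAt (hU.mem_nhds h1U)
  have h : ∀ X : E, DifferentiableAt ℝ (fun Z : E => lder X f (lieExp Z)) 0 := fun X => by
    have := hO.contDiffAt_comp_mul_exp (f := lder X f) (q := 1) (Z := (0 : E))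
      (by simpa [lieExp_zero] using hO.contMDiffAt_lder hfa X)
    simpa using this.differentiableAt (by simp)
  exact hO.lder_comm_one hU h1U hf X Y (h X) (h Y)

/-- By left invariance the identity at `q` is the identity at `1` for the left translate of `f`. -/
theorem lder_comm (hO : IsWeaklyExponential m O) {f : G → F}
    (hf : ContMDiff 𝓘(ℝ, E) 𝓘(ℝ, F) ∞ f) (X Y : E) (q : G) :
    lder X (lder Y f) q - lder Y (lder X f) q = lder (lieAd G X Y) f q := by
  have h := hO.lder_comm_one_of_contMDiffOn isOpen_univ (mem_univ _)
    (hf.comp (contMDiff_mul_left (a := q))).contMDiffOn X Y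
  simpa [lder, mul_assoc] using h

theorem contDiffAt_conj (hO : IsWeaklyExponential m O) (g : G) :
    ContDiffAt ℝ ∞ (fun Y : E => lieLog O (g * lieExp Y * g⁻¹)) 0 :=
  hO.contDiffAt_log_comp ((hO.contMDiffAt_mul_exp contMDiffAt_const contDiffAt_id).mul
    contMDiffAt_const) (by simpa [lieExp_zero] using hO.one_mem)

theorem hasFDerivAt_conj (hO : IsWeaklyExponential m O) (g : G) :
    HasFDerivAt (fun Y : E => lieLog O (g * lieExp Y * g⁻¹)) (Ad O g) 0 :=
  ((hO.contDiffAt_conj g).differentiableAt (by simp)).hasFDerivAt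

theorem eventually_mem_of_continuousAt (hO : IsWeaklyExponential m O) {P : Type*}
    [TopologicalSpace P] {g : P → G} {p : P} (hg : ContinuousAt g p)
    (hp : g p ∈ (lieExp '' O : Set G)) : ∀ᶠ x in 𝓝 p, g x ∈ (lieExp '' O : Set G) :=
  hg.eventually_mem (hO.isOpen_image.mem_nhds hp)

theorem continuousAt_conj_exp (hO : IsWeaklyExponential m O) (g h : G) (Y : E) :
    ContinuousAt (fun Y : E => g * lieExp Y * h) Y :=
  ((hO.contMDiffAt_mul_exp (p := Y) contMDiffAt_const contDiffAt_id).mul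
    contMDiffAt_const).continuousAt

theorem Ad_mul (hO : IsWeaklyExponential m O) (g h : G) :
    Ad O (g * h) = (Ad O g).comp (Ad O h) := by
  have h1 : HasFDerivAt (fun Y : E => lieLog O (g * lieExp Y * g⁻¹)) (Ad O g)
      (lieLog O (h * lieExp (0 : E) * h⁻¹)) := by
    simpa [lieExp_zero, hO.log_one] using hO.hasFDerivAt_conj g
  have h2 := h1.comp (0 : E) (hO.hasFDerivAt_conj h)
  refine (hO.hasFDerivAt_conj (g * h)).unique (h2.congr_of_eventuallyEq ?_)
  filter_upwards [hO.eventually_mem_of_continuousAt (hO.continuousAt_conj_exp h h⁻¹ 0)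
    (by simpa [lieExp_zero] using hO.one_mem)] with Y hY
  simp only [Function.comp_apply, exp_log hY, mul_inv_rev]
  congr 1
  group

theorem eventually_log_exp (hO : IsWeaklyExponential m O) :
    (fun Y : E => lieLog O (lieExp Y : G)) =ᶠ[𝓝 0] id := by
  filter_upwards [hO.mem_nhds] with Y hY
  exact hO.log_exp hY

theorem Ad_one (hO : IsWeaklyExponential m O) : Ad O (1 : G) = ContinuousLinearMap.id ℝ E := by
  refine (hO.hasFDerivAt_conj (1 : G)).unique ((hasFDerivAt_id _).congr_of_eventuallyEq ?_)
  simpa using hO.eventually_log_exp (G := G)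

theorem contDiffAt_Ad_exp (hO : IsWeaklyExponential m O) (X : E) :
    ContDiffAt ℝ ∞ (fun s : ℝ => Ad O (lieExp (s • X) : G)) 0 := by
  refine ContDiffAt.fderiv (f := fun (s : ℝ) (Y : E) =>
    lieLog O (lieExp (s • X) * lieExp Y * (lieExp (s • X))⁻¹ : G)) (g := fun _ => 0) (n := ∞)
    ?_ contDiffAt_const (by simp)
  have h1 : ContMDiffAt 𝓘(ℝ, ℝ × E) 𝓘(ℝ, E) ∞
      (fun z : ℝ × E => (lieExp (z.1 • X) : G)) (0, 0) :=
    hO.contMDiffAt_exp_comp (contDiffAt_fst.smul contDiffAt_const)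
  exact hO.contDiffAt_log_comp ((hO.contMDiffAt_mul_exp h1 contDiffAt_snd).mul h1.inv)
    (by simpa [lieExp_zero] using hO.one_mem)

theorem lder_log_one (hO : IsWeaklyExponential m O) (X : E) : lder X (lieLog (G := G) O) 1 = X := by
  rw [hO.lder_eq_fderiv (hO.contMDiffAt_log hO.one_mem)]
  simp only [one_mul]
  rw [(hO.eventually_log_exp (G := G)).fderiv_eq, fderiv_id]
  rfl

/-- Apply the commutator identity to the logarithm, whose derivative along `L_Z` at `1` is `Z`.
Differentiating `lder Y log` along exp(sX) at s = 0 gives, by the product rule, `A' Y` plus a mixed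
second derivative equal to `lder Y (lder X log)`; so `A' Y` is the commutator. -/
theorem hasDerivAt_Ad_exp_zero (hO : IsWeaklyExponential m O) (X : E) :
    HasDerivAt (fun s : ℝ => Ad O (lieExp (s • X) : G)) (lieAd G X) 0 := by
  have hA := ((hO.contDiffAt_Ad_exp (G := G) X).differentiableAt (by simp)).hasDerivAt
  set A' := deriv (fun s : ℝ => Ad O (lieExp (s • X) : G)) 0 with hA'
  suffices h : A' = lieAd G X by rwa [h] at hA
  refine ContinuousLinearMap.ext fun Y => ?_
  have hcomm := hO.lder_comm_one_of_contMDiffOn hO.isOpen_image hO.one_mem hO.contMDiffOn_log X Y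
  rw [hO.lder_log_one] at hcomm
  rw [← hcomm]
  let r : ℝ → E → E := fun s W => lieLog O (lieExp W * lieExp (s • X) : G)
  have hr : ContDiffAt ℝ ∞ (uncurry r) (0, 0) :=
    hO.contDiffAt_log_comp (hO.contMDiffAt_mul_exp (hO.contMDiffAt_exp_comp contDiffAt_snd)
      (contDiffAt_fst.smul contDiffAt_const)) (by simpa [lieExp_zero] using hO.one_mem)
  have hr1 : ContDiffAt ℝ ∞ (fun s => fderiv ℝ (r s) 0) 0 :=
    ContDiffAt.fderiv (n := ∞) hr contDiffAt_const (by simp)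
  have hrd : ∀ᶠ s : ℝ in 𝓝 0, DifferentiableAt ℝ (r s) 0 := by
    have h1 : ∀ᶠ z in 𝓝 ((0, 0) : ℝ × E), DifferentiableAt ℝ (uncurry r) z := by
      filter_upwards [(hr.of_le (m := 1) ENat.LEInfty.out).eventually (by simp)] with z hz
      exact hz.differentiableAt (by norm_num)
    filter_upwards [(Continuous.prodMk_left (0 : E)).continuousAt.eventually h1] with s hs
    exact DifferentiableAt.comp (g := uncurry r) (f := fun W : E => (s, W)) 0 hs
      ((differentiableAt_const s).prodMk differentiableAt_id)
  -- exp(sX) exp(tY) = (exp(sX) exp(tY) exp(-sX)) exp(sX): the conjugation produces Ad, and the last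
  -- factor is absorbed in `r s`.
  have key : (fun s : ℝ => lder Y (lieLog (G := G) O) (1 * lieExp (s • X))) =ᶠ[𝓝 0]
      fun s => fderiv ℝ (r s) 0 (Ad O (lieExp (s • X) : G) Y) := by
    filter_upwards [hrd] with s hs
    set g : G := lieExp (s • X) with hg
    have h1 : HasDerivAt (fun t : ℝ => t • Y) Y 0 := by
      simpa using (hasDerivAt_id (0 : ℝ)).smul_const Y
    have h2 : HasFDerivAt (fun Y : E => lieLog O (g * lieExp Y * g⁻¹)) (Ad O g) ((0 : ℝ) • Y) := by
      simpa using hO.hasFDerivAt_conj g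
    have h3 := h2.comp_hasDerivAt (0 : ℝ) h1
    have h4 : HasFDerivAt (r s) (fderiv ℝ (r s) 0)
        (((fun Y : E => lieLog O (g * lieExp Y * g⁻¹)) ∘ fun t : ℝ => t • Y) 0) := by
      simpa [lieExp_zero, hO.log_one] using hs.hasFDerivAt
    have h5 := h4.comp_hasDerivAt (0 : ℝ) h3
    rw [← h5.deriv, lder]
    refine Filter.EventuallyEq.deriv_eq ?_
    have hc : ContinuousAt (fun t : ℝ => g * lieExp (t • Y) * g⁻¹) 0 :=
      ContinuousAt.comp (f := fun t : ℝ => t • Y) (hO.continuousAt_conj_exp g g⁻¹ _)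
        (by fun_prop)
    filter_upwards [hO.eventually_mem_of_continuousAt hc
      (by simpa [lieExp_zero] using hO.one_mem)] with t ht
    simp only [r, Function.comp_apply, exp_log ht, ← hg]
    congr 1
    group
  have hX : lder X (lder Y (lieLog (G := G) O)) 1 =
      deriv (fun s : ℝ => fderiv ℝ (r s) 0 (Ad O (lieExp (s • X) : G) Y)) 0 := key.deriv_eq
  have hprod : HasDerivAt (fun s : ℝ => fderiv ℝ (r s) 0 (Ad O (lieExp (s • X) : G) Y)) _ 0 :=
    (hr1.differentiableAt (by simp)).hasDerivAt.clm_apply (hA.clm_apply (hasDerivAt_const 0 Y))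
  have hr0 : fderiv ℝ (r 0) 0 = ContinuousLinearMap.id ℝ E := by
    have : r 0 =ᶠ[𝓝 0] id := by simpa [r, lieExp_zero] using hO.eventually_log_exp (G := G)
    rw [this.fderiv_eq, fderiv_id]
  have hAd0 : Ad O (lieExp ((0 : ℝ) • X) : G) = ContinuousLinearMap.id ℝ E := by
    rw [zero_smul, lieExp_zero, hO.Ad_one]
  have hswap : deriv (fun s => fderiv ℝ (r s) 0) 0 Y = lder Y (lder X (lieLog (G := G) O)) 1 := by
    have h1 : deriv (fun s => fderiv ℝ (r s) 0 Y) 0 = deriv (fun s => fderiv ℝ (r s) 0) 0 Y := by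
      have := ((hr1.differentiableAt (by simp)).hasDerivAt.clm_apply
        (hasDerivAt_const (0 : ℝ) Y)).deriv
      simpa using this
    have h2 : (fun s => fderiv ℝ (r s) 0 Y) =ᶠ[𝓝 0] fun s => deriv (fun w : ℝ => r s (w • Y)) 0 := by
      filter_upwards [hrd] with s hs
      have h1 : HasDerivAt (fun t : ℝ => t • Y) Y 0 := by
        simpa using (hasDerivAt_id (0 : ℝ)).smul_const Y
      have h4 : HasFDerivAt (r s) (fderiv ℝ (r s) 0) ((0 : ℝ) • Y) := by
        simpa using hs.hasFDerivAt
      exact (h4.comp_hasDerivAt (0 : ℝ) h1).deriv.symm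
    rw [← h1, h2.deriv_eq, deriv_deriv_comm (H := fun s w => r s (w • Y))]
    · simp only [lder, r, one_mul]
    · have h0 : ContDiffAt ℝ ∞ (uncurry r) ((fun z : ℝ × ℝ => (z.1, z.2 • Y)) (0, 0)) := by
        simpa using hr
      exact (h0.comp ((0, 0) : ℝ × ℝ) (contDiffAt_fst.prodMk
        (contDiffAt_snd.smul contDiffAt_const))).of_le
          (ENat.LEInfty.out (m := 2))
  rw [hX, hprod.deriv, hAd0, hr0, ← hswap]
  simp

theorem Ad_exp_add (hO : IsWeaklyExponential m O) (X : E) (s t : ℝ) :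
    Ad O (lieExp ((s + t) • X) : G) =
      Ad O (lieExp (s • X) : G) * Ad O (lieExp (t • X) : G) := by
  rw [hO.exp_add_smul, hO.Ad_mul]; rfl

theorem hasDerivAt_Ad_exp (hO : IsWeaklyExponential m O) (X : E) (s : ℝ) :
    HasDerivAt (fun s : ℝ => Ad O (lieExp (s • X) : G))
      (Ad O (lieExp (s • X) : G) * lieAd G X) s := by
  have h1 : HasDerivAt (fun u : ℝ => u - s) 1 s := (hasDerivAt_id s).sub_const s
  have h2 : HasDerivAt (fun s : ℝ => Ad O (lieExp (s • X) : G)) (lieAd G X) (s - s) := by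
    simpa using hO.hasDerivAt_Ad_exp_zero (G := G) X
  have h3 := ((HasDerivAt.scomp (h := fun u : ℝ => u - s) s h2 h1).const_mul (Ad O (lieExp (s • X) : G)))
  rw [one_smul] at h3
  refine h3.congr_of_eventuallyEq (Eventually.of_forall fun u => ?_)
  simp only [Function.comp_apply]
  rw [← hO.Ad_exp_add, add_sub_cancel]

/-- Both sides solve Φ' = Φ ad_X with Φ(0) = 1: the product of Ad(exp sX) with the exponential of -s
ad_X has zero derivative. -/
theorem Ad_exp (hO : IsWeaklyExponential m O) (X : E) (s : ℝ) :
    Ad O (lieExp (s • X) : G) = NormedSpace.exp (s • lieAd G X) := by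
  haveI : CompleteSpace E := FiniteDimensional.complete ℝ E
  have h1 : ∀ s : ℝ, HasDerivAt (fun s : ℝ => Ad O (lieExp (s • X) : G) *
      NormedSpace.exp (s • (-lieAd G X))) 0 s := fun s => by
    have := (hO.hasDerivAt_Ad_exp (G := G) X s).mul (hasDerivAt_exp_smul_const' (-lieAd G X) s)
    convert! this using 1
    noncomm_ring
  have h2 := is_const_of_deriv_eq_zero (fun s => (h1 s).differentiableAt)
    (fun s => (h1 s).deriv) s 0
  simp only [zero_smul, lieExp_zero, hO.Ad_one, NormedSpace.exp_zero, mul_one] at h2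
  letI : NormedAlgebra ℚ (E →L[ℝ] E) := NormedAlgebra.restrictScalars ℚ ℝ _
  have h3 : NormedSpace.exp (s • (-lieAd G X)) * NormedSpace.exp (s • lieAd G X) = 1 := by
    rw [← NormedSpace.exp_add_of_commute, smul_neg, neg_add_cancel, NormedSpace.exp_zero]
    exact (((Commute.refl _).neg_left).smul_left s).smul_right s
  calc Ad O (lieExp (s • X) : G) = Ad O (lieExp (s • X) : G) *
        (NormedSpace.exp (s • (-lieAd G X)) * NormedSpace.exp (s • lieAd G X)) := by
          rw [h3, mul_one]
    _ = NormedSpace.exp (s • lieAd G X) := by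
          rw [← mul_assoc, h2]; exact one_mul _

end IsWeaklyExponential

end Adjoint

/-! ### Hyperbolic series in a Banach algebra -/

section HyperbolicSeries

variable {𝔸 : Type*} [NormedRing 𝔸] [NormedAlgebra ℝ 𝔸] [CompleteSpace 𝔸]

theorem hasSum_cosh (x : 𝔸) :
    HasSum (fun n : ℕ => ((Nat.factorial (2 * n) : ℝ)⁻¹) • x ^ (2 * n))
      ((1 / 2 : ℝ) • (NormedSpace.exp x + NormedSpace.exp (-x))) := by
  have h := ((NormedSpace.exp_series_hasSum_exp' (𝕂 := ℝ) x).add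
    (NormedSpace.exp_series_hasSum_exp' (𝕂 := ℝ) (-x))).const_smul (1 / 2 : ℝ)
  have hinj : Function.Injective (fun n : ℕ => 2 * n) := fun a b h => by
    simpa using h
  rw [← hinj.hasSum_iff] at h
  · refine h.congr_fun fun n => ?_
    simp only [Function.comp_apply]
    rw [(even_two_mul n).neg_pow, ← two_smul ℝ, smul_smul]
    norm_num
  · intro k hk
    have hodd : Odd k := by
      rw [← Nat.not_even_iff_odd]
      rintro ⟨r, hr⟩
      exact hk ⟨r, by simp only; omega⟩
    rw [hodd.neg_pow]
    simp

/-- The series `sinh(tA/2) / (A/2)`. -/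
def sinhSeries (A : 𝔸) (t : ℝ) : 𝔸 :=
  ∑' n : ℕ, (t ^ (2 * n + 1) * ((4 : ℝ) ^ n * (Nat.factorial (2 * n + 1) : ℝ))⁻¹) • A ^ (2 * n)

/-- Differentiated term by term, the series becomes that of cosh(tA/2); for |s| < |t| + 1 it is
dominated by part of the exponential series at (|t| + 1)A/2. -/
theorem hasDerivAt_sinhSeries (A : 𝔸) (t : ℝ) :
    HasDerivAt (sinhSeries A) ((1 / 2 : ℝ) • (NormedSpace.exp ((t / 2) • A) +
      NormedSpace.exp (-((t / 2) • A)))) t := by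
  have hinj : Function.Injective (fun n : ℕ => 2 * n) := fun a b h => by
    simpa using h
  set R : ℝ := |t| + 1
  rw [← (hasSum_cosh ((t / 2) • A)).tsum_eq]
  refine hasDerivAt_tsum_of_isPreconnected (t := Metric.ball 0 R) (y₀ := 0)
    (u := fun n => ‖((Nat.factorial (2 * n) : ℝ)⁻¹) • ((R / 2) • A) ^ (2 * n)‖)
    (g' := fun n s => ((Nat.factorial (2 * n) : ℝ)⁻¹) • ((s / 2) • A) ^ (2 * n))
    ((NormedSpace.norm_expSeries_summable' (𝕂 := ℝ) ((R / 2) • A)).comp_injective hinj)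
    Metric.isOpen_ball (convex_ball 0 R).isPreconnected ?_ ?_ (by simp [R]; positivity) ?_
    (by simp [R])
  · intro n s _
    have h1 : HasDerivAt (fun s : ℝ => s ^ (2 * n + 1) *
        ((4 : ℝ) ^ n * (Nat.factorial (2 * n + 1) : ℝ))⁻¹)
        (((2 * n + 1 : ℕ) : ℝ) * s ^ (2 * n) *
          ((4 : ℝ) ^ n * (Nat.factorial (2 * n + 1) : ℝ))⁻¹) s := by
      simpa using (hasDerivAt_pow (2 * n + 1) s).mul_const _
    convert! h1.smul_const (A ^ (2 * n)) using 1
    rw [smul_pow, smul_smul, Nat.factorial_succ, div_pow, pow_mul (2 : ℝ)]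
    congr 1
    push_cast
    have : (2 * (n : ℝ) + 1) ≠ 0 := by positivity
    field_simp
    norm_num
  · intro n s hs
    rw [smul_pow, smul_pow, norm_smul, norm_smul, norm_smul, norm_smul]
    have : ‖(s / 2) ^ (2 * n)‖ ≤ ‖(R / 2) ^ (2 * n)‖ := by
      rw [norm_pow, norm_pow]
      refine pow_le_pow_left₀ (norm_nonneg _) ?_ _
      have hs' : |s| < R := by simpa using hs
      rw [Real.norm_eq_abs, Real.norm_eq_abs, abs_div, abs_div]
      exact div_le_div_of_nonneg_right (hs'.le.trans (le_abs_self R)) (abs_nonneg _)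
    gcongr
  · simp [summable_zero]

theorem sinhSeries_zero (A : 𝔸) : sinhSeries A 0 = 0 := by simp [sinhSeries]

theorem hasDerivAt_exp_half (A : 𝔸) (t : ℝ) :
    HasDerivAt (fun t : ℝ => NormedSpace.exp ((t / 2) • A))
      ((1 / 2 : ℝ) • (A * NormedSpace.exp ((t / 2) • A))) t := by
  have h1 : HasDerivAt (fun t : ℝ => t / 2) (1 / 2) t := (hasDerivAt_id t).div_const 2
  exact (hasDerivAt_exp_smul_const' A (t / 2)).scomp t h1

theorem hasDerivAt_exp_neg_half (A : 𝔸) (t : ℝ) :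
    HasDerivAt (fun t : ℝ => NormedSpace.exp (-((t / 2) • A)))
      (-((1 / 2 : ℝ) • (A * NormedSpace.exp (-((t / 2) • A))))) t := by
  have h := hasDerivAt_exp_half (-A) t
  simp only [smul_neg, neg_mul] at h
  exact h

/-- `A` need not be invertible, so the closed form of the series is stated after multiplication by
`A`. -/
theorem mul_sinhSeries (A : 𝔸) (t : ℝ) :
    A * sinhSeries A t = NormedSpace.exp ((t / 2) • A) - NormedSpace.exp (-((t / 2) • A)) := by
  have h1 : ∀ t : ℝ, HasDerivAt (fun t => A * sinhSeries A t -
      (NormedSpace.exp ((t / 2) • A) - NormedSpace.exp (-((t / 2) • A)))) 0 t := fun t => by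
    convert! ((hasDerivAt_sinhSeries A t).const_mul A).sub
      ((hasDerivAt_exp_half A t).sub (hasDerivAt_exp_neg_half A t)) using 1
    rw [mul_smul_comm, mul_add]
    module
  have h2 := is_const_of_deriv_eq_zero (fun s => (h1 s).differentiableAt)
    (fun s => (h1 s).deriv) t 0
  simpa [sinhSeries_zero, sub_eq_zero] using h2

theorem exp_half_mul_exp_neg_half (A : 𝔸) :
    NormedSpace.exp A * NormedSpace.exp (-A) = 1 := by
  letI : NormedAlgebra ℚ 𝔸 := NormedAlgebra.restrictScalars ℚ ℝ _
  rw [← NormedSpace.exp_add_of_commute (Commute.refl A).neg_right, add_neg_cancel,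
    NormedSpace.exp_zero]

/-- The solution of `Ξ' = 1 - A Ξ`, `Ξ(0) = 0`. -/
theorem eq_of_linear_ode {A : 𝔸} {Ξ : ℝ → 𝔸} (h0 : Ξ 0 = 0)
    (hΞ : ∀ t, HasDerivAt Ξ (1 - A * Ξ t) t) (t : ℝ) :
    NormedSpace.exp ((t / 2) • A) * Ξ t = sinhSeries A t := by
  letI : NormedAlgebra ℚ 𝔸 := NormedAlgebra.restrictScalars ℚ ℝ _
  have hc : ∀ s : ℝ, A * NormedSpace.exp ((s / 2) • A) = NormedSpace.exp ((s / 2) • A) * A :=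
    fun s => (((Commute.refl A).smul_right (s / 2)).exp_right).eq
  -- The difference D = exp(sA/2) Ξ - sinhSeries A s satisfies D' = -½ A D, whence the integrating
  -- factor exp(sA/2).
  have h1 : ∀ s, HasDerivAt (fun s => NormedSpace.exp ((s / 2) • A) *
      (NormedSpace.exp ((s / 2) • A) * Ξ s - sinhSeries A s)) 0 s := fun s => by
    have h2 := (hasDerivAt_exp_half A s).mul
      (((hasDerivAt_exp_half A s).mul (hΞ s)).sub (hasDerivAt_sinhSeries A s))
    convert! h2 using 1
    have h3 := mul_sinhSeries A s
    set e := NormedSpace.exp ((s / 2) • A) with he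
    set e' := NormedSpace.exp (-((s / 2) • A))
    have h4 : A * e = e * A := hc s
    have h6 : A * e * sinhSeries A s = e * (e - e') := by
      rw [h4, mul_assoc, h3]
    have h7 : A * e * (e * Ξ s) = e * (A * e) * Ξ s := by
      nth_rewrite 1 [h4]; noncomm_ring
    have h8 : e * (e * (A * Ξ s)) = e * (A * e) * Ξ s := by rw [h4]; noncomm_ring
    simp only [Pi.mul_apply, Pi.sub_apply]
    rw [← he, smul_mul_assoc, mul_sub (A * e), h6, h7]
    simp only [smul_mul_assoc, mul_add, mul_sub, mul_smul_comm, mul_one, smul_add, smul_sub]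
    rw [h8, ← mul_assoc e (A * e)]
    module
  have h2 := is_const_of_deriv_eq_zero (fun s => (h1 s).differentiableAt)
    (fun s => (h1 s).deriv) t 0
  have h3 : NormedSpace.exp ((t / 2) • A) *
      (NormedSpace.exp ((t / 2) • A) * Ξ t - sinhSeries A t) = 0 := by
    simpa [sinhSeries_zero, h0] using h2
  have h4 := congrArg (fun x => NormedSpace.exp (-((t / 2) • A)) * x) h3
  simp only [mul_zero, ← mul_assoc] at h4
  have h5 := exp_half_mul_exp_neg_half (-((t / 2) • A))
  rw [neg_neg] at h5
  rw [h5, one_mul] at h4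
  exact sub_eq_zero.1 h4

end HyperbolicSeries

/-! ### The derivative of the exponential map -/

section DerivativeOfExp

variable {E : Type*} [NormedAddCommGroup E] [NormedSpace ℝ E] [FiniteDimensional ℝ E]
  {G : Type*} [Group G] [TopologicalSpace G] [ChartedSpace E G]
  [LieGroup 𝓘(ℝ, E) ∞ G] [T2Space G] [MeasurableSpace G] {m : Measure G} {O : Set E}

namespace IsWeaklyExponential

theorem contDiffAt_log_inv_mul (hO : IsWeaklyExponential m O) (X : E) :
    ContDiffAt ℝ ∞ (fun Y : E => lieLog O ((lieExp X)⁻¹ * lieExp Y : G)) X :=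
  hO.contDiffAt_log_comp (hO.contMDiffAt_mul_exp contMDiffAt_const contDiffAt_id)
    (by simpa using hO.one_mem)

theorem hasFDerivAt_dexp (hO : IsWeaklyExponential m O) (X : E) :
    HasFDerivAt (fun Y : E => lieLog O ((lieExp X)⁻¹ * lieExp Y : G)) (dexp G O X) X :=
  ((hO.contDiffAt_log_inv_mul X).differentiableAt (by simp)).hasFDerivAt

theorem contDiff_dexp (hO : IsWeaklyExponential m O) : ContDiff ℝ ∞ (dexp G O) := by
  rw [contDiff_iff_contDiffAt]
  intro X
  refine ContDiffAt.fderiv (f := fun (X : E) (Y : E) =>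
    lieLog O ((lieExp X)⁻¹ * lieExp Y : G)) (g := id) (n := ∞) ?_ contDiffAt_id (by simp)
  exact hO.contDiffAt_log_comp (hO.contMDiffAt_mul_exp
    (hO.contMDiffAt_exp_comp contDiffAt_fst).inv contDiffAt_snd) (by simpa using hO.one_mem)

theorem dexp_zero (hO : IsWeaklyExponential m O) : dexp G O 0 = ContinuousLinearMap.id ℝ E := by
  refine (hO.hasFDerivAt_dexp 0).unique ((hasFDerivAt_id _).congr_of_eventuallyEq ?_)
  simpa [lieExp_zero] using hO.eventually_log_exp (G := G)

theorem hasFDerivAt_log_smul (hO : IsWeaklyExponential m O) (X : E) (t : ℝ) :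
    HasFDerivAt (fun Y : E => lieLog O ((lieExp (t • X))⁻¹ * lieExp (t • Y) : G))
      (t • dexp G O (t • X)) X := by
  have h1 : HasFDerivAt (fun Y : E => t • Y) (t • ContinuousLinearMap.id ℝ E) X :=
    (hasFDerivAt_id X).const_smul t
  have h2 := HasFDerivAt.comp (f := fun Y : E => t • Y) X (hO.hasFDerivAt_dexp (G := G) (t • X)) h1
  rw [ContinuousLinearMap.comp_smul, ContinuousLinearMap.comp_id] at h2
  exact h2

theorem hasFDerivAt_log_mul (hO : IsWeaklyExponential m O) :
    HasFDerivAt (fun z : E × E => lieLog O (lieExp z.1 * lieExp z.2 : G))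
      (ContinuousLinearMap.fst ℝ E E + ContinuousLinearMap.snd ℝ E E) (0, 0) := by
  have hs : ContDiffAt ℝ ∞ (fun z : E × E => lieLog O (lieExp z.1 * lieExp z.2 : G)) (0, 0) :=
    hO.contDiffAt_log_comp (hO.contMDiffAt_mul_exp (hO.contMDiffAt_exp_comp contDiffAt_fst)
      contDiffAt_snd) (by simpa [lieExp_zero] using hO.one_mem)
  have h := (hs.differentiableAt (by simp)).hasFDerivAt
  have h1 := HasFDerivAt.comp (f := fun e : E => (e, (0 : E))) (0 : E) h (hasFDerivAt_prodMk_left (𝕜 := ℝ) (0 : E) (0 : E))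
  have h2 := HasFDerivAt.comp (f := fun e : E => ((0 : E), e)) (0 : E) h (hasFDerivAt_prodMk_right (𝕜 := ℝ) (0 : E) (0 : E))
  have h1' := h1.unique ((hasFDerivAt_id _).congr_of_eventuallyEq (by
    simpa [Function.comp_def, lieExp_zero] using hO.eventually_log_exp (G := G)))
  have h2' := h2.unique ((hasFDerivAt_id _).congr_of_eventuallyEq (by
    simpa [Function.comp_def, lieExp_zero] using hO.eventually_log_exp (G := G)))
  convert! h using 1
  refine ContinuousLinearMap.ext fun z => ?_
  have e1 := congrArg (fun T : E →L[ℝ] E => T z.1) h1'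
  have e2 := congrArg (fun T : E →L[ℝ] E => T z.2) h2'
  simp only [ContinuousLinearMap.comp_apply, ContinuousLinearMap.inl_apply,
    ContinuousLinearMap.inr_apply, ContinuousLinearMap.id_apply] at e1 e2
  change z.1 + z.2 = _
  nth_rewrite 1 [← e1]
  rw [← e2, ← map_add]
  simp

/-- exp((t+u)X)⁻¹ exp((t+u)Y) is the conjugate of exp(tX)⁻¹ exp(tY) by exp(-uX), times exp(uX)⁻¹
exp(uY). Differentiating at Y = X gives this cocycle relation, because the product in logarithmic
coordinates linearizes to addition at the unit. -/
theorem smul_dexp_add (hO : IsWeaklyExponential m O) (X : E) (t u : ℝ) :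
    (t + u) • dexp G O ((t + u) • X) =
      Ad O (lieExp ((-u) • X) : G) * (t • dexp G O (t • X)) + u • dexp G O (u • X) := by
  have hAd : HasFDerivAt (fun Y : E => lieLog O ((lieExp ((-u) • X) : G) * lieExp Y *
      (lieExp ((-u) • X))⁻¹)) (Ad O (lieExp ((-u) • X) : G))
      (lieLog O ((lieExp (t • X))⁻¹ * lieExp (t • X) : G)) := by
    rw [inv_mul_cancel, hO.log_one]
    exact hO.hasFDerivAt_conj _
  have h1 := HasFDerivAt.comp
    (f := fun Y : E => lieLog O ((lieExp (t • X))⁻¹ * lieExp (t • Y) : G)) X hAd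
    (hO.hasFDerivAt_log_smul X t)
  have h2 := h1.prodMk (hO.hasFDerivAt_log_smul (G := G) X u)
  have h3 : HasFDerivAt (fun z : E × E => lieLog O (lieExp z.1 * lieExp z.2 : G))
      (ContinuousLinearMap.fst ℝ E E + ContinuousLinearMap.snd ℝ E E)
      ((fun Y : E => (((fun Y : E => lieLog O ((lieExp ((-u) • X) : G) * lieExp Y *
        (lieExp ((-u) • X))⁻¹)) ∘
        fun Y : E => lieLog O ((lieExp (t • X))⁻¹ * lieExp (t • Y) : G)) Y,
        lieLog O ((lieExp (u • X))⁻¹ * lieExp (u • Y) : G))) X) := by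
    simpa [lieExp_zero, hO.log_one] using hO.hasFDerivAt_log_mul (G := G)
  have h4 := HasFDerivAt.comp X h3 h2
  refine (hO.hasFDerivAt_log_smul (G := G) X (t + u)).unique ?_
  refine (h4.congr_of_eventuallyEq ?_)
  have c1 : ContinuousAt (fun Y : E => ((lieExp (t • X))⁻¹ * lieExp (t • Y) : G)) X :=
    (hO.contMDiffAt_mul_exp contMDiffAt_const (contDiffAt_const.smul contDiffAt_id)).continuousAt
  have c2 : ContinuousAt (fun Y : E => ((lieExp (u • X))⁻¹ * lieExp (u • Y) : G)) X :=
    (hO.contMDiffAt_mul_exp contMDiffAt_const (contDiffAt_const.smul contDiffAt_id)).continuousAt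
  have c3 : ContinuousAt (fun Y : E => (lieExp ((-u) • X) : G) *
      ((lieExp (t • X))⁻¹ * lieExp (t • Y)) * (lieExp ((-u) • X))⁻¹) X :=
    ((contMDiffAt_const.mul (hO.contMDiffAt_mul_exp contMDiffAt_const
      (contDiffAt_const.smul contDiffAt_id))).mul contMDiffAt_const).continuousAt
  filter_upwards [hO.eventually_mem_of_continuousAt c1 (by simpa using hO.one_mem),
    hO.eventually_mem_of_continuousAt c2 (by simpa using hO.one_mem),
    hO.eventually_mem_of_continuousAt c3 (by simpa using hO.one_mem)] with Y hY1 hY2 hY3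
  simp only [Function.comp_apply, exp_log hY1]
  rw [exp_log hY3, exp_log hY2, neg_smul, hO.exp_neg, hO.exp_add_smul, hO.exp_add_smul]
  congr 1
  group

/-- The cocycle relation is differentiated in u at 0; the minus sign comes from Ad(exp(-uX)). -/
theorem hasDerivAt_smul_dexp (hO : IsWeaklyExponential m O) (X : E) (t : ℝ) :
    HasDerivAt (fun t : ℝ => t • dexp G O (t • X)) (1 - lieAd G X * (t • dexp G O (t • X))) t := by
  have h0 : HasDerivAt (fun u : ℝ => u • dexp G O (u • X)) 1 0 := by
    have hd : HasDerivAt (fun u : ℝ => dexp G O (u • X)) _ 0 :=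
      DifferentiableAt.hasDerivAt (((hO.contDiff_dexp (G := G)).differentiable (by simp)).comp
        (differentiable_id.smul_const X) 0)
    have := (hasDerivAt_id (0 : ℝ)).smul hd
    simp only [id, zero_smul, hO.dexp_zero, one_smul, zero_add] at this
    exact this
  have hA : HasDerivAt (fun u : ℝ => Ad O (lieExp ((-u) • X) : G)) (-lieAd G X) 0 := by
    have h1 : HasDerivAt (fun s : ℝ => Ad O (lieExp (s • X) : G)) (lieAd G X) (-0) := by
      simpa using hO.hasDerivAt_Ad_exp_zero (G := G) X
    have := HasDerivAt.scomp (h := fun u : ℝ => -u) (0 : ℝ) h1 (hasDerivAt_neg 0)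
    simpa [Function.comp_def] using this
  have h1 := (hA.mul_const (t • dexp G O (t • X))).add h0
  have h2 : HasDerivAt (fun u : ℝ => (t + u) • dexp G O ((t + u) • X))
      (-lieAd G X * (t • dexp G O (t • X)) + 1) (t - t) := by
    rw [sub_self]
    exact h1.congr_of_eventuallyEq (Eventually.of_forall fun u => hO.smul_dexp_add X t u)
  have h3 := HasDerivAt.scomp (h := fun s : ℝ => s - t) t h2 ((hasDerivAt_id t).sub_const t)
  rw [one_smul] at h3
  convert! h3.congr_of_eventuallyEq (f₁ := fun t : ℝ => t • dexp G O (t • X))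
    (Eventually.of_forall fun s => ?_) using 1
  · rw [neg_mul, sub_eq_add_neg, add_comm]
  · simp

/-- `λ(ad_X)`, with `λ(x) = (2/x) sinh(x/2)`, in terms of the derivative of the exponential map. -/
theorem tsum_lieAd_eq (hO : IsWeaklyExponential m O) (X : E) :
    (∑' n : ℕ, ((4 : ℝ) ^ n * (Nat.factorial (2 * n + 1) : ℝ))⁻¹ • (lieAd G X) ^ (2 * n)) =
      Ad O (lieExp ((1 / 2 : ℝ) • X) : G) * dexp G O X := by
  haveI : CompleteSpace E := FiniteDimensional.complete ℝ E
  have h := eq_of_linear_ode (by simp) (hO.hasDerivAt_smul_dexp (G := G) X) 1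
  rw [hO.Ad_exp]
  simp only [one_smul] at h
  rw [h, sinhSeries]
  simp

end IsWeaklyExponential

end DerivativeOfExp

/-! ### The Jacobian of the exponential map and the Haar measure -/

section Density

variable {E : Type*} [NormedAddCommGroup E] [NormedSpace ℝ E] [FiniteDimensional ℝ E]
  {G : Type*} [Group G] [TopologicalSpace G] [ChartedSpace E G]

theorem contDiff_clm_det : ContDiff ℝ ∞ (fun f : E →L[ℝ] E => f.det) := by
  let b := Module.finBasis ℝ E
  have h : (fun f : E →L[ℝ] E => f.det) =
      fun f => ∑ σ : Equiv.Perm (Fin (Module.finrank ℝ E)),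
        Equiv.Perm.sign σ • ∏ i, (b.coord (σ i)).toContinuousLinearMap (f (b i)) := by
    funext f
    rw [ContinuousLinearMap.det, ← LinearMap.det_toMatrix b, Matrix.det_apply]
    simp [LinearMap.toMatrix_apply]
  rw [h]
  refine ContDiff.sum fun σ _ => ContDiff.const_smul _ (contDiff_prod fun i _ => ?_)
  exact (ContinuousLinearMap.contDiff _).comp (contDiff_id.clm_apply contDiff_const)

theorem clm_det_mul (A B : E →L[ℝ] E) : (A * B).det = A.det * B.det :=
  LinearMap.det_comp (A : E →ₗ[ℝ] E) (B : E →ₗ[ℝ] E)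

theorem clm_det_one : (1 : E →L[ℝ] E).det = 1 := LinearMap.det_id

/-- The square root of the modular function of `G`. -/
def modRoot (O : Set E) (g : G) : ℝ := Real.sqrt |(Ad O g).det|

variable [LieGroup 𝓘(ℝ, E) ∞ G]

theorem lieAd_neg (X : E) : lieAd G (-X) = -lieAd G X := by
  haveI : LieGroup 𝓘(ℝ, E) (minSmoothness ℝ 3) G := lieGroup_minSmoothness 3
  haveI : CompleteSpace E := FiniteDimensional.complete ℝ E
  refine ContinuousLinearMap.ext fun Y => ?_
  exact neg_lie (L := GroupLieAlgebra 𝓘(ℝ, E) G) (M := GroupLieAlgebra 𝓘(ℝ, E) G) X Y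

theorem densF_neg (X : E) : densF G (-X) = densF G X := by
  simp only [densF, lieAd_neg, (even_two_mul _).neg_pow]

variable [T2Space G] [MeasurableSpace G] {m : Measure G} {O : Set E}

namespace IsWeaklyExponential

theorem Ad_det_ne_zero (hO : IsWeaklyExponential m O) (g : G) : (Ad O g).det ≠ 0 := by
  have h := congrArg ContinuousLinearMap.det (hO.Ad_mul g g⁻¹)
  rw [mul_inv_cancel, hO.Ad_one] at h
  intro h0
  have h1 : ((Ad O g).comp (Ad O g⁻¹)).det = (Ad O g).det * (Ad O g⁻¹).det := clm_det_mul _ _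
  rw [h1, h0, zero_mul] at h
  exact one_ne_zero (clm_det_one.symm.trans h)

theorem modRoot_pos (hO : IsWeaklyExponential m O) (g : G) : 0 < modRoot O g :=
  Real.sqrt_pos.2 (abs_pos.2 (hO.Ad_det_ne_zero g))

theorem modRoot_mul (hO : IsWeaklyExponential m O) (g h : G) :
    modRoot O (g * h) = modRoot O g * modRoot O h := by
  have h1 : ((Ad O g).comp (Ad O h)).det = (Ad O g).det * (Ad O h).det := clm_det_mul _ _
  rw [modRoot, hO.Ad_mul, h1, abs_mul, Real.sqrt_mul (abs_nonneg _)]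
  rfl

theorem modRoot_sq (g : G) : modRoot O g ^ 2 = |(Ad O g).det| := Real.sq_sqrt (abs_nonneg _)

theorem modRoot_one (hO : IsWeaklyExponential m O) : modRoot O (1 : G) = 1 := by
  have h := hO.modRoot_mul (1 : G) 1
  rw [mul_one] at h
  exact (mul_left_cancel₀ (hO.modRoot_pos 1).ne' (by rw [mul_one, ← h])).symm

theorem modRoot_inv (hO : IsWeaklyExponential m O) (g : G) : modRoot O g⁻¹ = (modRoot O g)⁻¹ := by
  refine eq_inv_of_mul_eq_one_left ?_
  rw [← hO.modRoot_mul, inv_mul_cancel, hO.modRoot_one]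

theorem contDiff_Ad_exp_half (hO : IsWeaklyExponential m O) :
    ContDiff ℝ ∞ (fun X : E => Ad O (lieExp ((1 / 2 : ℝ) • X) : G)) := by
  rw [contDiff_iff_contDiffAt]
  intro X
  refine ContDiffAt.fderiv (f := fun (X : E) (Y : E) =>
    lieLog O (lieExp ((1 / 2 : ℝ) • X) * lieExp Y * (lieExp ((1 / 2 : ℝ) • X))⁻¹ : G))
    (g := fun _ => 0) (n := ∞) ?_ contDiffAt_const (by simp)
  have h1 : ContMDiffAt 𝓘(ℝ, E × E) 𝓘(ℝ, E) ∞
      (fun z : E × E => (lieExp ((1 / 2 : ℝ) • z.1) : G)) (X, 0) :=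
    hO.contMDiffAt_exp_comp (contDiffAt_const.smul contDiffAt_fst)
  exact hO.contDiffAt_log_comp ((hO.contMDiffAt_mul_exp h1 contDiffAt_snd).mul h1.inv)
    (by simpa [lieExp_zero] using hO.one_mem)

theorem densF_eq (hO : IsWeaklyExponential m O) (X : E) :
    densF G X = Real.sqrt |(Ad O (lieExp ((1 / 2 : ℝ) • X) : G) * dexp G O X).det| := by
  rw [densF, hO.tsum_lieAd_eq]

/-- The factor Ad(exp(X/2)) in λ(ad_X) contributes exactly the root of the modular function at exp
X. All later density computations reduce to this identity and the multiplicativity of `modRoot`. -/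
theorem densF_sq (hO : IsWeaklyExponential m O) (X : E) :
    densF G X ^ 2 = modRoot O (lieExp X : G) * |(dexp G O X).det| := by
  have h : modRoot O (lieExp X : G) = modRoot O (lieExp ((1 / 2 : ℝ) • X) : G) ^ 2 := by
    rw [← hO.exp_half_mul_half, hO.modRoot_mul, sq]
  rw [hO.densF_eq, Real.sq_sqrt (abs_nonneg _), clm_det_mul, abs_mul, ← modRoot_sq, h]

theorem contDiff_tsum_det (hO : IsWeaklyExponential m O) :
    ContDiff ℝ ∞ (fun X : E => (Ad O (lieExp ((1 / 2 : ℝ) • X) : G) * dexp G O X).det) :=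
  contDiff_clm_det.comp (hO.contDiff_Ad_exp_half.clm_comp hO.contDiff_dexp)

theorem continuous_densF (hO : IsWeaklyExponential m O) : Continuous (densF G : E → ℝ) := by
  have h : (densF G : E → ℝ) = fun X =>
      Real.sqrt |(Ad O (lieExp ((1 / 2 : ℝ) • X) : G) * dexp G O X).det| := funext hO.densF_eq
  rw [h]
  exact (hO.contDiff_tsum_det.continuous.abs).sqrt

theorem dexp_det_ne_zero (hO : IsWeaklyExponential m O) {X : E} (hX : X ∈ O) :
    (dexp G O X).det ≠ 0 := by
  have hs : DifferentiableAt ℝ (fun Z : E => lieLog O (lieExp X * lieExp Z : G)) 0 :=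
    (hO.contDiffAt_log_comp (hO.contMDiffAt_mul_exp contMDiffAt_const contDiffAt_id)
      (by simpa [lieExp_zero] using mem_image_of_mem _ hX)).differentiableAt (by simp)
  have h1 : HasFDerivAt (fun Z : E => lieLog O (lieExp X * lieExp Z : G))
      (fderiv ℝ (fun Z : E => lieLog O (lieExp X * lieExp Z : G)) 0) (lieLog O ((lieExp X)⁻¹ * lieExp X : G)) := by
    rw [inv_mul_cancel, hO.log_one]; exact hs.hasFDerivAt
  have h2 := HasFDerivAt.comp (𝕜 := ℝ)
    (f := fun Y : E => lieLog O ((lieExp X)⁻¹ * lieExp Y : G)) X h1 (hO.hasFDerivAt_dexp X)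
  have hc : ContinuousAt (fun Y : E => ((lieExp X)⁻¹ * lieExp Y : G)) X :=
    (hO.contMDiffAt_mul_exp contMDiffAt_const contDiffAt_id).continuousAt
  have h3 := h2.unique ((hasFDerivAt_id (𝕜 := ℝ) X).congr_of_eventuallyEq (by
    filter_upwards [hO.eventually_mem_of_continuousAt hc (by simpa using hO.one_mem),
      hO.isOpen.mem_nhds hX] with Y hY hYO
    simp [exp_log hY, hO.log_exp hYO]))
  have h4 := congrArg ContinuousLinearMap.det h3
  intro h0
  have h5 := clm_det_mul (fderiv ℝ (fun Z : E => lieLog O (lieExp X * lieExp Z : G)) 0) (dexp G O X)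
  rw [h0, mul_zero] at h5
  exact one_ne_zero (clm_det_one.symm.trans (h4.symm.trans h5))

theorem tsum_det_ne_zero (hO : IsWeaklyExponential m O) {X : E} (hX : X ∈ O) :
    (Ad O (lieExp ((1 / 2 : ℝ) • X) : G) * dexp G O X).det ≠ 0 := by
  rw [clm_det_mul]
  exact mul_ne_zero (hO.Ad_det_ne_zero _) (hO.dexp_det_ne_zero hX)

theorem densF_pos (hO : IsWeaklyExponential m O) {X : E} (hX : X ∈ O) : 0 < densF G X := by
  rw [hO.densF_eq]
  exact Real.sqrt_pos.2 (abs_pos.2 (hO.tsum_det_ne_zero hX))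

theorem contDiffAt_densF (hO : IsWeaklyExponential m O) {X : E} (hX : X ∈ O) :
    ContDiffAt ℝ ∞ (densF G : E → ℝ) X := by
  have h : (densF G : E → ℝ) = fun X =>
      Real.sqrt |(Ad O (lieExp ((1 / 2 : ℝ) • X) : G) * dexp G O X).det| := funext hO.densF_eq
  rw [h]
  exact (hO.contDiff_tsum_det.contDiffAt.abs (hO.tsum_det_ne_zero hX)).sqrt
    (abs_pos.2 (hO.tsum_det_ne_zero hX)).ne'

/-- The derivative of two-sided translations in exponential coordinates. -/
theorem hasFDerivAt_log_mul_exp_mul (hO : IsWeaklyExponential m O) {a b : G} {Y : E}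
    (hU : a * lieExp Y * b ∈ (lieExp '' O : Set G)) :
    ∃ T : E →L[ℝ] E, HasFDerivAt (fun Y : E => lieLog O (a * lieExp Y * b)) T Y ∧
      |T.det| * |(dexp G O (lieLog O (a * lieExp Y * b))).det| =
        |(Ad O b⁻¹).det| * |(dexp G O Y).det| := by
  have hs : DifferentiableAt ℝ (fun Y : E => lieLog O (a * lieExp Y * b)) Y :=
    (hO.contDiffAt_log_comp ((hO.contMDiffAt_mul_exp contMDiffAt_const contDiffAt_id).mul
      contMDiffAt_const) hU).differentiableAt (by simp)
  refine ⟨_, hs.hasFDerivAt, ?_⟩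
  have h1 := HasFDerivAt.comp Y (hO.hasFDerivAt_dexp (lieLog O (a * lieExp Y * b))) hs.hasFDerivAt
  have h2 : HasFDerivAt (fun Y : E => lieLog O (b⁻¹ * lieExp Y * b⁻¹⁻¹)) (Ad O b⁻¹)
      (lieLog O ((lieExp Y)⁻¹ * lieExp Y : G)) := by
    rw [inv_mul_cancel, hO.log_one]; exact hO.hasFDerivAt_conj b⁻¹
  have h3 := HasFDerivAt.comp (f := fun Z : E => lieLog O ((lieExp Y)⁻¹ * lieExp Z : G)) Y h2
    (hO.hasFDerivAt_dexp Y)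
  have c1 : ContinuousAt (fun Z : E => ((lieExp Y)⁻¹ * lieExp Z : G)) Y :=
    (hO.contMDiffAt_mul_exp contMDiffAt_const contDiffAt_id).continuousAt
  have h4 := h1.unique (h3.congr_of_eventuallyEq (by
    filter_upwards [hO.eventually_mem_of_continuousAt (hO.continuousAt_conj_exp a b Y) hU,
      hO.eventually_mem_of_continuousAt c1 (by simpa using hO.one_mem)] with Z hZ hZ'
    simp only [Function.comp_apply, exp_log hU, exp_log hZ, exp_log hZ']
    congr 1
    group))
  have h5 := congrArg (fun T => |ContinuousLinearMap.det T|) h4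
  have e1 : ∀ A B : E →L[ℝ] E, |(A.comp B).det| = |A.det| * |B.det| := fun A B => by
    rw [← abs_mul, ← clm_det_mul]; rfl
  simp only [e1] at h5
  rw [mul_comm]
  exact h5

end IsWeaklyExponential

end Density

/-! ### The Haar measure in exponential coordinates -/

section HaarMeasure

variable {E : Type*} [NormedAddCommGroup E] [NormedSpace ℝ E] [FiniteDimensional ℝ E]
  [MeasurableSpace E] [BorelSpace E]
  {G : Type*} [Group G] [TopologicalSpace G] [T2Space G] [SecondCountableTopology G]
  [ChartedSpace E G] [LieGroup 𝓘(ℝ, E) ∞ G] [MeasurableSpace G] [BorelSpace G]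
  {m : Measure G} {O : Set E}

/-- The measure on `G` whose density in exponential coordinates is the Jacobian of the
exponential map. -/
def expMeasure (G : Type*) [Group G] [TopologicalSpace G] [ChartedSpace E G] [MeasurableSpace G]
    (μ : Measure E) (O : Set E) : Measure G :=
  ((μ.restrict O).withDensity fun X => ENNReal.ofReal |(dexp G O X).det|).map lieExp

variable [IsTopologicalGroup G] [LocallyCompactSpace G] [m.IsHaarMeasure]
  {μ : Measure E} [μ.IsAddHaarMeasure]

namespace IsWeaklyExponential

theorem measurable_exp (hO : IsWeaklyExponential m O) : Measurable (lieExp (G := G) : E → G) :=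
  hO.continuous_exp.measurable

/-- No density of `m` in the chart is known yet, so null sets are transported by invariance alone.
Every left translate of `N` is `m`-null, so by Fubini almost every right translate of `N` has a null
preimage in `O`. Countably many such translates suffice, and differentiable maps preserve Lebesgue
null sets. -/
theorem measure_preimage_exp_eq_zero (hO : IsWeaklyExponential m O) {N : Set G}
    (hNm : MeasurableSet N) (hN : m N = 0) : μ (O ∩ lieExp ⁻¹' N) = 0 := by
  let ρ : Measure G := (μ.restrict O).map lieExp
  have hρ : ∀ {S : Set G}, MeasurableSet S → ρ S = μ (O ∩ lieExp ⁻¹' S) := fun {S} hS => by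
    rw [Measure.map_apply hO.measurable_exp hS, Measure.restrict_apply (hO.measurable_exp hS),
      inter_comm]
  haveI : SFinite ρ := inferInstance
  have hSm : MeasurableSet {z : G × G | z.1 * z.2 ∈ N} := measurable_mul hNm
  have h1 : (ρ.prod m) {z : G × G | z.1 * z.2 ∈ N} = 0 := by
    refine Measure.measure_prod_null_of_ae_null hSm (Eventually.of_forall fun x => ?_)
    change m ((fun y => x * y) ⁻¹' N) = 0
    rw [measure_preimage_mul]; exact hN
  have h2 : (m.prod ρ) {z : G × G | z.2 * z.1 ∈ N} = 0 := by
    have hm : Measurable fun z : G × G => z.2 * z.1 := measurable_snd.mul measurable_fst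
    rw [← Measure.prod_swap, Measure.map_apply measurable_swap
      (show MeasurableSet {z : G × G | z.2 * z.1 ∈ N} from hm hNm)]
    exact h1
  have h3 : ∀ᵐ y ∂m, ρ {x | x * y ∈ N} = 0 := Measure.measure_ae_null_of_prod_null h2
  obtain ⟨t, hts, htc, htd⟩ := (Measure.dense_of_ae h3).exists_countable_dense_subset
  -- For `Z ∈ O` the condition exp(Z) y⁻¹ ∈ exp(O) is open in y and holds at y = 1, so some y of the
  -- countable dense set satisfies it.
  have hcover : O ∩ lieExp ⁻¹' N ⊆
      ⋃ y ∈ t, {Z | Z ∈ O ∧ lieExp Z ∈ N ∧ lieExp Z * y⁻¹ ∈ (lieExp '' O : Set G)} := by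
    rintro Z ⟨hZ, hZN⟩
    have hc : Continuous fun y : G => lieExp Z * y⁻¹ := by fun_prop
    obtain ⟨y, hy, hyt⟩ := htd.exists_mem_open (hO.isOpen_image.preimage hc)
      ⟨1, by simpa using mem_image_of_mem _ hZ⟩
    exact mem_biUnion hy ⟨hZ, hZN, hyt⟩
  refine measure_mono_null hcover ((measure_biUnion_null_iff htc).2 fun y hy => ?_)
  let B : Set E := {X | X ∈ O ∧ lieExp X * y ∈ N ∧ lieExp X * y ∈ (lieExp '' O : Set G)}
  have hB : μ B = 0 := by
    have h4 : ρ {x | x * y ∈ N} = 0 := hts hy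
    have h5 : μ (O ∩ lieExp ⁻¹' {x | x * y ∈ N}) = 0 :=
      (hρ (measurable_mul_const y hNm)).symm.trans h4
    have h6 : B ⊆ O ∩ lieExp ⁻¹' {x | x * y ∈ N} := fun X hX => ⟨hX.1, hX.2.1⟩
    exact measure_mono_null h6 h5
  have hdiff : DifferentiableOn ℝ (fun X : E => lieLog O (lieExp X * y : G)) B := by
    intro X hX
    exact ((hO.contDiffAt_log_comp ((hO.contMDiffAt_exp_comp contDiffAt_id).mul contMDiffAt_const)
      hX.2.2).differentiableAt (by simp)).differentiableWithinAt
  refine measure_mono_null ?_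
    (addHaar_image_eq_zero_of_differentiableOn_of_addHaar_eq_zero μ hdiff hB)
  rintro Z ⟨hZ, hZN, hZU⟩
  refine ⟨lieLog O (lieExp Z * y⁻¹), ⟨log_mem hZU, ?_, ?_⟩, ?_⟩
  · simpa [exp_log hZU] using hZN
  · simpa [exp_log hZU] using mem_image_of_mem _ hZ
  · simp [exp_log hZU, hO.log_exp hZ]

theorem measurable_ofReal_det (hO : IsWeaklyExponential m O) :
    Measurable fun X : E => ENNReal.ofReal |(dexp G O X).det| :=
  (ContinuousLinearMap.continuous_det.comp
    hO.contDiff_dexp.continuous).abs.measurable.ennreal_ofReal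

theorem expMeasure_apply (hO : IsWeaklyExponential m O) {B : Set G} (hB : MeasurableSet B) :
    expMeasure G μ O B = ∫⁻ X in O ∩ lieExp ⁻¹' B, ENNReal.ofReal |(dexp G O X).det| ∂μ := by
  rw [expMeasure, Measure.map_apply hO.measurable_exp hB,
    withDensity_apply _ (hO.measurable_exp hB), Measure.restrict_restrict (hO.measurable_exp hB),
    inter_comm]

/-- Change of variables along Y ↦ log(a exp(Y) b), with the Jacobian of
`hasFDerivAt_log_mul_exp_mul`. The case b = 1 gives left invariance, the case a = 1 the modular
function. -/
theorem expMeasure_preimage (hO : IsWeaklyExponential m O) (a b : G) {B : Set G}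
    (hB : MeasurableSet B) :
    expMeasure G μ O B = ENNReal.ofReal |(Ad O b⁻¹).det| *
      expMeasure G μ O ((fun x => a * x * b) ⁻¹' B) := by
  have hmul : Measurable fun x : G => a * x * b := by fun_prop
  have hmul' : Measurable fun x : G => a⁻¹ * x * b⁻¹ := by fun_prop
  have hUm : MeasurableSet (lieExp '' O : Set G) := hO.isOpen_image.measurableSet
  let ψ : E → E := fun Y => lieLog O (a * lieExp Y * b)
  let s : Set E := O ∩ lieExp ⁻¹' ((fun x => a * x * b) ⁻¹' (B ∩ lieExp '' O))
  have hs : MeasurableSet s :=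
    hO.isOpen.measurableSet.inter (hO.measurable_exp (hmul (hB.inter hUm)))
  have hT : ∀ Y, ∃ T : E →L[ℝ] E, Y ∈ s → HasFDerivAt ψ T Y ∧
      |T.det| * |(dexp G O (ψ Y)).det| = |(Ad O b⁻¹).det| * |(dexp G O Y).det| := fun Y => by
    by_cases hY : Y ∈ s
    · obtain ⟨T, hT⟩ := hO.hasFDerivAt_log_mul_exp_mul hY.2.2
      exact ⟨T, fun _ => hT⟩
    · exact ⟨0, fun h => absurd h hY⟩
  choose T hT using hT
  have hinj : InjOn ψ s := by
    intro Y hY Z hZ h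
    have h1 := congrArg (lieExp (G := G)) h
    simp only [ψ, exp_log hY.2.2, exp_log hZ.2.2] at h1
    exact hO.injOn hY.1 hZ.1 (mul_left_cancel (mul_right_cancel h1))
  have himg : ψ '' s = O ∩ lieExp ⁻¹' (B ∩ (fun x => a⁻¹ * x * b⁻¹) ⁻¹' (lieExp '' O)) := by
    ext Z
    constructor
    · rintro ⟨Y, hY, rfl⟩
      have e : a⁻¹ * (a * lieExp Y * b) * b⁻¹ = lieExp Y := by group
      refine ⟨log_mem hY.2.2, ?_, ?_⟩
      · simpa only [ψ, mem_preimage, exp_log hY.2.2] using hY.2.1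
      · simpa only [ψ, mem_preimage, exp_log hY.2.2, e] using mem_image_of_mem _ hY.1
    · rintro ⟨hZ, hZB, hZU⟩
      have e : a * (a⁻¹ * lieExp Z * b⁻¹) * b = lieExp Z := by group
      have hZU' : a⁻¹ * lieExp Z * b⁻¹ ∈ (lieExp '' O : Set G) := hZU
      refine ⟨lieLog O (a⁻¹ * lieExp Z * b⁻¹), ⟨log_mem hZU', ?_⟩, ?_⟩
      · simp only [mem_preimage, exp_log hZU', e]
        exact ⟨hZB, mem_image_of_mem _ hZ⟩
      · simp only [ψ, exp_log hZU', e, hO.log_exp hZ]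
  have hnull : ∀ a b : G, m ((fun x => a * x * b) ⁻¹' (lieExp '' O)ᶜ) = 0 := fun a b => by
    have h1 := measure_preimage_mul m a ((fun x => x * b) ⁻¹' (lieExp '' O)ᶜ)
    have h2 : m ((fun x => x * b) ⁻¹' (lieExp '' O)ᶜ) = 0 :=
      (quasiMeasurePreserving_mul_right m b).preimage_null hO.null_compl
    rw [← h2, ← h1]
    rfl
  -- Points of `O` whose translate leaves exp(O) may be discarded: they form a null set by
  -- `measure_preimage_exp_eq_zero`.
  have hE1 : expMeasure G μ O B = ∫⁻ X in ψ '' s, ENNReal.ofReal |(dexp G O X).det| ∂μ := by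
    rw [hO.expMeasure_apply hB]
    refine setLIntegral_congr (ae_eq_set.2 ⟨?_, ?_⟩)
    · refine measure_mono_null ?_ (hO.measure_preimage_exp_eq_zero (μ := μ) (hmul' hUm.compl)
        (hnull a⁻¹ b⁻¹))
      rw [himg]
      rintro Z ⟨⟨h1, h2⟩, h3⟩
      exact ⟨h1, fun h4 => h3 ⟨h1, h2, h4⟩⟩
    · refine measure_mono_null (t := ∅) (fun Z hZ => ?_) measure_empty
      rw [himg] at hZ
      exact hZ.2 ⟨hZ.1.1, hZ.1.2.1⟩
  have hE2 : expMeasure G μ O ((fun x => a * x * b) ⁻¹' B) =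
      ∫⁻ X in s, ENNReal.ofReal |(dexp G O X).det| ∂μ := by
    rw [hO.expMeasure_apply (hmul hB)]
    refine setLIntegral_congr (ae_eq_set.2 ⟨?_, ?_⟩)
    · refine measure_mono_null ?_ (hO.measure_preimage_exp_eq_zero (μ := μ) (hmul hUm.compl)
        (hnull a b))
      rintro Z ⟨⟨h1, h2⟩, h3⟩
      exact ⟨h1, fun h4 => h3 ⟨h1, h2, h4⟩⟩
    · exact measure_mono_null (t := ∅) (fun Z hZ => hZ.2 ⟨hZ.1.1, hZ.1.2.1⟩) measure_empty
  rw [hE1, hE2, lintegral_image_eq_lintegral_abs_det_fderiv_mul μ hs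
    (fun Y hY => (hT Y hY).1.hasFDerivWithinAt) hinj,
    ← lintegral_const_mul _ hO.measurable_ofReal_det]
  refine setLIntegral_congr_fun hs fun Y hY => ?_
  rw [← ENNReal.ofReal_mul (abs_nonneg _), ← ENNReal.ofReal_mul (abs_nonneg _), (hT Y hY).2]

/-- Finiteness on compact sets rests on the precompactness hypothesis: the logarithms of the part in
exp(O) stay in a compact set, where the density is bounded. Open sets have positive measure because
exp(O) is dense and the density does not vanish on `O`. -/
theorem isHaarMeasure_expMeasure (hO : IsWeaklyExponential m O) :
    (expMeasure G μ O).IsHaarMeasure := by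
  have hleft : (expMeasure G μ O).IsMulLeftInvariant := by
    refine ⟨fun g => Measure.ext fun B hB => ?_⟩
    rw [Measure.map_apply (measurable_const_mul g) hB, hO.expMeasure_preimage g 1 hB]
    rw [inv_one, hO.Ad_one]
    have : |(ContinuousLinearMap.id ℝ E).det| = 1 := by
      rw [show (ContinuousLinearMap.id ℝ E).det = 1 from clm_det_one, abs_one]
    simp [this]
  have hfin : IsFiniteMeasureOnCompacts (expMeasure G μ O) := by
    refine ⟨fun K hK => ?_⟩
    rw [hO.expMeasure_apply hK.measurableSet]
    have hS : IsCompact (closure (lieLog O '' (K ∩ lieExp '' O))) := by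
      refine hO.precompact _ inter_subset_right ?_
      exact hK.of_isClosed_subset isClosed_closure
        (closure_minimal inter_subset_left hK.isClosed)
    have hsub : O ∩ lieExp ⁻¹' K ⊆ closure (lieLog O '' (K ∩ lieExp '' O)) := by
      rintro X ⟨hX, hXK⟩
      exact subset_closure ⟨lieExp X, ⟨hXK, mem_image_of_mem _ hX⟩, hO.log_exp hX⟩
    refine (lintegral_mono_set hsub).trans_lt ?_
    have hcont : Continuous fun X : E => |(dexp G O X).det| :=
      (ContinuousLinearMap.continuous_det.comp hO.contDiff_dexp.continuous).abs
    obtain ⟨C, hC⟩ := hS.bddAbove_image hcont.continuousOn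
    refine (setLIntegral_mono measurable_const fun X hX =>
      ENNReal.ofReal_le_ofReal (hC (mem_image_of_mem _ hX))).trans_lt ?_
    rw [setLIntegral_const]
    exact ENNReal.mul_lt_top ENNReal.ofReal_lt_top hS.measure_lt_top
  have hopen : (expMeasure G μ O).IsOpenPosMeasure := by
    refine ⟨fun V hV hne => ?_⟩
    rw [hO.expMeasure_apply hV.measurableSet]
    have hd : Dense (lieExp '' O : Set G) := by
      refine Measure.dense_of_ae (μ := m) (p := fun x => x ∈ (lieExp '' O : Set G)) ?_
      exact hO.null_compl
    obtain ⟨g, hg, hgU⟩ := hd.exists_mem_open hV hne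
    obtain ⟨X, hX, rfl⟩ := hg
    have hop : IsOpen (O ∩ lieExp ⁻¹' V) := hO.isOpen.inter (hV.preimage hO.continuous_exp)
    intro h0
    rw [lintegral_eq_zero_iff hO.measurable_ofReal_det, EventuallyEq,
      ae_restrict_iff' hop.measurableSet] at h0
    have h1 : μ (O ∩ lieExp ⁻¹' V) = 0 := by
      refine measure_mono_null (fun Y hY => ?_) h0
      intro h2
      have h3 := h2 hY
      simp only [Pi.zero_apply, ENNReal.ofReal_eq_zero] at h3
      exact (abs_pos.2 (hO.dexp_det_ne_zero hY.1)).not_ge h3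
    exact (hop.measure_pos μ ⟨X, hX, hgU⟩).ne' h1
  exact { toIsFiniteMeasureOnCompacts := hfin, toIsMulLeftInvariant := hleft,
          toIsOpenPosMeasure := hopen }

theorem exists_eq_smul_expMeasure (hO : IsWeaklyExponential m O) :
    ∃ c : NNReal, 0 < c ∧ m = c • expMeasure G μ O := by
  haveI := hO.isHaarMeasure_expMeasure (μ := μ)
  exact ⟨_, Measure.haarScalarFactor_pos_of_isHaarMeasure m (expMeasure G μ O),
    Measure.isMulLeftInvariant_eq_smul m (expMeasure G μ O)⟩

/-- The density of exp is continuous with value 1 at 0, so the limit that defines `algMeasure`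
exists and picks up exactly the normalization `c` of the Haar measure. -/
theorem algMeasure_eq (hO : IsWeaklyExponential m O) {c : NNReal}
    (hc : m = c • expMeasure G (Measure.addHaar : Measure E) O) :
    (algMeasure m : Measure E) = c • Measure.addHaar := by
  set ν : Measure E := Measure.addHaar with hν
  have hlim : Tendsto (fun r : ℝ => m (lieExp '' Metric.ball (0 : E) r) / ν (Metric.ball 0 r))
      (𝓝[>] 0) (𝓝 (c : ℝ≥0∞)) := by
    have hJ : Continuous fun X : E => ENNReal.ofReal |(dexp G O X).det| :=
      ENNReal.continuous_ofReal.comp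
        (ContinuousLinearMap.continuous_det.comp hO.contDiff_dexp.continuous).abs
    have hJ0 : ENNReal.ofReal |(dexp G O (0 : E)).det| = 1 := by
      rw [hO.dexp_zero, show (ContinuousLinearMap.id ℝ E).det = 1 from clm_det_one]
      simp
    have hmain : Tendsto (fun r : ℝ => (∫⁻ X in Metric.ball (0 : E) r,
        ENNReal.ofReal |(dexp G O X).det| ∂ν) / ν (Metric.ball 0 r)) (𝓝[>] 0) (𝓝 1) := by
      rw [tendsto_order]
      have hpos : ∀ᶠ r : ℝ in 𝓝[>] 0, 0 < ν (Metric.ball (0 : E) r) := by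
        filter_upwards [self_mem_nhdsWithin] with r hr
        exact Metric.measure_ball_pos ν 0 hr
      have hfin : ∀ r : ℝ, ν (Metric.ball (0 : E) r) ≠ ⊤ := fun r => measure_ball_lt_top.ne
      constructor
      · intro y hy
        obtain ⟨z, hyz, hz⟩ := exists_between hy
        have h1 : ∀ᶠ X in 𝓝 (0 : E), z < ENNReal.ofReal |(dexp G O X).det| :=
          hJ.continuousAt.eventually (lt_mem_nhds (by change z < ENNReal.ofReal |(dexp G O (0 : E)).det|; rwa [hJ0]))
        obtain ⟨δ, hδ, hball⟩ := Metric.eventually_nhds_iff_ball.1 h1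
        filter_upwards [hpos, Ioo_mem_nhdsGT hδ] with r hr hrδ
        refine hyz.trans_le ?_
        rw [ENNReal.le_div_iff_mul_le (Or.inl hr.ne') (Or.inl (hfin r))]
        rw [← setLIntegral_const]
        exact setLIntegral_mono hJ.measurable fun X hX =>
          (hball X (Metric.ball_subset_ball hrδ.2.le hX)).le
      · intro y hy
        obtain ⟨z, hz, hzy⟩ := exists_between hy
        have h1 : ∀ᶠ X in 𝓝 (0 : E), ENNReal.ofReal |(dexp G O X).det| < z :=
          hJ.continuousAt.eventually (gt_mem_nhds (by change ENNReal.ofReal |(dexp G O (0 : E)).det| < z; rwa [hJ0]))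
        obtain ⟨δ, hδ, hball⟩ := Metric.eventually_nhds_iff_ball.1 h1
        filter_upwards [hpos, Ioo_mem_nhdsGT hδ] with r hr hrδ
        refine lt_of_le_of_lt ?_ hzy
        rw [ENNReal.div_le_iff hr.ne' (hfin r)]
        rw [← setLIntegral_const]
        exact setLIntegral_mono measurable_const fun X hX =>
          (hball X (Metric.ball_subset_ball hrδ.2.le hX)).le
    have h2 := ENNReal.Tendsto.const_mul (a := (c : ℝ≥0∞)) hmain (Or.inl one_ne_zero)
    rw [mul_one] at h2
    refine h2.congr' ?_
    obtain ⟨δ, hδ, hball⟩ := Metric.mem_nhds_iff.1 hO.mem_nhds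
    filter_upwards [Ioo_mem_nhdsGT hδ] with r hr
    have hsub : Metric.ball (0 : E) r ⊆ O := (Metric.ball_subset_ball hr.2.le).trans hball
    have himg : lieExp (G := G) '' Metric.ball (0 : E) r =
        lieExp '' O ∩ lieLog O ⁻¹' (Metric.ball (0 : E) r) := by
      ext g
      constructor
      · rintro ⟨X, hX, rfl⟩
        exact ⟨mem_image_of_mem _ (hsub hX), by rwa [mem_preimage, hO.log_exp (hsub hX)]⟩
      · rintro ⟨hg, hg'⟩
        exact ⟨_, hg', exp_log hg⟩
    have hopen : IsOpen (lieExp (G := G) '' Metric.ball (0 : E) r) := by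
      rw [himg]
      exact hO.contMDiffOn_log.continuousOn.isOpen_inter_preimage hO.isOpen_image Metric.isOpen_ball
    have hpre : O ∩ lieExp ⁻¹' (lieExp (G := G) '' Metric.ball (0 : E) r) = Metric.ball 0 r := by
      ext X
      constructor
      · rintro ⟨hX, Y, hY, h⟩
        rwa [← hO.injOn (hsub hY) hX h]
      · exact fun hX => ⟨hsub hX, mem_image_of_mem _ hX⟩
    rw [hc, Measure.smul_apply, hO.expMeasure_apply hopen.measurableSet, hpre, ENNReal.smul_def,
      smul_eq_mul, mul_div_assoc]
  rw [algMeasure, hlim.limUnder_eq]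
  rfl

theorem isAddHaarMeasure_algMeasure (hO : IsWeaklyExponential m O) :
    (algMeasure m : Measure E).IsAddHaarMeasure := by
  obtain ⟨c, hc, h⟩ := hO.exists_eq_smul_expMeasure (μ := (Measure.addHaar : Measure E))
  rw [hO.algMeasure_eq h]
  exact Measure.IsAddHaarMeasure.nnreal_smul _ hc.ne'

/-- The Haar measure in exponential coordinates. -/
theorem expMeasure_algMeasure (hO : IsWeaklyExponential m O) :
    expMeasure G (algMeasure m : Measure E) O = m := by
  obtain ⟨c, hc, h⟩ := hO.exists_eq_smul_expMeasure (μ := (Measure.addHaar : Measure E))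
  rw [hO.algMeasure_eq h]
  refine Eq.trans ?_ h.symm
  rw [expMeasure, expMeasure]
  have e : ((c • (Measure.addHaar : Measure E)).restrict O) = c • Measure.addHaar.restrict O :=
    Measure.restrict_smul _ _ _
  rw [e]
  ext B hB
  rw [Measure.map_apply hO.measurable_exp hB, withDensity_apply _ (hO.measurable_exp hB),
    Measure.smul_apply, Measure.map_apply hO.measurable_exp hB,
    withDensity_apply _ (hO.measurable_exp hB), Measure.restrict_smul, lintegral_smul_measure]

/-- Right translation by `b` has Jacobian |det Ad(b⁻¹)|, which makes the square of `modRoot` the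
modular function. -/
theorem map_mul_right (hO : IsWeaklyExponential m O) (b : G) :
    m.map (fun x => x * b) = ENNReal.ofReal (modRoot O b ^ 2) • m := by
  haveI := hO.isAddHaarMeasure_algMeasure
  ext B hB
  have h := hO.expMeasure_preimage (μ := (algMeasure m : Measure E)) 1 b hB
  simp only [hO.expMeasure_algMeasure, one_mul] at h
  rw [Measure.map_apply (measurable_mul_const b) hB, Measure.smul_apply, h, smul_eq_mul,
    ← mul_assoc, ← ENNReal.ofReal_mul (sq_nonneg _), ← modRoot_sq, hO.modRoot_inv, ← mul_pow,
    mul_inv_cancel₀ (hO.modRoot_pos b).ne']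
  simp

end IsWeaklyExponential

end HaarMeasure

/-! ### Fourier transforms on the Lie algebra -/

section Fourier

variable {E : Type*} [NormedAddCommGroup E] [NormedSpace ℝ E]

theorem phase_eq (ħ : ℝ) (p : E →L[ℝ] ℝ) (X : E) :
    phase ħ p X = Complex.exp (((-(p X / ħ) : ℝ) : ℂ) * Complex.I) := by
  rw [phase]; congr 1; push_cast; ring

theorem norm_phase (ħ : ℝ) (p : E →L[ℝ] ℝ) (X : E) : ‖phase ħ p X‖ = 1 := by
  rw [phase_eq, Complex.norm_exp_ofReal_mul_I]

theorem phase_add (ħ : ℝ) (p : E →L[ℝ] ℝ) (X Y : E) :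
    phase ħ p (X + Y) = phase ħ p X * phase ħ p Y := by
  rw [phase, phase, phase, ← Complex.exp_add]; congr 1; rw [map_add]; push_cast; ring

theorem phase_smul_left (ħ : ℝ) (t : ℝ) (p : E →L[ℝ] ℝ) (X : E) :
    phase ħ (t • p) X = phase ħ p (t • X) := by
  simp [phase]

theorem continuous_phase (ħ : ℝ) : Continuous fun z : (E →L[ℝ] ℝ) × E => phase ħ z.1 z.2 := by
  unfold phase
  have : Continuous fun z : (E →L[ℝ] ℝ) × E => z.1 z.2 := isBoundedBilinearMap_apply.continuous
  fun_prop

theorem continuous_phase_right (ħ : ℝ) (p : E →L[ℝ] ℝ) : Continuous fun X : E => phase ħ p X :=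
  (continuous_phase ħ).comp (by fun_prop : Continuous fun X : E => (p, X))

theorem continuous_phase_left (ħ : ℝ) (X : E) :
    Continuous fun p : E →L[ℝ] ℝ => phase ħ p X :=
  (continuous_phase ħ).comp (by fun_prop : Continuous fun p : E →L[ℝ] ℝ => (p, X))

theorem hasFDerivAt_phase (ħ : ℝ) (p : E →L[ℝ] ℝ) (X : E) :
    HasFDerivAt (fun X : E => phase ħ p X)
      ((phase ħ p X * -(Complex.I / (ħ : ℂ))) • (Complex.ofRealCLM.comp p)) X := by
  have h1 : HasFDerivAt (fun X : E => -(Complex.I / (ħ : ℂ)) * ((p X : ℝ) : ℂ))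
      (-(Complex.I / (ħ : ℂ)) • (Complex.ofRealCLM.comp p)) X :=
    (Complex.ofRealCLM.comp p).hasFDerivAt.const_mul _
  have h2 := h1.cexp
  rw [smul_smul] at h2
  exact h2

variable [FiniteDimensional ℝ E] [MeasurableSpace E] [BorelSpace E]

/-- Carries the dual space to a Euclidean space, where Fourier inversion for Schwartz functions
applies. -/
theorem exists_clm_dual_equiv : ∃ T : EuclideanSpace ℝ (Fin (Module.finrank ℝ E)) ≃L[ℝ]
    (E →L[ℝ] ℝ), ∀ v X, T v X = inner ℝ v (toEuclidean X) := by
  let T0 : EuclideanSpace ℝ (Fin (Module.finrank ℝ E)) →ₗ[ℝ] (E →L[ℝ] ℝ) :=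
    { toFun := fun v => (innerSL ℝ v).comp (toEuclidean : E ≃L[ℝ] _).toContinuousLinearMap
      map_add' := fun v w => by ext X; simp
      map_smul' := fun c v => by ext X; simp }
  have hinj : Injective T0 := by
    rw [← LinearMap.ker_eq_bot, LinearMap.ker_eq_bot']
    intro v hv
    have h := DFunLike.congr_fun hv ((toEuclidean : E ≃L[ℝ] _).symm v)
    simpa [T0] using h
  have hdim : Module.finrank ℝ (EuclideanSpace ℝ (Fin (Module.finrank ℝ E))) =
      Module.finrank ℝ (E →L[ℝ] ℝ) := by
    rw [finrank_euclideanSpace_fin, ← (LinearMap.toContinuousLinearMap (𝕜 := ℝ) (E := E)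
      (F' := ℝ)).finrank_eq]
    exact (Subspace.dual_finrank_eq (K := ℝ) (V := E)).symm
  exact ⟨(LinearEquiv.ofInjectiveOfFinrankEq T0 hinj hdim).toContinuousLinearEquiv,
    fun v X => rfl⟩

open scoped FourierTransform in
/-- The Fourier transform of a smooth function of compact support on the dual space is a Schwartz
function, whose integral is a constant multiple of the value at the origin. -/
theorem exists_schwartz_fourier {ħ : ℝ} (hħ : ħ ≠ 0) (μ : Measure E) [μ.IsAddHaarMeasure]
    (ν : Measure (E →L[ℝ] ℝ)) [ν.IsAddHaarMeasure] :
    ∃ C : ℂ, C ≠ 0 ∧ ∀ χ : (E →L[ℝ] ℝ) → ℂ, ContDiff ℝ ∞ χ → HasCompactSupport χ →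
      ∃ Ψ : SchwartzMap E ℂ, (∀ X, Ψ X = ∫ p, χ p * phase ħ p X ∂ν) ∧
        ∫ X, Ψ X ∂μ = C * χ 0 := by
  obtain ⟨T, hT⟩ := exists_clm_dual_equiv (E := E)
  let V := EuclideanSpace ℝ (Fin (Module.finrank ℝ E))
  have h2 : (2 * Real.pi * ħ)⁻¹ ≠ 0 := inv_ne_zero (by positivity)
  -- The factor 1/(2πħ) reconciles the phase exp(-(i/ħ)⟨p, X⟩) with the convention exp(-2πi⟨v, w⟩).
  let M : E ≃L[ℝ] V := (toEuclidean : E ≃L[ℝ] V).trans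
    (ContinuousLinearEquiv.smulLeft (Units.mk0 _ h2))
  have hM : ∀ X, M X = (2 * Real.pi * ħ)⁻¹ • (toEuclidean X : V) := fun X => rfl
  haveI : ((volume : Measure V).map T).IsAddHaarMeasure := T.isAddHaarMeasure_map _
  haveI : (μ.map M).IsAddHaarMeasure := M.isAddHaarMeasure_map _
  -- The constant C is c1 c2, which accounts for the normalizations of `ν` and `μ`.
  set c1 := Measure.addHaarScalarFactor ν ((volume : Measure V).map T) with hc1
  set c2 := Measure.addHaarScalarFactor (μ.map M) (volume : Measure V) with hc2
  have e1 : ν = c1 • (volume : Measure V).map T := Measure.isAddLeftInvariant_eq_smul _ _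
  have e2 : μ.map M = c2 • (volume : Measure V) := Measure.isAddLeftInvariant_eq_smul _ _
  have p1 : c1 ≠ 0 := (Measure.addHaarScalarFactor_pos_of_isAddHaarMeasure _ _).ne'
  have p2 : c2 ≠ 0 := (Measure.addHaarScalarFactor_pos_of_isAddHaarMeasure _ _).ne'
  refine ⟨((c1 : ℝ) : ℂ) * ((c2 : ℝ) : ℂ), by simp [p1, p2], fun χ hχ hχc => ?_⟩
  have hs1 : HasCompactSupport (χ ∘ T) := hχc.comp_homeomorph T.toHomeomorph
  have hs2 : ContDiff ℝ ∞ (χ ∘ T) := hχ.comp T.contDiff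
  let s : SchwartzMap V ℂ := hs1.toSchwartzMap hs2
  have hs : ∀ v, s v = χ (T v) := fun v => rfl
  refine ⟨((c1 : ℝ) : ℂ) • SchwartzMap.compCLMOfContinuousLinearEquiv ℂ M (𝓕 s), fun X => ?_, ?_⟩
  · have h3 : ∫ p, χ p * phase ħ p X ∂((volume : Measure V).map T) =
        ∫ v, χ (T v) * phase ħ (T v) X :=
      T.toHomeomorph.measurableEmbedding.integral_map _
    rw [e1, integral_smul_nnreal_measure, h3]
    simp only [smul_apply, SchwartzMap.compCLMOfContinuousLinearEquiv_apply,
      Function.comp_apply, SchwartzMap.fourier_coe, Real.fourier_eq']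
    rw [NNReal.smul_def, Complex.real_smul, smul_eq_mul]
    congr 1
    refine integral_congr_ae (Eventually.of_forall fun v => ?_)
    simp only [hs, smul_eq_mul]
    rw [mul_comm, phase_eq, hT, hM, inner_smul_right]
    congr 4
    field_simp
  · have h3 : ∫ X, 𝓕 s (M X) ∂μ = ∫ w, 𝓕 s w ∂(μ.map M) :=
      (M.toHomeomorph.measurableEmbedding.integral_map _).symm
    have h4 : 𝓕⁻ (𝓕 s) 0 = s 0 := by rw [FourierTransform.fourierInv_fourier_eq]
    rw [SchwartzMap.fourierInv_coe, Real.fourierInv_eq'] at h4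
    simp only [inner_zero_right, mul_zero, Complex.ofReal_zero, zero_mul, Complex.exp_zero,
      one_smul] at h4
    simp only [smul_apply, SchwartzMap.compCLMOfContinuousLinearEquiv_apply,
      Function.comp_apply, smul_eq_mul]
    rw [integral_const_mul, h3, e2, integral_smul_nnreal_measure, h4, hs, map_zero,
      NNReal.smul_def, Complex.real_smul, mul_assoc]

variable {μ : Measure E} [μ.IsAddHaarMeasure] {ν : Measure (E →L[ℝ] ℝ)} [ν.IsAddHaarMeasure]
  {ħ : ℝ} {χ : (E →L[ℝ] ℝ) → ℂ} {Ψ : SchwartzMap E ℂ} {C : ℂ}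

theorem hasCompactSupport_comp_smul (hχc : HasCompactSupport χ) {ε : ℝ} (hε : ε ≠ 0) :
    HasCompactSupport fun p => χ (ε • p) :=
  hχc.comp_homeomorph (Homeomorph.smulOfNeZero ε hε)

/-- After Fubini and a dilation, the Fourier transform of the cut-off at scale ε is an approximate
delta of width ε at -X₀, acting on `A`. Every improper integral below is evaluated through this
formula. -/
theorem integral_cutoff_mul_fourier (hχ : Continuous χ) (hχc : HasCompactSupport χ)
    (hΨ : ∀ X, Ψ X = ∫ p, χ p * phase ħ p X ∂ν) {A : E → ℂ} (hA : Integrable A μ) (X₀ : E)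
    {ε : ℝ} (hε : 0 < ε) :
    ∫ p, χ (ε • p) * phase ħ p X₀ * (∫ X, A X * phase ħ p X ∂μ) ∂ν =
      ∫ Z, A (ε • Z - X₀) * Ψ Z ∂μ := by
  have hdim : Module.finrank ℝ (E →L[ℝ] ℝ) = Module.finrank ℝ E := by
    rw [← (LinearMap.toContinuousLinearMap (𝕜 := ℝ) (E := E) (F' := ℝ)).finrank_eq]
    exact Subspace.dual_finrank_eq (K := ℝ) (V := E)
  have hχε : Integrable (fun p => χ (ε • p)) ν :=
    (hχ.comp (by fun_prop)).integrable_of_hasCompactSupport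
      (hasCompactSupport_comp_smul hχc hε.ne')
  have hint : Integrable (uncurry fun (p : E →L[ℝ] ℝ) (X : E) =>
      χ (ε • p) * phase ħ p X₀ * (A X * phase ħ p X)) (ν.prod μ) := by
    have h1 := (hχε.mul_prod hA).mul_bdd (c := 1)
      (g := fun z : (E →L[ℝ] ℝ) × E => phase ħ z.1 (X₀ + z.2))
      (((continuous_phase ħ).comp (by fun_prop :
        Continuous fun z : (E →L[ℝ] ℝ) × E => (z.1, X₀ + z.2))).aestronglyMeasurable)
      (Eventually.of_forall fun z => (norm_phase _ _ _).le)
    refine h1.congr (Eventually.of_forall fun z => ?_)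
    simp only [uncurry, phase_add]
    ring
  have h2 : ∀ X, ∫ p, χ (ε • p) * phase ħ p X₀ * (A X * phase ħ p X) ∂ν =
      A X * (((ε ^ Module.finrank ℝ E)⁻¹ : ℝ) • Ψ (ε⁻¹ • (X + X₀))) := fun X => by
    rw [hΨ]
    have h3 := Measure.integral_comp_smul_of_nonneg ν
      (fun p => χ p * phase ħ p (ε⁻¹ • (X + X₀))) ε (hR := hε.le)
    rw [hdim] at h3
    rw [← h3, ← integral_const_mul]
    refine integral_congr_ae (Eventually.of_forall fun p => ?_)
    simp only [phase_smul_left, smul_smul, mul_inv_cancel₀ hε.ne', one_smul, phase_add]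
    ring
  calc _ = ∫ p, ∫ X, χ (ε • p) * phase ħ p X₀ * (A X * phase ħ p X) ∂μ ∂ν := by
        simp only [integral_const_mul]
    _ = ∫ X, ∫ p, χ (ε • p) * phase ħ p X₀ * (A X * phase ħ p X) ∂ν ∂μ := integral_integral_swap hint
    _ = ∫ X, A (X - X₀) * (((ε ^ Module.finrank ℝ E)⁻¹ : ℝ) • Ψ (ε⁻¹ • X)) ∂μ := by
        simp only [h2]
        rw [← integral_sub_right_eq_self _ X₀]
        simp only [sub_add_cancel]
    _ = _ := by
        have h4 := Measure.integral_comp_inv_smul_of_nonneg μ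
          (fun Z => A (ε • Z - X₀) * Ψ Z) hε.le
        simp only [smul_smul, mul_inv_cancel₀ hε.ne', one_smul] at h4
        simp only [mul_smul_comm]
        rw [integral_smul, h4, smul_smul, inv_mul_cancel₀ (pow_pos hε _).ne', one_smul]

theorem norm_integral_cutoff_le {A : E → ℂ} {M : ℝ} (hA : ∀ X, ‖A X‖ ≤ M) (Ψ : SchwartzMap E ℂ)
    (f : E → E) : ‖∫ Z, A (f Z) * Ψ Z ∂μ‖ ≤ M * ∫ Z, ‖Ψ Z‖ ∂μ := by
  rw [← integral_const_mul]
  refine norm_integral_le_of_norm_le (Ψ.integrable.norm.const_mul M)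
    (Eventually.of_forall fun Z => ?_)
  rw [norm_mul]
  exact mul_le_mul_of_nonneg_right (hA _) (norm_nonneg _)

theorem tendsto_integral_cutoff {A : E → ℂ} {M : ℝ} (hAm : Measurable A) (hA : ∀ X, ‖A X‖ ≤ M)
    {X₀ : E} (hA0 : ContinuousAt A (-X₀)) (Ψ : SchwartzMap E ℂ) :
    Tendsto (fun ε : ℝ => ∫ Z, A (ε • Z - X₀) * Ψ Z ∂μ) (𝓝[>] 0)
      (𝓝 (A (-X₀) * ∫ Z, Ψ Z ∂μ)) := by
  rw [← integral_const_mul]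
  refine tendsto_integral_filter_of_dominated_convergence (fun Z => M * ‖Ψ Z‖)
    (Eventually.of_forall fun ε => ?_) (Eventually.of_forall fun ε => Eventually.of_forall fun Z => ?_)
    (Ψ.integrable.norm.const_mul M) (Eventually.of_forall fun Z => ?_)
  · exact (hAm.comp (by fun_prop)).aestronglyMeasurable.mul Ψ.continuous.aestronglyMeasurable
  · rw [norm_mul]
    exact mul_le_mul_of_nonneg_right (hA _) (norm_nonneg _)
  · refine Tendsto.mul_const _ (hA0.tendsto.comp ?_)
    have hc : Continuous fun ε : ℝ => ε • Z - X₀ := by fun_prop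
    exact (hc.tendsto' 0 (-X₀) (by simp)).mono_left nhdsWithin_le_nhds

/-- Integration by parts: multiplication by a fiber variable corresponds to a derivative. -/
theorem mul_fourier_eq (hħ : ħ ≠ 0) {B : E → ℂ} (hB : ContDiff ℝ 1 B) (hBc : HasCompactSupport B)
    (p : E →L[ℝ] ℝ) (Y : E) :
    ((p Y : ℝ) : ℂ) * ∫ X, B X * phase ħ p X ∂μ =
      -(Complex.I * ħ) * ∫ X, fderiv ℝ B X Y * phase ħ p X ∂μ := by
  have hph : Continuous (phase ħ p) := continuous_phase_right ħ p
  have hd : ∀ X, fderiv ℝ (phase ħ p) X Y =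
      phase ħ p X * -(Complex.I / (ħ : ℂ)) * ((p Y : ℝ) : ℂ) := fun X => by
    rw [show fderiv ℝ (phase ħ p) X = _ from (hasFDerivAt_phase ħ p X).fderiv]; rfl
  have hBd : Continuous fun X => fderiv ℝ B X Y :=
    (hB.continuous_fderiv one_ne_zero).clm_apply continuous_const
  have hBdc : HasCompactSupport fun X => fderiv ℝ B X Y := hBc.fderiv_apply (𝕜 := ℝ) Y
  have h := integral_mul_fderiv_eq_neg_fderiv_mul_of_integrable (μ := μ) (f := B) (g := phase ħ p)
    (v := Y) ((hBd.mul hph).integrable_of_hasCompactSupport hBdc.mul_right) ?_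
    ((hB.continuous.mul hph).integrable_of_hasCompactSupport hBc.mul_right)
    (fun X _ => (hB.differentiable one_ne_zero) X)
    (fun X _ => (hasFDerivAt_phase ħ p X).differentiableAt)
  · rw [← neg_eq_iff_eq_neg] at h
    have hħ' : (ħ : ℂ) ≠ 0 := by exact_mod_cast hħ
    rw [← h]
    simp only [hd]
    rw [neg_mul_neg, ← integral_const_mul, ← integral_const_mul]
    refine integral_congr_ae (Eventually.of_forall fun X => ?_)
    simp only
    field_simp
    rw [Complex.I_sq]
    ring
  · simp only [hd]
    exact (hB.continuous.mul ((hph.mul continuous_const).mul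
      continuous_const)).integrable_of_hasCompactSupport hBc.mul_right

/-- The directional derivative. -/
def dirDeriv (Y : E) (B : E → ℂ) (X : E) : ℂ := fderiv ℝ B X Y

theorem contDiff_dirDeriv {n : ℕ} {B : E → ℂ} (hB : ContDiff ℝ (n + 1 : ℕ) B) (Y : E) :
    ContDiff ℝ n (dirDeriv Y B) :=
  (hB.fderiv_right (m := n) (by norm_cast)).clm_apply contDiff_const

theorem contDiff_iterate_dirDeriv (l n : ℕ) (Y : E) : ∀ {B : E → ℂ}, ContDiff ℝ (n + l : ℕ) B →
    ContDiff ℝ n ((dirDeriv Y)^[l] B) := by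
  induction l with
  | zero => intro B hB; simpa using hB
  | succ l ih => intro B hB; exact ih (contDiff_dirDeriv hB Y)

theorem hasCompactSupport_iterate_dirDeriv (l : ℕ) (Y : E) : ∀ {B : E → ℂ}, HasCompactSupport B →
    HasCompactSupport ((dirDeriv Y)^[l] B) := by
  induction l with
  | zero => intro B hB; exact hB
  | succ l ih => intro B hB; exact ih (hB.fderiv_apply (𝕜 := ℝ) Y)

theorem iterate_dirDeriv_eq (l : ℕ) (Y : E) : ∀ {B : E → ℂ}, ContDiff ℝ l B → ∀ t : ℝ,
    iteratedDeriv l (fun t : ℝ => B (t • Y)) t = (dirDeriv Y)^[l] B (t • Y) := by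
  induction l with
  | zero => intro B hB t; simp
  | succ l ih =>
    intro B hB t
    rw [iteratedDeriv_succ', iterate_succ_apply, ← ih (contDiff_dirDeriv hB Y)]
    congr 1
    funext s
    have h1 : HasFDerivAt B (fderiv ℝ B (s • Y)) (s • Y) :=
      ((hB.differentiable (by simp)) _).hasFDerivAt
    have h2 : HasDerivAt (fun t : ℝ => t • Y) Y s := by
      simpa using (hasDerivAt_id s).smul_const Y
    exact (h1.comp_hasDerivAt s h2).deriv

theorem pow_mul_fourier_eq (hħ : ħ ≠ 0) (p : E →L[ℝ] ℝ) (Y : E) (l : ℕ) :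
    ∀ {B : E → ℂ}, ContDiff ℝ l B → HasCompactSupport B →
    ((p Y : ℝ) : ℂ) ^ l * ∫ X, B X * phase ħ p X ∂μ =
      (-(Complex.I * ħ)) ^ l * ∫ X, (dirDeriv Y)^[l] B X * phase ħ p X ∂μ := by
  induction l with
  | zero => intro B _ _; simp
  | succ l ih =>
    intro B hB hBc
    have h1 := mul_fourier_eq (μ := μ) hħ (hB.of_le (by norm_cast; omega)) hBc p Y
    have h2 := ih (contDiff_dirDeriv hB Y) (hBc.fderiv_apply (𝕜 := ℝ) Y)
    rw [iterate_succ_apply, pow_succ, mul_assoc, h1, pow_succ (-(Complex.I * (ħ : ℂ))) l]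
    unfold dirDeriv at h2 ⊢
    linear_combination (-(Complex.I * (ħ : ℂ))) * h2

/-- `A` is smooth only near 0, so powers of ⟨p, Y⟩ cannot be integrated by parts globally. A bump
function splits `A` into a compactly supported Cˡ part, for which l integrations by parts and the
approximate delta give the limit, and a remainder that vanishes near 0 and contributes O(ε). -/
theorem tendsto_integral_pow_mul_fourier (hħ : ħ ≠ 0)
    (hC : ∀ χ : (E →L[ℝ] ℝ) → ℂ, ContDiff ℝ ∞ χ → HasCompactSupport χ →
      ∃ Ψ : SchwartzMap E ℂ, (∀ X, Ψ X = ∫ p, χ p * phase ħ p X ∂ν) ∧ ∫ X, Ψ X ∂μ = C * χ 0)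
    (hχ : ContDiff ℝ ∞ χ) (hχc : HasCompactSupport χ) {A : E → ℂ} {M : ℝ} (hAi : Integrable A μ)
    (hA : ∀ X, ‖A X‖ ≤ M) (hA0 : ContDiffAt ℝ ∞ A 0) (Y : E) (l : ℕ) :
    Tendsto (fun ε : ℝ => ∫ p, χ (ε • p) * ((p Y : ℝ) : ℂ) ^ l * (∫ X, A X * phase ħ p X ∂μ) ∂ν)
      (𝓝[>] 0)
      (𝓝 (C * χ 0 * ((-(Complex.I * ħ)) ^ l * iteratedDeriv l (fun t : ℝ => A (t • Y)) 0))) := by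
  obtain ⟨u, hu, hAu⟩ := (hA0.of_le (m := (l : ℕ)) (by exact_mod_cast le_top)).contDiffOn
    le_rfl (by simp)
  obtain ⟨r, hr, hru⟩ := Metric.nhds_basis_closedBall.mem_iff.1 hu
  -- The outer radius r/2 keeps the support well inside the ball of radius r on which `A` is Cˡ, so
  -- that `B` is Cˡ everywhere.
  let η : ContDiffBump (0 : E) := ⟨r / 4, r / 2, by positivity, by linarith⟩
  let B : E → ℂ := fun X => (η X : ℂ) * A X
  have hηc : HasCompactSupport fun X => ((η X : ℝ) : ℂ) :=
    η.hasCompactSupport.comp_left (g := fun x : ℝ => (x : ℂ)) (by simp)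
  have hBc : HasCompactSupport B := hηc.mul_right
  have hηs : ContDiff ℝ l fun X => ((η X : ℝ) : ℂ) :=
    Complex.ofRealCLM.contDiff.comp η.contDiff
  have hBs : ContDiff ℝ l B := by
    rw [contDiff_iff_contDiffAt]
    intro X
    by_cases hX : X ∈ Metric.ball (0 : E) r
    · exact hηs.contDiffAt.mul (hAu.contDiffAt (Filter.mem_of_superset
        (Metric.isOpen_ball.mem_nhds hX) (Metric.ball_subset_closedBall.trans hru)))
    · refine contDiffAt_const (c := (0 : ℂ)) |>.congr_of_eventuallyEq ?_
      have : (Metric.closedBall (0 : E) (r / 2))ᶜ ∈ 𝓝 X := by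
        refine Metric.isClosed_closedBall.isOpen_compl.mem_nhds fun h => hX ?_
        rw [Metric.mem_closedBall] at h
        rw [Metric.mem_ball]; linarith
      filter_upwards [this] with Z hZ
      have : η Z = 0 := η.zero_of_le_dist (by
        rw [mem_compl_iff, Metric.mem_closedBall, not_le] at hZ; exact hZ.le)
      simp [B, this]
  have hBA : B =ᶠ[𝓝 0] A := by
    filter_upwards [Metric.ball_mem_nhds (0 : E) (by positivity : 0 < r / 4)] with X hX
    have : η X = 1 := η.one_of_mem_closedBall (Metric.ball_subset_closedBall hX)
    simp [B, this]
  have hBi : Integrable B μ := hBs.continuous.integrable_of_hasCompactSupport hBc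
  have hB1 : ∀ X, ‖B X‖ ≤ M := fun X => by
    rw [norm_mul, Complex.norm_real, Real.norm_of_nonneg η.nonneg]
    exact (mul_le_of_le_one_left (norm_nonneg _) η.le_one).trans (hA X)
  let R : E → ℂ := fun X => A X - B X
  have hRi : Integrable R μ := hAi.sub hBi
  have hlocal : iteratedDeriv l (fun t : ℝ => A (t • Y)) 0 = (dirDeriv Y)^[l] B 0 := by
    have h1 : (fun t : ℝ => A (t • Y)) =ᶠ[𝓝 0] fun t : ℝ => B (t • Y) := by
      have hc : Continuous fun t : ℝ => t • Y := by fun_prop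
      have := (hc.tendsto' 0 0 (by simp)).eventually hBA
      filter_upwards [this] with t ht using ht.symm
    rw [h1.iteratedDeriv_eq, iterate_dirDeriv_eq l Y hBs, zero_smul]
  -- the smooth part
  obtain ⟨Ψ, hΨ, hΨ0⟩ := hC χ hχ hχc
  have hDs : Continuous ((dirDeriv Y)^[l] B) :=
    (contDiff_iterate_dirDeriv l 0 Y (by simpa using hBs)).continuous
  have hDc : HasCompactSupport ((dirDeriv Y)^[l] B) := hasCompactSupport_iterate_dirDeriv l Y hBc
  obtain ⟨M', hM'⟩ := hDc.exists_bound_of_continuous hDs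
  have hsmooth : Tendsto (fun ε : ℝ => ∫ p, χ (ε • p) * ((p Y : ℝ) : ℂ) ^ l *
      (∫ X, B X * phase ħ p X ∂μ) ∂ν) (𝓝[>] 0)
      (𝓝 (C * χ 0 * ((-(Complex.I * ħ)) ^ l * (dirDeriv Y)^[l] B 0))) := by
    have h1 := (tendsto_integral_cutoff (μ := μ) hDs.measurable hM' (X₀ := 0)
      hDs.continuousAt Ψ).const_mul ((-(Complex.I * (ħ : ℂ))) ^ l)
    rw [neg_zero, hΨ0] at h1
    rw [show C * χ 0 * ((-(Complex.I * (ħ : ℂ))) ^ l * (dirDeriv Y)^[l] B 0) =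
      (-(Complex.I * (ħ : ℂ))) ^ l * ((dirDeriv Y)^[l] B 0 * (C * χ 0)) by ring]
    refine h1.congr' ?_
    filter_upwards [self_mem_nhdsWithin] with ε hε
    rw [← integral_cutoff_mul_fourier hχ.continuous hχc hΨ
      (hDs.integrable_of_hasCompactSupport hDc) 0 hε, ← integral_const_mul]
    refine integral_congr_ae (Eventually.of_forall fun p => ?_)
    simp only
    rw [mul_assoc (χ (ε • p)) (((p Y : ℝ) : ℂ) ^ l), pow_mul_fourier_eq hħ p Y l hBs hBc]
    simp [phase]
    ring
  -- the part away from the origin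
  let χl : (E →L[ℝ] ℝ) → ℂ := fun p => χ p * ((p Y : ℝ) : ℂ) ^ l
  have hpow : ContDiff ℝ ∞ fun p : E →L[ℝ] ℝ => ((p Y : ℝ) : ℂ) ^ l :=
    (Complex.ofRealCLM.contDiff.comp (contDiff_id.clm_apply contDiff_const)).pow l
  have hχl : ContDiff ℝ ∞ χl := hχ.mul hpow
  have hχlc : HasCompactSupport χl := hχc.mul_right
  obtain ⟨Ψl, hΨl, -⟩ := hC χl hχl hχlc
  have hR0 : ∀ X, ‖X‖ < r / 4 → R X = 0 := fun X hX => by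
    have : η X = 1 := η.one_of_mem_closedBall (by simpa using hX.le)
    simp [R, B, this]
  have hM0 : 0 ≤ M := (norm_nonneg _).trans (hA 0)
  -- As `R` is bounded and vanishes near 0, any power of ‖X‖ dominates it. The exponent l + 1 beats
  -- the factor ε⁻ˡ that rescaling ⟨p, Y⟩ˡ releases, and leaves one ε.
  have hRb : ∀ X, ‖R X‖ ≤ 2 * M * (4 / r) ^ (l + 1) * ‖X‖ ^ (l + 1) := fun X => by
    by_cases hX : ‖X‖ < r / 4
    · rw [hR0 X hX, norm_zero]; positivity
    · have h1 : 1 ≤ (4 / r * ‖X‖) ^ (l + 1) := by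
        refine one_le_pow₀ ?_
        rw [not_lt] at hX
        rw [div_mul_eq_mul_div, le_div_iff₀ hr]; linarith
      rw [mul_assoc, ← mul_pow]
      refine le_trans ?_ (le_mul_of_one_le_right (by positivity) h1)
      exact (norm_sub_le _ _).trans (by linarith [hA X, hB1 X])
  have hrest : Tendsto (fun ε : ℝ => ∫ p, χ (ε • p) * ((p Y : ℝ) : ℂ) ^ l *
      (∫ X, R X * phase ħ p X ∂μ) ∂ν) (𝓝[>] 0) (𝓝 0) := by
    let D : ℝ := 2 * M * (4 / r) ^ (l + 1) * ∫ Z, ‖Z‖ ^ (l + 1) * ‖Ψl Z‖ ∂μ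
    have hlim : Tendsto (fun ε : ℝ => ε * D) (𝓝[>] 0) (𝓝 0) := by
      have : Continuous fun ε : ℝ => ε * D := by fun_prop
      exact (this.tendsto' 0 0 (by simp)).mono_left nhdsWithin_le_nhds
    refine squeeze_zero_norm' ?_ hlim
    filter_upwards [self_mem_nhdsWithin] with ε hε
    rw [mem_Ioi] at hε
    have hε' : (ε : ℂ) ≠ 0 := by exact_mod_cast hε.ne'
    have h1 : ∫ p, χ (ε • p) * ((p Y : ℝ) : ℂ) ^ l * (∫ X, R X * phase ħ p X ∂μ) ∂ν =
        ((ε : ℂ) ^ l)⁻¹ * ∫ Z, R (ε • Z) * Ψl Z ∂μ := by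
      have h2 := integral_cutoff_mul_fourier hχl.continuous hχlc hΨl hRi 0 hε
      simp only [sub_zero] at h2
      rw [← h2, ← integral_const_mul]
      refine integral_congr_ae (Eventually.of_forall fun p => ?_)
      simp only [χl, phase, map_zero, Complex.ofReal_zero, mul_zero, Complex.exp_zero, mul_one,
        smul_apply, smul_eq_mul, Complex.ofReal_mul, mul_pow]
      field_simp
    rw [h1, norm_mul, norm_inv, norm_pow, Complex.norm_real, Real.norm_of_nonneg hε.le]
    have h3 : ‖∫ Z, R (ε • Z) * Ψl Z ∂μ‖ ≤ ε ^ (l + 1) * D := by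
      change _ ≤ ε ^ (l + 1) * (2 * M * (4 / r) ^ (l + 1) * ∫ Z, ‖Z‖ ^ (l + 1) * ‖Ψl Z‖ ∂μ)
      rw [← integral_const_mul, ← integral_const_mul]
      refine norm_integral_le_of_norm_le
        (((Ψl.integrable_pow_mul μ (l + 1)).const_mul _).const_mul _)
        (Eventually.of_forall fun Z => ?_)
      rw [norm_mul]
      refine (mul_le_mul_of_nonneg_right (hRb _) (norm_nonneg _)).trans_eq ?_
      rw [norm_smul, Real.norm_of_nonneg hε.le]
      ring
    calc (ε ^ l)⁻¹ * ‖∫ Z, R (ε • Z) * Ψl Z ∂μ‖ ≤ (ε ^ l)⁻¹ * (ε ^ (l + 1) * D) := by gcongr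
      _ = ε * D := by field_simp; ring
  rw [hlocal]
  have hsum := hsmooth.add hrest
  rw [add_zero] at hsum
  refine hsum.congr' ?_
  filter_upwards [self_mem_nhdsWithin] with ε hε
  rw [mem_Ioi] at hε
  have hfc : ∀ {A : E → ℂ}, Integrable A μ → Integrable (fun p => χ (ε • p) *
      ((p Y : ℝ) : ℂ) ^ l * ∫ X, A X * phase ħ p X ∂μ) ν := fun {A} hA => by
    have hc : Continuous fun p : E →L[ℝ] ℝ => ∫ X, A X * phase ħ p X ∂μ := by
      refine continuous_of_dominated (bound := fun X => ‖A X‖) (fun p => (phase_integrable ħ p hA).1)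
        (fun p => Eventually.of_forall fun X => ?_) hA.norm
        (Eventually.of_forall fun X => continuous_const.mul (continuous_phase_left ħ X))
      rw [norm_mul, norm_phase, mul_one]
    refine Continuous.integrable_of_hasCompactSupport
      (((hχ.continuous.comp (by fun_prop)).mul hpow.continuous).mul hc) ?_
    exact ((hasCompactSupport_comp_smul hχc hε.ne').mul_right).mul_right
  rw [← integral_add (hfc hBi) (hfc hRi)]
  refine integral_congr_ae (Eventually.of_forall fun p => ?_)
  simp only
  rw [← mul_add, ← integral_add (phase_integrable ħ p hBi) (phase_integrable ħ p hRi)]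
  congr 2
  funext X
  simp only [R]; ring

end Fourier

/-! ### Smooth dependence of integrals on parameters -/

section Parametric

variable {P : Type*} [NormedAddCommGroup P] [NormedSpace ℝ P] [FiniteDimensional ℝ P]
  {E : Type*} [NormedAddCommGroup E] [NormedSpace ℝ E] [MeasurableSpace E] [BorelSpace E]
  {ρ : Measure E} [IsFiniteMeasure ρ] {L : Set E} {U : Set P} {H : P × E → ℂ}

theorem aestronglyMeasurable_slice {F : Type*} [NormedAddCommGroup F] (hL : IsCompact L)
    (hρ : ρ Lᶜ = 0) {f : P × E → F} {y : P} (hf : ∀ X ∈ L, ContinuousAt f (y, X)) :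
    AEStronglyMeasurable (fun X => f (y, X)) ρ := by
  rw [← Measure.restrict_eq_self_of_ae_mem (s := L) hρ]
  refine ContinuousOn.aestronglyMeasurable_of_isCompact (fun X hX => ?_) hL hL.measurableSet
  exact (ContinuousAt.comp (f := fun X => (y, X)) (hf X hX) (by fun_prop)).continuousWithinAt

/-- Near `y` the integrand and its derivative are continuous on the compact product of a closed ball
with `L`, hence bounded, and bounds are integrable for a finite measure. -/
theorem hasFDerivAt_integral_of_contDiffAt (hL : IsCompact L) (hρ : ρ Lᶜ = 0) (hU : IsOpen U)
    (hH : ∀ y ∈ U, ∀ X ∈ L, ContDiffAt ℝ ∞ H (y, X)) {y : P} (hy : y ∈ U) :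
    ∃ D : P →L[ℝ] ℂ, HasFDerivAt (fun y => ∫ X, H (y, X) ∂ρ) D y ∧
      ∀ v, D v = ∫ X, fderiv ℝ H (y, X) (v, 0) ∂ρ := by
  haveI : ProperSpace P := FiniteDimensional.proper ℝ P
  obtain ⟨r, hr, hrU⟩ := Metric.nhds_basis_closedBall.mem_iff.1 (hU.mem_nhds hy)
  have hHc : ∀ y ∈ U, ∀ X ∈ L, ContinuousAt H (y, X) := fun y hy X hX => (hH y hy X hX).continuousAt
  let D' : P × E → P →L[ℝ] ℂ := fun z => (fderiv ℝ H z).comp (ContinuousLinearMap.inl ℝ P E)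
  have hD'c : ∀ y ∈ U, ∀ X ∈ L, ContinuousAt D' (y, X) := fun y hy X hX =>
    (((hH y hy X hX).fderiv_right (m := 0) (by simp)).clm_comp contDiffAt_const).continuousAt
  have hLa : ∀ᵐ X ∂ρ, X ∈ L := hρ
  have hK : IsCompact (Metric.closedBall y r ×ˢ L) := (isCompact_closedBall y r).prod hL
  obtain ⟨M, hM⟩ := hK.exists_bound_of_continuousOn (f := D')
    fun z hz => (hD'c z.1 (hrU hz.1) z.2 hz.2).continuousWithinAt
  obtain ⟨M', hM'⟩ := hK.exists_bound_of_continuousOn (f := H)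
    fun z hz => (hHc z.1 (hrU hz.1) z.2 hz.2).continuousWithinAt
  have hyb : y ∈ Metric.closedBall y r := Metric.mem_closedBall_self hr.le
  have hD'i : Integrable (fun X => D' (y, X)) ρ :=
    Integrable.of_bound (aestronglyMeasurable_slice hL hρ (hD'c y hy)) M (hLa.mono fun X hX => hM _ ⟨hyb, hX⟩)
  refine ⟨∫ X, D' (y, X) ∂ρ, ?_, fun v => ContinuousLinearMap.integral_apply hD'i v⟩
  refine hasFDerivAt_integral_of_dominated_of_fderiv_le (F := fun y X => H (y, X))
    (F' := fun y X => D' (y, X)) (bound := fun _ => M)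
    (Metric.closedBall_mem_nhds y hr) ?_ ?_ hD'i.1
    (hLa.mono fun X hX z hz => hM _ ⟨hz, hX⟩) (integrable_const M)
    (hLa.mono fun X hX z hz => ?_)
  · exact Filter.mem_of_superset (hU.mem_nhds hy) fun z hz => aestronglyMeasurable_slice hL hρ (hHc z hz)
  · exact Integrable.of_bound (aestronglyMeasurable_slice hL hρ (hHc y hy)) M' (hLa.mono fun X hX => hM' _ ⟨hyb, hX⟩)
  · have h1 := ((hH z (hrU hz) X hX).differentiableAt (by simp)).hasFDerivAt
    exact HasFDerivAt.comp (f := fun z => (z, X)) z h1 (hasFDerivAt_prodMk_left z X)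

/-- Directional derivatives of the integral are integrals of the same type, so induction on the
order applies. -/
theorem contDiffOn_integral_of_contDiffAt (hL : IsCompact L) (hρ : ρ Lᶜ = 0) (hU : IsOpen U)
    (hH : ∀ y ∈ U, ∀ X ∈ L, ContDiffAt ℝ ∞ H (y, X)) :
    ContDiffOn ℝ ∞ (fun y => ∫ X, H (y, X) ∂ρ) U := by
  rw [contDiffOn_infty]
  intro n
  induction n generalizing H with
  | zero =>
    rw [Nat.cast_zero, contDiffOn_zero]
    intro y hy
    obtain ⟨D, hD, -⟩ := hasFDerivAt_integral_of_contDiffAt hL hρ hU hH hy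
    exact hD.continuousAt.continuousWithinAt
  | succ n ih =>
    rw [Nat.cast_succ, contDiffOn_succ_iff_fderiv_of_isOpen hU]
    refine ⟨fun y hy => ?_, by simp, contDiffOn_clm_apply.2 fun v => ?_⟩
    · obtain ⟨D, hD, -⟩ := hasFDerivAt_integral_of_contDiffAt hL hρ hU hH hy
      exact hD.differentiableAt.differentiableWithinAt
    · refine (ih (H := fun z => fderiv ℝ H z (v, 0)) fun y hy X hX => ?_).congr fun y hy => ?_
      · exact ((hH y hy X hX).fderiv_right (m := ∞) (by simp)).clm_apply contDiffAt_const
      · obtain ⟨D, hD, hDv⟩ := hasFDerivAt_integral_of_contDiffAt hL hρ hU hH hy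
        rw [hD.fderiv, hDv]

end Parametric

/-! ### Smooth dependence of Haar integrals on parameters -/

section HaarParametric

variable {P : Type*} [NormedAddCommGroup P] [NormedSpace ℝ P]
  {E : Type*} [NormedAddCommGroup E] [NormedSpace ℝ E] [FiniteDimensional ℝ E]
  [MeasurableSpace E] [BorelSpace E]
  {G : Type*} [Group G] [TopologicalSpace G] [T2Space G] [SecondCountableTopology G]
  [ChartedSpace E G] [LieGroup 𝓘(ℝ, E) ∞ G] [MeasurableSpace G] [BorelSpace G]
  {m : Measure G} {O : Set E}

namespace IsWeaklyExponential

theorem contMDiff_of_comp_exp_prod (hO : IsWeaklyExponential m O) {K : G × G → ℂ}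
    (hK : ∀ a b : G, ContDiffAt ℝ ∞ (fun z : E × E => K (a * lieExp z.1, b * lieExp z.2)) 0) :
    ContMDiff (𝓘(ℝ, E).prod 𝓘(ℝ, E)) 𝓘(ℝ, ℂ) ∞ K := by
  rintro ⟨a, b⟩
  have h2 : ∀ q : G, ContMDiffAt 𝓘(ℝ, E) 𝓘(ℝ, E) ∞ (fun x : G => lieLog O (q⁻¹ * x)) q := fun q =>
    (hO.contMDiffAt_log (by simpa using hO.one_mem)).comp q contMDiff_mul_left.contMDiffAt
  have h3 : ContMDiffAt (𝓘(ℝ, E).prod 𝓘(ℝ, E)) 𝓘(ℝ, E × E) ∞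
      (fun x : G × G => (lieLog O (a⁻¹ * x.1), lieLog O (b⁻¹ * x.2))) (a, b) :=
    ((h2 a).comp (a, b) contMDiffAt_fst).prodMk_space ((h2 b).comp (a, b) contMDiffAt_snd)
  have h4 : ContMDiffAt 𝓘(ℝ, E × E) 𝓘(ℝ, ℂ) ∞
      (fun z : E × E => K (a * lieExp z.1, b * lieExp z.2))
      (lieLog O (a⁻¹ * a), lieLog O (b⁻¹ * b)) := by
    rw [inv_mul_cancel, inv_mul_cancel, hO.log_one]; exact (hK a b).contMDiffAt
  refine (h4.comp (a, b) h3).congr_of_eventuallyEq ?_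
  have h5 : ∀ q : G, ∀ᶠ x in 𝓝 q, q⁻¹ * x ∈ (lieExp '' O : Set G) := fun q =>
    (contMDiff_mul_left (I := 𝓘(ℝ, E)) (n := ∞) (a := q⁻¹)).continuous.continuousAt.eventually_mem
      (hO.isOpen_image.mem_nhds (by simpa using hO.one_mem))
  filter_upwards [continuousAt_fst (p := (a, b)) |>.eventually (h5 a),
    continuousAt_snd (p := (a, b)) |>.eventually (h5 b)] with x hx hx'
  simp [exp_log hx, exp_log hx']

theorem contDiffAt_kernel_comp {k : G × G → ℂ}
    (hk : ContMDiff (𝓘(ℝ, E).prod 𝓘(ℝ, E)) 𝓘(ℝ, ℂ) ∞ k) {a b : P → G} {p : P}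
    (ha : ContMDiffAt 𝓘(ℝ, P) 𝓘(ℝ, E) ∞ a p) (hb : ContMDiffAt 𝓘(ℝ, P) 𝓘(ℝ, E) ∞ b p) :
    ContDiffAt ℝ ∞ (fun p => k (a p, b p)) p :=
  contMDiffAt_iff_contDiffAt.1 (hk.contMDiffAt.comp p (ha.prodMk hb))

variable [IsTopologicalGroup G] [LocallyCompactSpace G] [m.IsHaarMeasure]

theorem ae_mem_exp (hO : IsWeaklyExponential m O) : ∀ᵐ c ∂m, c ∈ (lieExp '' O : Set G) :=
  hO.null_compl

theorem isCompact_closure_log (hO : IsWeaklyExponential m O) {S : Set G} (hS : IsCompact S) :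
    IsCompact (closure (lieLog O '' (S ∩ lieExp '' O))) :=
  hO.precompact _ inter_subset_right
    (hS.of_isClosed_subset isClosed_closure (closure_minimal inter_subset_left hS.isClosed))

theorem mem_closure_log (hO : IsWeaklyExponential m O) {S : Set G} {X : E} (hX : X ∈ O)
    (hS : lieExp X ∈ S) : X ∈ closure (lieLog O '' (S ∩ lieExp '' O)) :=
  subset_closure ⟨lieExp X, ⟨hS, mem_image_of_mem _ hX⟩, hO.log_exp hX⟩

/-- The density of the Haar measure in exponential coordinates. -/
theorem integral_eq_setIntegral_exp (hO : IsWeaklyExponential m O) {f : G → ℂ}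
    (hf : AEStronglyMeasurable f m) :
    ∫ c, f c ∂m = ∫ X in O, ((|(dexp G O X).det| : ℝ) : ℂ) * f (lieExp X) ∂(algMeasure m) := by
  haveI := hO.isAddHaarMeasure_algMeasure
  have h1 : Measurable fun X : E => |(dexp G O X).det|.toNNReal :=
    ((ContinuousLinearMap.continuous_det.comp
      hO.contDiff_dexp.continuous).abs.measurable).real_toNNReal
  rw [← hO.expMeasure_algMeasure] at hf
  conv_lhs => rw [← hO.expMeasure_algMeasure]
  rw [expMeasure] at hf ⊢
  rw [integral_map hO.measurable_exp.aemeasurable hf]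
  have h2 := integral_withDensity_eq_integral_smul (μ := (algMeasure m : Measure E).restrict O) h1
    (fun X : E => f (lieExp X))
  refine Eq.trans h2 (integral_congr_ae (Eventually.of_forall fun X => ?_))
  simp only [NNReal.smul_def, Complex.real_smul, Real.coe_toNNReal _ (abs_nonneg _)]

theorem aestronglyMeasurable_of_continuousOn (hO : IsWeaklyExponential m O) {f : G → ℂ}
    (hf : ContinuousOn f (lieExp '' O)) : AEStronglyMeasurable f m := by
  rw [← Measure.restrict_eq_self_of_ae_mem hO.ae_mem_exp]
  exact hf.aestronglyMeasurable hO.isOpen_image.measurableSet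

/-- Moves integrals of functions that vanish off a fixed compact set to a finite measure on a
compact subset of `E`. That subset need not lie in `O`, since logarithms may accumulate at the
boundary; this is harmless, because exp is smooth on all of `E`. -/
theorem exists_finite_measure (hO : IsWeaklyExponential m O) {S : Set G} (hS : IsCompact S) :
    ∃ (ρ : Measure E) (L : Set E), IsFiniteMeasure ρ ∧ IsCompact L ∧ ρ Lᶜ = 0 ∧
      ∀ f : G → ℂ, ContinuousOn f (lieExp '' O) → (∀ c ∉ S, f c = 0) →
        ∫ c, f c ∂m = ∫ X, f (lieExp X) ∂ρ := by
  haveI := hO.isAddHaarMeasure_algMeasure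
  let L : Set E := closure (lieLog O '' (S ∩ lieExp '' O))
  have hL : IsCompact L := hO.isCompact_closure_log hS
  let ρ : Measure E := ((((algMeasure m : Measure E).restrict O).withDensity
    fun X => ENNReal.ofReal |(dexp G O X).det|).restrict L)
  have hρ : ρ Lᶜ = 0 := by
    rw [Measure.restrict_apply hL.measurableSet.compl, compl_inter_self, measure_empty]
  refine ⟨ρ, L, ⟨?_⟩, hL, hρ, fun f hf hfS => ?_⟩
  · rw [Measure.restrict_apply_univ, withDensity_apply _ hL.measurableSet]
    have hcont : Continuous fun X : E => |(dexp G O X).det| :=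
      (ContinuousLinearMap.continuous_det.comp hO.contDiff_dexp.continuous).abs
    obtain ⟨C, hC⟩ := hL.bddAbove_image hcont.continuousOn
    refine (setLIntegral_mono measurable_const fun X hX =>
      ENNReal.ofReal_le_ofReal (hC (mem_image_of_mem _ hX))).trans_lt ?_
    rw [setLIntegral_const]
    exact ENNReal.mul_lt_top ENNReal.ofReal_lt_top
      ((Measure.restrict_apply_le _ _).trans_lt hL.measure_lt_top)
  · have hfm := hO.aestronglyMeasurable_of_continuousOn hf
    rw [← hO.expMeasure_algMeasure] at hfm
    conv_lhs => rw [← hO.expMeasure_algMeasure]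
    rw [expMeasure] at hfm ⊢
    rw [integral_map hO.measurable_exp.aemeasurable hfm]
    refine (setIntegral_eq_integral_of_ae_compl_eq_zero ?_).symm
    have h1 : ∀ᵐ X ∂((algMeasure m : Measure E).restrict O).withDensity
        (fun X => ENNReal.ofReal |(dexp G O X).det|), X ∈ O :=
      (withDensity_absolutelyContinuous _ _).ae_le (ae_restrict_mem hO.isOpen.measurableSet)
    filter_upwards [h1] with X hX hXL
    exact hfS _ fun h => hXL (hO.mem_closure_log hX h)

theorem continuousOn_of_contDiffAt_comp_exp (hO : IsWeaklyExponential m O) {f : G → ℂ}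
    (hf : ∀ X : E, ContDiffAt ℝ ∞ (fun X : E => f (lieExp X)) X) :
    ContinuousOn f (lieExp '' O) := by
  intro c hc
  have h1 : ContinuousWithinAt (fun c => f (lieExp (lieLog O c))) (lieExp '' O) c :=
    ContinuousAt.comp_continuousWithinAt (f := lieLog O) (g := fun X : E => f (lieExp X))
      (hf _).continuousAt (hO.contMDiffOn_log.continuousOn c hc)
  exact h1.congr (fun y hy => by rw [exp_log hy]) (by rw [exp_log hc])

theorem contDiffAt_slice {K : P → G → ℂ} {y : P} {X : E}
    (h : ContDiffAt ℝ ∞ (fun z : P × E => K z.1 (lieExp z.2)) (y, X)) :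
    ContDiffAt ℝ ∞ (fun X : E => K y (lieExp X)) X :=
  ContDiffAt.comp (f := fun X => (y, X)) X h (contDiffAt_const.prodMk contDiffAt_id)

theorem contDiffOn_integral_haar [FiniteDimensional ℝ P] (hO : IsWeaklyExponential m O) {U : Set P}
    (hU : IsOpen U) {S : Set G} (hS : IsCompact S) {K : P → G → ℂ}
    (hK0 : ∀ y ∈ U, ∀ c ∉ S, K y c = 0)
    (hK : ∀ y ∈ U, ∀ X : E, ContDiffAt ℝ ∞ (fun z : P × E => K z.1 (lieExp z.2)) (y, X)) :
    ContDiffOn ℝ ∞ (fun y => ∫ c, K y c ∂m) U := by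
  obtain ⟨ρ, L, hfin, hL, hρ, h⟩ := hO.exists_finite_measure hS
  refine (contDiffOn_integral_of_contDiffAt (H := fun z : P × E => K z.1 (lieExp z.2)) hL hρ hU
    fun y hy X _ => hK y hy X).congr fun y hy => ?_
  exact h _ (hO.continuousOn_of_contDiffAt_comp_exp fun X => contDiffAt_slice (hK y hy X))
    (hK0 y hy)

/-- The t-derivative of `K` inherits the support and smoothness conditions on the open set `U`, so
differentiation under the integral can be repeated. -/
theorem iteratedDeriv_integral_haar (hO : IsWeaklyExponential m O) {U : Set ℝ}
    (hU : IsOpen U) {S : Set G} (hS : IsCompact S) (l : ℕ) {K : ℝ → G → ℂ}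
    (hK0 : ∀ y ∈ U, ∀ c ∉ S, K y c = 0)
    (hK : ∀ y ∈ U, ∀ X : E, ContDiffAt ℝ ∞ (fun z : ℝ × E => K z.1 (lieExp z.2)) (y, X))
    {t : ℝ} (ht : t ∈ U) :
    iteratedDeriv l (fun t => ∫ c, K t c ∂m) t = ∫ c, iteratedDeriv l (fun t => K t c) t ∂m := by
  induction l generalizing K with
  | zero => simp
  | succ l ih =>
    let K' : ℝ → G → ℂ := fun t c => deriv (fun t => K t c) t
    have hK'0 : ∀ y ∈ U, ∀ c ∉ S, K' y c = 0 := fun y hy c hc => by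
      have : (fun t => K t c) =ᶠ[𝓝 y] fun _ => 0 := by
        filter_upwards [hU.mem_nhds hy] with s hs using hK0 s hs c hc
      simp only [K', this.deriv_eq, deriv_const]
    have hK' : ∀ y ∈ U, ∀ X : E,
        ContDiffAt ℝ ∞ (fun z : ℝ × E => K' z.1 (lieExp z.2)) (y, X) := fun y hy X => by
      refine contDiffAt_partialDeriv (P := ℝ × E) (H := fun z t => K t (lieExp z.2))
        (p₀ := (y, X)) (t₀ := fun z => z.1) ?_ contDiffAt_fst
      exact ContDiffAt.comp (f := fun w : (ℝ × E) × ℝ => (w.2, w.1.2))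
        (g := fun z : ℝ × E => K z.1 (lieExp z.2)) ((y, X), y) (hK y hy X) (by fun_prop)
    have hd : (fun t => deriv (fun t => ∫ c, K t c ∂m) t) =ᶠ[𝓝 t] fun t => ∫ c, K' t c ∂m := by
      filter_upwards [hU.mem_nhds ht] with s hs
      obtain ⟨ρ, L, hfin, hL, hρ, h⟩ := hO.exists_finite_measure hS
      obtain ⟨D, hD, hDv⟩ := hasFDerivAt_integral_of_contDiffAt
        (H := fun z : ℝ × E => K z.1 (lieExp z.2)) hL hρ hU (fun y hy X _ => hK y hy X) hs
      have e1 : (fun t => ∫ c, K t c ∂m) =ᶠ[𝓝 s] fun t => ∫ X, K t (lieExp X) ∂ρ := by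
        filter_upwards [hU.mem_nhds hs] with y hy
        exact h _ (hO.continuousOn_of_contDiffAt_comp_exp fun X => contDiffAt_slice (hK y hy X))
          (hK0 y hy)
      rw [e1.deriv_eq, hD.hasDerivAt.deriv, hDv, h (K' s)
        (hO.continuousOn_of_contDiffAt_comp_exp fun X => contDiffAt_slice (hK' s hs X)) (hK'0 s hs)]
      refine integral_congr_ae (Eventually.of_forall fun X => ?_)
      have h5 := ((hK s hs X).differentiableAt (by simp)).hasFDerivAt
      exact (h5.comp_hasDerivAt s ((hasDerivAt_id s).prodMk (hasDerivAt_const s X))).deriv.symm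
    rw [iteratedDeriv_succ', hd.iteratedDeriv_eq, ih hK'0 hK']
    simp only [iteratedDeriv_succ', K']

end IsWeaklyExponential

end HaarParametric

/-! ### Test functions and their integral kernels -/

section Kernels

variable {E : Type*} [NormedAddCommGroup E] [NormedSpace ℝ E] [FiniteDimensional ℝ E]
  [MeasurableSpace E] [BorelSpace E]
  {G : Type*} [Group G] [TopologicalSpace G] [T2Space G] [SecondCountableTopology G]
  [ChartedSpace E G] [LieGroup 𝓘(ℝ, E) ∞ G] [MeasurableSpace G] [BorelSpace G]
  {m : Measure G} {O : Set E} {k k' : G × G → ℂ}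

/-- Smooth functions on `G × G` of compact support. -/
structure IsTestKernel (E : Type*) [NormedAddCommGroup E] [NormedSpace ℝ E] {G : Type*}
    [TopologicalSpace G] [ChartedSpace E G] (k : G × G → ℂ) : Prop where
  smooth : ContMDiff (𝓘(ℝ, E).prod 𝓘(ℝ, E)) 𝓘(ℝ, ℂ) ∞ k
  compact : HasCompactSupport k

open Classical in
/-- The function on `G × 𝔤` whose integral kernel is `k`. -/
def kernelSymbol (O : Set E) (k : G × G → ℂ) : G × E → ℂ := fun z =>
  if z.2 ∈ O then (densF G z.2 : ℂ) *
    k (z.1 * lieExp (-(1 / 2 : ℝ) • z.2), z.1 * lieExp ((1 / 2 : ℝ) • z.2)) else 0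

theorem kernelSymbol_of_mem {X : E} (hX : X ∈ O) (q : G) : kernelSymbol O k (q, X) =
    (densF G X : ℂ) * k (q * lieExp (-(1 / 2 : ℝ) • X), q * lieExp ((1 / 2 : ℝ) • X)) := if_pos hX

theorem kernelSymbol_of_notMem {X : E} (hX : X ∉ O) (q : G) : kernelSymbol O k (q, X) = 0 :=
  if_neg hX

theorem IsTestKernel.smul (hk : IsTestKernel E k) (c : ℂ) : IsTestKernel E (c • k) :=
  ⟨(contDiff_const_smul c).contMDiff.comp hk.smooth,
    hk.compact.comp_left (g := fun z : ℂ => c • z) (by simp)⟩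

namespace IsWeaklyExponential

theorem exp_neg_half (hO : IsWeaklyExponential m O) (X : E) :
    (lieExp (-(1 / 2 : ℝ) • X) : G) = (lieExp ((1 / 2 : ℝ) • X))⁻¹ := by
  rw [neg_smul, hO.exp_neg]

theorem inv_exp_mul_exp (hO : IsWeaklyExponential m O) (q : G) (X : E) :
    (q * lieExp (-(1 / 2 : ℝ) • X))⁻¹ * (q * lieExp ((1 / 2 : ℝ) • X)) = lieExp X := by
  rw [hO.exp_neg_half, ← hO.exp_half_mul_half X]
  group

/-- The kernel formula is inverted by a = q exp(-X/2), b = q exp(X/2): then a⁻¹b = exp X, the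
midpoint a exp(X/2) is q, and F(X) ≠ 0 on `O`. -/
theorem eq_kernelSymbol (hO : IsWeaklyExponential m O) {φ : G × E → ℂ} (hφ : IsKernel O φ k)
    (h0 : ∀ q, ∀ X ∉ O, φ (q, X) = 0) : φ = kernelSymbol O k := by
  funext ⟨q, X⟩
  by_cases hX : X ∈ O
  · have h1 := hO.inv_exp_mul_exp q X
    have hlog : logAt O (q * lieExp (-(1 / 2 : ℝ) • X)) (q * lieExp ((1 / 2 : ℝ) • X)) = X := by
      rw [logAt, h1, hO.log_exp hX]
    have h2 := hφ.extends' (q * lieExp (-(1 / 2 : ℝ) • X)) (q * lieExp ((1 / 2 : ℝ) • X))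
      (by rw [h1]; exact mem_image_of_mem _ hX)
    have h3 : q * lieExp (-(1 / 2 : ℝ) • X) * lieExp ((1 / 2 : ℝ) • X) = q := by
      rw [hO.exp_neg_half]; group
    rw [hlog, h3] at h2
    have hF : (densF G X : ℂ) ≠ 0 := by exact_mod_cast (hO.densF_pos hX).ne'
    rw [kernelSymbol_of_mem hX, h2]
    field_simp
  · rw [kernelSymbol_of_notMem hX, h0 q X hX]

theorem isKernel_kernelSymbol (hO : IsWeaklyExponential m O) (hk : IsTestKernel E k) :
    IsKernel O (kernelSymbol O k) k := by
  refine ⟨hk.smooth, hk.compact, fun a b hab => ?_⟩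
  have hX : logAt O a b ∈ O := log_mem hab
  have hF : (densF G (logAt O a b) : ℂ) ≠ 0 := by exact_mod_cast (hO.densF_pos hX).ne'
  have h1 : a * lieExp ((1 / 2 : ℝ) • logAt O a b) * lieExp (-(1 / 2 : ℝ) • logAt O a b) = a := by
    rw [hO.exp_neg_half]; group
  have h2 : a * lieExp ((1 / 2 : ℝ) • logAt O a b) * lieExp ((1 / 2 : ℝ) • logAt O a b) = b := by
    rw [mul_assoc, hO.exp_half_mul_half, logAt, exp_log hab]; group
  rw [kernelSymbol_of_mem hX, h1, h2]
  field_simp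

variable [IsTopologicalGroup G] [LocallyCompactSpace G] [m.IsHaarMeasure]

theorem dense_exp (hO : IsWeaklyExponential m O) : Dense (lieExp '' O : Set G) :=
  Measure.dense_of_ae (μ := m) (p := fun x => x ∈ (lieExp '' O : Set G)) hO.ae_mem_exp

/-- The symbol prescribes the kernel where a⁻¹b ∈ exp(O), a dense set of b for each a; continuity
does the rest. -/
theorem eq_of_kernelSymbol_eq (hO : IsWeaklyExponential m O) (hk : IsTestKernel E k)
    (hk' : IsTestKernel E k') (h : kernelSymbol O k = kernelSymbol O k') : k = k' := by
  have h1 : ∀ a b : G, a⁻¹ * b ∈ (lieExp '' O : Set G) → k (a, b) = k' (a, b) := fun a b hab => by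
    rw [(hO.isKernel_kernelSymbol hk).extends' a b hab,
      (hO.isKernel_kernelSymbol hk').extends' a b hab, h]
  funext ⟨a, b⟩
  have hd : Dense {b : G | a⁻¹ * b ∈ (lieExp '' O : Set G)} :=
    hO.dense_exp.preimage (isOpenMap_mul_left a⁻¹)
  have hc : Continuous fun b => k (a, b) := hk.smooth.continuous.comp (by fun_prop)
  have hc' : Continuous fun b => k' (a, b) := hk'.smooth.continuous.comp (by fun_prop)
  exact congrFun (hc.ext_on hd hc' fun b hb => h1 a b hb) b

theorem continuous_kernel_comp (hO : IsWeaklyExponential m O) (hk : Continuous k) :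
    Continuous fun z : G × E => (densF G z.2 : ℂ) *
      k (z.1 * lieExp (-(1 / 2 : ℝ) • z.2), z.1 * lieExp ((1 / 2 : ℝ) • z.2)) := by
  have h1 : Continuous fun z : G × E => ((densF G z.2 : ℝ) : ℂ) :=
    Complex.continuous_ofReal.comp (hO.continuous_densF.comp continuous_snd)
  have h2 := hO.continuous_exp
  refine h1.mul (hk.comp ?_)
  fun_prop

theorem measurable_kernelSymbol (hO : IsWeaklyExponential m O) (hk : Continuous k) :
    Measurable (kernelSymbol O k) :=
  Measurable.ite (hO.isOpen.measurableSet.preimage measurable_snd)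
    (hO.continuous_kernel_comp hk).measurable measurable_const

/-- The symbol of a kernel of compact support is bounded and vanishes off a compact set. -/
theorem exists_bound_kernelSymbol (hO : IsWeaklyExponential m O) (hk : Continuous k)
    (hkc : HasCompactSupport k) : ∃ (Q : Set G) (L : Set E) (M : ℝ), IsCompact Q ∧ IsCompact L ∧
      0 ≤ M ∧ (∀ q X, q ∉ Q ∨ X ∉ L → kernelSymbol O k (q, X) = 0) ∧
      ∀ z, ‖kernelSymbol O k z‖ ≤ M := by
  let T : Set G := (fun z : G × G => z.1⁻¹ * z.2) '' tsupport k
  have hT : IsCompact T := hkc.isCompact.image (by fun_prop)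
  let L : Set E := closure (lieLog O '' (T ∩ lieExp '' O))
  have hL : IsCompact L := hO.isCompact_closure_log hT
  have hexp := hO.continuous_exp
  let Q : Set G := (fun z : (G × G) × E => z.1.1 * lieExp ((1 / 2 : ℝ) • z.2)) '' (tsupport k ×ˢ L)
  have hQ : IsCompact Q := (hkc.isCompact.prod hL).image (by fun_prop)
  have h0 : ∀ q X, kernelSymbol O k (q, X) ≠ 0 → q ∈ Q ∧ X ∈ L := fun q X h => by
    have hX : X ∈ O := by
      by_contra hX; exact h (kernelSymbol_of_notMem hX q)
    rw [kernelSymbol_of_mem hX] at h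
    have h1 := subset_tsupport k (mem_support.2 (right_ne_zero_of_mul h))
    have hXL : X ∈ L := hO.mem_closure_log hX ⟨_, h1, hO.inv_exp_mul_exp q X⟩
    refine ⟨⟨(_, X), ⟨h1, hXL⟩, ?_⟩, hXL⟩
    simp only
    rw [hO.exp_neg_half]; group
  obtain ⟨M, hM⟩ := (hQ.prod hL).exists_bound_of_continuousOn
    (hO.continuous_kernel_comp hk).continuousOn
  have hz : ∀ q X, q ∉ Q ∨ X ∉ L → kernelSymbol O k (q, X) = 0 := fun q X h => by
    by_contra h'
    obtain ⟨h1, h2⟩ := h0 q X h'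
    exact h.elim (fun h => h h1) (fun h => h h2)
  refine ⟨Q, L, max M 0, hQ, hL, le_max_right _ _, hz, fun ⟨q, X⟩ => ?_⟩
  by_cases h : kernelSymbol O k (q, X) = 0
  · rw [h, norm_zero]; exact le_max_right _ _
  · have hX : X ∈ O := by
      by_contra hX; exact h (kernelSymbol_of_notMem hX q)
    rw [kernelSymbol_of_mem hX]
    exact (hM (q, X) (h0 q X h)).trans (le_max_left _ _)

theorem kernelSymbol_mem_tildeF (hO : IsWeaklyExponential m O) (hk : IsTestKernel E k) :
    kernelSymbol O k ∈ tildeF m O := by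
  haveI := hO.isAddHaarMeasure_algMeasure
  obtain ⟨Q, L, M, hQ, hL, hM0, h0, hM⟩ := hO.exists_bound_kernelSymbol hk.smooth.continuous
    hk.compact
  have hm := hO.measurable_kernelSymbol hk.smooth.continuous
  have hb : ∀ q X, ‖kernelSymbol O k (q, X)‖ ≤ ‖(L.indicator (fun _ => M) X : ℝ)‖ := fun q X => by
    by_cases hX : X ∈ L
    · rw [indicator_of_mem hX, Real.norm_of_nonneg hM0]; exact hM _
    · rw [h0 q X (Or.inr hX), norm_zero]; exact norm_nonneg _
  refine ⟨?_, fun q X hX => kernelSymbol_of_notMem hX q, fun q => ?_, k,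
    hO.isKernel_kernelSymbol hk⟩
  · have hQL : MeasurableSet (Q ×ˢ L) := hQ.measurableSet.prod hL.measurableSet
    have hfin : (m.prod (algMeasure m)) (Q ×ˢ L) ≠ ⊤ := by
      rw [Measure.prod_prod]
      exact ENNReal.mul_ne_top hQ.measure_lt_top.ne hL.measure_lt_top.ne
    refine (memLp_indicator_const 2 hQL M (Or.inr hfin)).mono hm.aestronglyMeasurable
      (Eventually.of_forall fun z => ?_)
    by_cases hz : z ∈ Q ×ˢ L
    · rw [indicator_of_mem hz, Real.norm_of_nonneg hM0]; exact hM _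
    · rw [mem_prod, not_and_or] at hz
      rw [h0 z.1 z.2 hz, norm_zero]; exact norm_nonneg _
  · refine Integrable.mono ((integrable_indicator_iff hL.measurableSet).2
      (integrableOn_const hL.measure_lt_top.ne)) ?_ (Eventually.of_forall (hb q))
    exact (hm.comp measurable_prodMk_left).aestronglyMeasurable

theorem integrable_kernelSymbol (hO : IsWeaklyExponential m O) (hk : IsTestKernel E k) (q : G) :
    Integrable (fun X => kernelSymbol O k (q, X)) (algMeasure m) :=
  (hO.kernelSymbol_mem_tildeF hk).2.2.1 q

theorem isAddHaarMeasure_dualMeasure (hO : IsWeaklyExponential m O) :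
    (dualMeasure m : Measure (E →L[ℝ] ℝ)).IsAddHaarMeasure := by
  haveI := hO.isAddHaarMeasure_algMeasure
  have h1 : algMeasure m (_root_.parallelepiped (Module.finBasis ℝ E)) ≠ 0 := by
    have h2 := (Module.finBasis ℝ E).parallelepiped.interior_nonempty
    refine (Measure.measure_pos_of_nonempty_interior _ ?_).ne'
    exact h2
  have h2 : algMeasure m (_root_.parallelepiped (Module.finBasis ℝ E)) ≠ ⊤ :=
    ((Module.finBasis ℝ E).parallelepiped.isCompact.measure_lt_top (μ := algMeasure m)).ne
  exact Measure.IsAddHaarMeasure.smul _ (ENNReal.inv_ne_zero.2 h2) (ENNReal.inv_ne_top.2 h1)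

theorem kernelSymbol_continuousAt (hO : IsWeaklyExponential m O) (hk : Continuous k) (q : G) {X : E}
    (hX : X ∈ O) : ContinuousAt (fun X => kernelSymbol O k (q, X)) X := by
  have h1 := ((hO.continuous_kernel_comp hk).comp
    (by fun_prop : Continuous fun X : E => (q, X))).continuousAt (x := X)
  refine h1.congr ?_
  filter_upwards [hO.isOpen.mem_nhds hX] with Y hY
  exact (kernelSymbol_of_mem hY q).symm

theorem exists_cutoff : ∃ χ : (E →L[ℝ] ℝ) → ℝ, ContDiff ℝ ∞ χ ∧ HasCompactSupport χ ∧
    χ 0 = 1 := by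
  let η : ContDiffBump (0 : E →L[ℝ] ℝ) := ⟨1, 2, one_pos, one_lt_two⟩
  exact ⟨η, η.contDiff, η.hasCompactSupport, η.one_of_mem_closedBall (by simp [η.rIn_pos.le])⟩

theorem exists_complex_cutoff : ∃ χ : (E →L[ℝ] ℝ) → ℂ, ContDiff ℝ ∞ χ ∧ HasCompactSupport χ ∧
    χ 0 = 1 := by
  obtain ⟨χ, h1, h2, h3⟩ := exists_cutoff (E := E)
  exact ⟨fun p => (χ p : ℂ), Complex.ofRealCLM.contDiff.comp h1,
    h2.comp_left (g := fun x : ℝ => (x : ℂ)) (by simp), by simp [h3]⟩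

/-- `tilde` is a chosen preimage, and injectivity makes it canonical. At a point of `O` the symbol
is continuous, so the approximate delta recovers its value from the Fourier transform; off `O` it
vanishes. -/
theorem invFourier_injective (hO : IsWeaklyExponential m O) {ħ : ℝ} (hħ : ħ ≠ 0) :
    Injective (invFourier m ħ O) := by
  haveI := hO.isAddHaarMeasure_algMeasure
  haveI := hO.isAddHaarMeasure_dualMeasure
  rw [← LinearMap.ker_eq_bot, LinearMap.ker_eq_bot']
  rintro ⟨φ, hφ⟩ h0
  obtain ⟨-, hφ0, hφi, k, hk⟩ := id hφ
  obtain rfl := hO.eq_kernelSymbol hk hφ0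
  have hkc : Continuous k := hk.smooth.continuous
  obtain ⟨C, hC0, hC⟩ := exists_schwartz_fourier hħ (algMeasure m : Measure E)
    (dualMeasure m : Measure (E →L[ℝ] ℝ))
  obtain ⟨χ, hχ, hχc, hχ1⟩ := exists_complex_cutoff (E := E)
  obtain ⟨Ψ, hΨ, hΨ0⟩ := hC χ hχ hχc
  obtain ⟨Q, L, M, -, -, -, -, hM⟩ := hO.exists_bound_kernelSymbol hkc hk.compact
  refine Subtype.ext (funext fun ⟨q, X⟩ => ?_)
  change kernelSymbol O k (q, X) = 0
  by_cases hX : X ∈ O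
  · have h1 := tendsto_integral_cutoff (μ := (algMeasure m : Measure E))
      (A := fun X => kernelSymbol O k (q, X))
      ((hO.measurable_kernelSymbol hkc).comp measurable_prodMk_left) (fun X => hM (q, X))
      (X₀ := -X) (by rw [neg_neg]; exact hO.kernelSymbol_continuousAt hkc q hX) Ψ
    have h2 : ∀ᶠ ε : ℝ in 𝓝[>] 0, ∫ Z, kernelSymbol O k (q, ε • Z - -X) * Ψ Z ∂(algMeasure m) = 0 := by
      filter_upwards [self_mem_nhdsWithin] with ε hε
      rw [← integral_cutoff_mul_fourier hχ.continuous hχc hΨ (hφi q) (-X) hε]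
      refine (integral_congr_ae (Eventually.of_forall fun p => ?_)).trans (integral_zero _ _)
      have h3 : ∫ X, kernelSymbol O k (q, X) * phase ħ p X ∂(algMeasure m) = 0 :=
        congrFun h0 (q, p)
      simp only [h3, mul_zero]
    have h3 := tendsto_nhds_unique h1 (tendsto_const_nhds.congr' (h2.mono fun ε h => h.symm))
    rw [hΨ0, hχ1, neg_neg, mul_one] at h3
    exact (mul_eq_zero.1 h3).resolve_right hC0
  · exact kernelSymbol_of_notMem hX q

end IsWeaklyExponential

variable {ħ : ℝ}

theorem isTestKernel_kernel (f : testF m ħ O) : IsTestKernel E (kernel f) :=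
  ⟨(tilde f).2.2.2.2.choose_spec.smooth, (tilde f).2.2.2.2.choose_spec.compact⟩

theorem isKernel_kernel (f : testF m ħ O) : IsKernel O (tilde f).1 (kernel f) :=
  (tilde f).2.2.2.2.choose_spec

theorem invFourier_tilde (f : testF m ħ O) : invFourier m ħ O (tilde f) = f.1 :=
  (LinearMap.mem_range.1 f.2).choose_spec

namespace IsWeaklyExponential

theorem tilde_eq (hO : IsWeaklyExponential m O) (f : testF m ħ O) :
    (tilde f).1 = kernelSymbol O (kernel f) :=
  hO.eq_kernelSymbol (isKernel_kernel f) (tilde f).2.2.1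

theorem testF_apply (hO : IsWeaklyExponential m O) (f : testF m ħ O) (x : G × (E →L[ℝ] ℝ)) :
    f.1 x = ∫ X, kernelSymbol O (kernel f) (x.1, X) * phase ħ x.2 X ∂(algMeasure m) := by
  rw [← hO.tilde_eq]
  exact (congrFun (invFourier_tilde f) x).symm

variable [IsTopologicalGroup G] [LocallyCompactSpace G] [m.IsHaarMeasure]

/-- The test function with a given integral kernel. -/
def ofKernel (hO : IsWeaklyExponential m O) (ħ : ℝ) (hk : IsTestKernel E k) : testF m ħ O :=
  ⟨invFourier m ħ O ⟨kernelSymbol O k, hO.kernelSymbol_mem_tildeF hk⟩,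
    LinearMap.mem_range_self _ _⟩

theorem ofKernel_apply (hO : IsWeaklyExponential m O) (hk : IsTestKernel E k)
    (x : G × (E →L[ℝ] ℝ)) : (hO.ofKernel ħ hk).1 x =
      ∫ X, kernelSymbol O k (x.1, X) * phase ħ x.2 X ∂(algMeasure m) := rfl

/-- Injectivity of the Fourier transform fixes the symbol and density of exp(O) then fixes the
kernel, so the chosen kernel is the given one. -/
theorem kernel_ofKernel (hO : IsWeaklyExponential m O) (hħ : ħ ≠ 0) (hk : IsTestKernel E k) :
    kernel (hO.ofKernel ħ hk) = k := by
  have h1 := hO.invFourier_injective hħ (invFourier_tilde (hO.ofKernel ħ hk))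
  have h2 := hO.tilde_eq (hO.ofKernel ħ hk)
  rw [h1] at h2
  exact hO.eq_of_kernelSymbol_eq (isTestKernel_kernel _) hk h2.symm

theorem ofKernel_kernel (hO : IsWeaklyExponential m O) (f : testF m ħ O) :
    hO.ofKernel ħ (isTestKernel_kernel f) = f :=
  Subtype.ext (funext fun x => (hO.testF_apply f x).symm)

/-- Uniqueness of kernels makes the choice homogeneous. With `c = 0` it shows that the zero test
function has kernel zero. -/
theorem kernel_smul (hO : IsWeaklyExponential m O) (hħ : ħ ≠ 0) (c : ℂ) (f : testF m ħ O) :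
    kernel (c • f) = c • kernel f := by
  have hk := (isTestKernel_kernel f).smul c
  rw [← hO.kernel_ofKernel hħ hk]
  congr 1
  refine Subtype.ext ?_
  have h1 : (⟨kernelSymbol O (c • kernel f), hO.kernelSymbol_mem_tildeF hk⟩ : tildeF m O) =
      c • ⟨kernelSymbol O (kernel f), hO.kernelSymbol_mem_tildeF (isTestKernel_kernel f)⟩ := by
    refine Subtype.ext (funext fun z => ?_)
    simp only [kernelSymbol, Submodule.coe_smul, Pi.smul_apply, smul_eq_mul]
    split_ifs <;> ring
  change c • f.1 = invFourier m ħ O _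
  rw [h1, map_smul]
  conv_lhs => rw [← hO.ofKernel_kernel f]
  rfl

end IsWeaklyExponential

end Kernels

/-! ### The star-product as composition of integral kernels -/

section StarProduct

variable {E : Type*} [NormedAddCommGroup E] [NormedSpace ℝ E] [FiniteDimensional ℝ E]
  [MeasurableSpace E] [BorelSpace E]
  {G : Type*} [Group G] [TopologicalSpace G] [T2Space G] [SecondCountableTopology G]
  [ChartedSpace E G] [LieGroup 𝓘(ℝ, E) ∞ G] [MeasurableSpace G] [BorelSpace G]
  {m : Measure G} {O : Set E} {g h : G × G → ℂ}

/-- Composition of integral kernels. -/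
def kernelComp (m : Measure G) (g h : G × G → ℂ) (x : G × G) : ℂ :=
  ∫ c, g (x.1, c) * h (c, x.2) ∂m

/-- The density of the Haar measure in exponential coordinates, extended by zero. -/
def expDensity (G : Type*) [Group G] [TopologicalSpace G] [ChartedSpace E G] (O : Set E) : E → ℝ :=
  O.indicator fun X => |(dexp G O X).det|

theorem expDensity_of_mem {X : E} (hX : X ∈ O) : expDensity G O X = |(dexp G O X).det| :=
  indicator_of_mem hX _

theorem expDensity_of_notMem {X : E} (hX : X ∉ O) : expDensity G O X = 0 :=
  indicator_of_notMem hX _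

theorem expDensity_nonneg (X : E) : 0 ≤ expDensity G O X :=
  indicator_nonneg (fun _ _ => abs_nonneg _) X

namespace IsWeaklyExponential

theorem measurable_expDensity (hO : IsWeaklyExponential m O) :
    Measurable (expDensity G O : E → ℝ) :=
  ((ContinuousLinearMap.continuous_det.comp
    hO.contDiff_dexp.continuous).abs.measurable).indicator hO.isOpen.measurableSet

variable [IsTopologicalGroup G] [LocallyCompactSpace G] [m.IsHaarMeasure]

theorem map_withDensity_expDensity (hO : IsWeaklyExponential m O) :
    ((algMeasure m : Measure E).withDensity fun X => ENNReal.ofReal (expDensity G O X)).map lieExp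
      = m := by
  conv_rhs => rw [← hO.expMeasure_algMeasure]
  rw [expMeasure, ← withDensity_indicator hO.isOpen.measurableSet]
  congr 2
  funext X
  by_cases hX : X ∈ O
  · rw [expDensity_of_mem hX, indicator_of_mem hX]
  · rw [expDensity_of_notMem hX, indicator_of_notMem hX, ENNReal.ofReal_zero]

theorem integral_prod_haar_right (hO : IsWeaklyExponential m O) {α : Type*} [MeasurableSpace α]
    (τ : Measure α) [SFinite τ] {f : α × G → ℂ} (hf : Measurable f) :
    ∫ z, f z ∂(τ.prod m) =
      ∫ z, (expDensity G O z.2 : ℂ) * f (z.1, lieExp z.2) ∂(τ.prod (algMeasure m)) := by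
  haveI := hO.isAddHaarMeasure_algMeasure
  have hd : Measurable fun X : E => ENNReal.ofReal (expDensity G O X) :=
    hO.measurable_expDensity.ennreal_ofReal
  have hd2 : Measurable fun z : α × E => ENNReal.ofReal (expDensity G O z.2) :=
    hd.comp measurable_snd
  have h1 : τ.prod m = ((τ.prod (algMeasure m : Measure E)).withDensity
      fun z => ENNReal.ofReal (expDensity G O z.2)).map (Prod.map id lieExp) := by
    rw [← prod_withDensity_right hd, ← Measure.map_prod_map _ _ measurable_id hO.measurable_exp,
      hO.map_withDensity_expDensity, Measure.map_id]
  rw [h1, integral_map (measurable_id.prodMap hO.measurable_exp).aemeasurable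
    hf.aestronglyMeasurable]
  have h2 := integral_withDensity_eq_integral_toReal_smul hd2
    (μ := τ.prod (algMeasure m : Measure E)) (Eventually.of_forall fun z => ENNReal.ofReal_lt_top)
    (fun z : α × E => f (Prod.map id lieExp z))
  refine Eq.trans h2 (integral_congr_ae (Eventually.of_forall fun z => ?_))
  simp only [ENNReal.toReal_ofReal (expDensity_nonneg _), Complex.real_smul, Prod.map, id]

theorem integral_prod_haar (hO : IsWeaklyExponential m O) {f : G × G → ℂ} (hf : Measurable f) :
    ∫ z, f z ∂(m.prod m) = ∫ z : E × E, (expDensity G O z.1 : ℂ) * (expDensity G O z.2 : ℂ) *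
      f (lieExp z.1, lieExp z.2) ∂((algMeasure m).prod (algMeasure m)) := by
  haveI := hO.isAddHaarMeasure_algMeasure
  have hexp := hO.measurable_exp
  have hd : Measurable fun X : E => ((expDensity G O X : ℝ) : ℂ) :=
    Complex.measurable_ofReal.comp hO.measurable_expDensity
  rw [hO.integral_prod_haar_right m hf, ← integral_prod_swap, hO.integral_prod_haar_right, 
    ← integral_prod_swap]
  · refine integral_congr_ae (Eventually.of_forall fun z => ?_)
    simp only [Prod.swap]
    ring
  · have h1 : Measurable fun z : E × G => f (z.2, lieExp z.1) :=
      hf.comp (measurable_snd.prodMk (hexp.comp measurable_fst))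
    exact (hd.comp measurable_fst).mul h1

/-- The integration variable runs over the compact projection of the support of `g`, whatever the
outer variables, so Haar integrals with smooth parameters apply. -/
theorem isTestKernel_kernelComp (hO : IsWeaklyExponential m O) (hg : IsTestKernel E g)
    (hh : IsTestKernel E h) : IsTestKernel E (kernelComp m g h) := by
  have hS : IsCompact (Prod.snd '' tsupport g) := hg.compact.isCompact.image continuous_snd
  have h0 : ∀ a c, c ∉ Prod.snd '' tsupport g → g (a, c) = 0 := fun a c hc => by
    by_contra h
    exact hc ⟨(a, c), subset_tsupport g h, rfl⟩
  refine ⟨hO.contMDiff_of_comp_exp_prod fun a b => ?_, ?_⟩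
  · refine (hO.contDiffOn_integral_haar (P := E × E) isOpen_univ hS
      (K := fun z c => g (a * lieExp z.1, c) * h (c, b * lieExp z.2))
      (fun z _ c hc => by rw [h0 _ c hc, zero_mul]) fun z _ X => ?_).contDiffAt univ_mem
    have hc : ContMDiffAt 𝓘(ℝ, (E × E) × E) 𝓘(ℝ, E) ∞
        (fun w : (E × E) × E => (lieExp w.2 : G)) (z, X) := hO.contMDiffAt_exp_comp contDiffAt_snd
    refine ContDiffAt.mul ?_ ?_
    · exact contDiffAt_kernel_comp hg.smooth (hO.contMDiffAt_mul_exp contMDiffAt_const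
        (contDiffAt_fst.comp _ contDiffAt_fst)) hc
    · exact contDiffAt_kernel_comp hh.smooth hc (hO.contMDiffAt_mul_exp contMDiffAt_const
        (contDiffAt_snd.comp _ contDiffAt_fst))
  · refine HasCompactSupport.of_support_subset_isCompact
      ((hg.compact.isCompact.image continuous_fst).prod (hh.compact.isCompact.image continuous_snd))
      fun ⟨a, b⟩ hab => ?_
    by_contra hn
    refine hab ((integral_congr_ae (Eventually.of_forall fun c => ?_)).trans (integral_zero _ _))
    by_contra hne
    exact hn ⟨⟨(a, c), subset_tsupport g (left_ne_zero_of_mul hne), rfl⟩,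
      ⟨(c, b), subset_tsupport h (right_ne_zero_of_mul hne), rfl⟩⟩

-- With x = exp X and z = exp X exp Y the integral over pairs (X, Y) becomes a Haar integral over
-- (x, z). Put Z = X ⋄ Y, α = q exp(-Z/2), β = q exp(Z/2): the two symbols turn into the kernels at
-- (α, αx) and (αx, β). Left invariance replaces αx by a free variable, whose integral is the
-- composition of the kernels at (α, β).
open scoped Pointwise in
theorem starProd_eq (hO : IsWeaklyExponential m O) {ħ : ℝ} (g h : testF m ħ O)
    (x : G × (E →L[ℝ] ℝ)) : starProd g h x = ∫ Z, kernelSymbol O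
      (kernelComp m (kernel g) (kernel h)) (x.1, Z) * phase ħ x.2 Z ∂(algMeasure m) := by
  haveI := hO.isAddHaarMeasure_algMeasure
  obtain ⟨q, p⟩ := x
  set kg := kernel g with hkg
  set kh := kernel h with hkh
  have hg : IsTestKernel E kg := isTestKernel_kernel g
  have hh : IsTestKernel E kh := isTestKernel_kernel h
  have hgc := hg.smooth.continuous
  have hhc := hh.smooth.continuous
  have hexp := hO.continuous_exp
  let U : Set G := lieExp '' O
  let α : E → G := fun Z => q * lieExp (-(1 / 2 : ℝ) • Z)
  let β : E → G := fun Z => q * lieExp ((1 / 2 : ℝ) • Z)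
  have hα : Continuous α := by fun_prop
  have hβ : Continuous β := by fun_prop
  have hαβ : ∀ Z, β Z = α Z * lieExp Z := fun Z => by
    rw [← hO.inv_exp_mul_exp q Z]; simp only [α, β]; group
  -- The integrand in the variables x and z; the quotient in front is what remains of the densities,
  -- as `hdens` shows.
  let w : G × G → ℂ := fun z => ((densF G (lieLog O z.2) / |(dexp G O (lieLog O z.2)).det| : ℝ) : ℂ) *
    (kg (α (lieLog O z.2), α (lieLog O z.2) * z.1) *
    kh (α (lieLog O z.2) * z.1, β (lieLog O z.2)) * phase ħ p (lieLog O z.2))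
  classical
  -- Extension by zero to the z without a logarithm in `O`, in accordance with the convention that L
  -- vanishes off its domain.
  let W : G × G → ℂ := (univ ×ˢ U).piecewise w 0
  have hW1 : ∀ x z, z ∈ U → W (x, z) = w (x, z) := fun x z hz =>
    piecewise_eq_of_mem _ _ _ ⟨mem_univ _, hz⟩
  have hW0 : ∀ x z, z ∉ U → W (x, z) = 0 := fun x z hz =>
    piecewise_eq_of_notMem _ _ _ fun h => hz h.2
  have hlog : ContinuousOn (fun z : G × G => lieLog O z.2) (univ ×ˢ U) :=
    hO.contMDiffOn_log.continuousOn.comp continuousOn_snd fun z hz => hz.2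
  have hWm : Measurable W := by
    refine ContinuousOn.measurable_piecewise ?_ continuousOn_const
      (MeasurableSet.univ.prod hO.isOpen_image.measurableSet)
    have h1 : ContinuousOn (fun z : G × G =>
        densF G (lieLog O z.2) / |(dexp G O (lieLog O z.2)).det|) (univ ×ˢ U) := by
      refine ContinuousOn.div (hO.continuous_densF.comp_continuousOn hlog)
        (((ContinuousLinearMap.continuous_det.comp
          hO.contDiff_dexp.continuous).abs).comp_continuousOn hlog) fun z hz => ?_
      exact abs_ne_zero.2 (hO.dexp_det_ne_zero (log_mem hz.2))
    refine (Complex.continuous_ofReal.comp_continuousOn h1).mul (ContinuousOn.mul ?_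
      ((continuous_phase_right ħ p).comp_continuousOn hlog))
    have h2 := hα.comp_continuousOn hlog
    have h3 := hβ.comp_continuousOn hlog
    have h4 : ContinuousOn (fun z : G × G => α (lieLog O z.2) * z.1) (univ ×ˢ U) :=
      h2.mul continuousOn_fst
    exact (hgc.comp_continuousOn (h2.prodMk h4)).mul (hhc.comp_continuousOn (h4.prodMk h3))
  have hshear : ∫ z : G × G, W (z.1, z.1 * z.2) ∂(m.prod m) = ∫ z, W z ∂(m.prod m) :=
    (measurePreserving_prod_mul m m).integral_comp
      (MeasurableEquiv.shearMulRight G).measurableEmbedding W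
  -- Since `modRoot` is multiplicative, the modular factors cancel in F(X)² F(Y)² / F(Z)² and only
  -- Jacobians of exp remain.
  have hdens : ∀ X Y : E, X ∈ O → Y ∈ O → lieExp X * lieExp Y ∈ U →
      (densF G X) ^ 2 * (densF G Y) ^ 2 / densF G (bch G O X Y) =
      |(dexp G O X).det| * |(dexp G O Y).det| *
        (densF G (bch G O X Y) / |(dexp G O (bch G O X Y)).det|) := fun X Y hX hY hXY => by
    have hZ : bch G O X Y ∈ O := log_mem hXY
    have h1 := (hO.densF_pos hZ).ne'
    have h2 : |(dexp G O (bch G O X Y)).det| ≠ 0 := abs_ne_zero.2 (hO.dexp_det_ne_zero hZ)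
    have h3 : modRoot O (lieExp (bch G O X Y) : G) =
        modRoot O (lieExp X : G) * modRoot O (lieExp Y : G) := by
      rw [bch, exp_log hXY, hO.modRoot_mul]
    have h4 := hO.densF_sq (bch G O X Y)
    rw [hO.densF_sq X, hO.densF_sq Y]
    rw [h3] at h4
    field_simp
    linear_combination (-|(dexp G O X).det| * |(dexp G O Y).det|) * h4
  have hstep1 : starProd g h (q, p) = ∫ z : G × G, W (z.1, z.1 * z.2) ∂(m.prod m) := by
    rw [hO.integral_prod_haar (f := fun z => W (z.1, z.1 * z.2)) (hWm.comp (by fun_prop))]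
    rw [starProd]
    refine integral_congr_ae (Eventually.of_forall fun ⟨X, Y⟩ => ?_)
    simp only [hO.tilde_eq]
    by_cases hd : (X, Y) ∈ bchDomain G O
    · obtain ⟨hX, hY, hXY⟩ := id hd
      simp only at hX hY hXY
      have hZ : lieExp (bch G O X Y) = (lieExp X * lieExp Y : G) := exp_log hXY
      rw [kernelSymbol_of_mem hX, kernelSymbol_of_mem hY, hW1 _ _ hXY, densL, if_pos hd,
        expDensity_of_mem hX, expDensity_of_mem hY]
      have e1 : q * lieExp (-(1 / 2 : ℝ) • bch G O X Y) * lieExp ((1 / 2 : ℝ) • X) *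
          lieExp (-(1 / 2 : ℝ) • X) = α (bch G O X Y) := by
        simp only [α]
        rw [hO.exp_neg_half X]; group
      have e2 : q * lieExp (-(1 / 2 : ℝ) • bch G O X Y) * lieExp ((1 / 2 : ℝ) • X) *
          lieExp ((1 / 2 : ℝ) • X) = α (bch G O X Y) * lieExp X := by
        rw [mul_assoc, hO.exp_half_mul_half]
      have e3 : q * lieExp ((1 / 2 : ℝ) • bch G O X Y) * lieExp (-(1 / 2 : ℝ) • Y) *
          lieExp ((1 / 2 : ℝ) • Y) = β (bch G O X Y) := by
        simp only [β]
        rw [hO.exp_neg_half Y]; group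
      have e4 : q * lieExp ((1 / 2 : ℝ) • bch G O X Y) * lieExp (-(1 / 2 : ℝ) • Y) *
          lieExp (-(1 / 2 : ℝ) • Y) = α (bch G O X Y) * lieExp X := by
        have h5 : (lieExp (-(1 / 2 : ℝ) • Y) * lieExp (-(1 / 2 : ℝ) • Y) : G) = (lieExp Y)⁻¹ := by
          rw [hO.exp_neg_half, ← hO.exp_half_mul_half Y]; group
        rw [mul_assoc, h5]
        change β (bch G O X Y) * _ = _
        rw [hαβ, hZ]; group
      rw [e1, e2, e3, e4]
      simp only [w]
      change _ = _ * (((densF G (bch G O X Y) / |(dexp G O (bch G O X Y)).det| : ℝ) : ℂ) *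
        (kg (α (bch G O X Y), α (bch G O X Y) * lieExp X) *
        kh (α (bch G O X Y) * lieExp X, β (bch G O X Y)) * phase ħ p (bch G O X Y)))
      have hd' := congrArg (fun r : ℝ => (r : ℂ)) (hdens X Y hX hY hXY)
      simp only [Complex.ofReal_div, Complex.ofReal_mul, Complex.ofReal_pow] at hd' ⊢
      linear_combination (kg (α (bch G O X Y), α (bch G O X Y) * lieExp X) *
        kh (α (bch G O X Y) * lieExp X, β (bch G O X Y)) * phase ħ p (bch G O X Y)) * hd'
    · rw [densL, if_neg hd, Complex.ofReal_zero, mul_zero]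
      by_cases hX : X ∈ O
      · by_cases hY : Y ∈ O
        · rw [hW0 _ _ fun hXY => hd ⟨hX, hY, hXY⟩, mul_zero]
        · rw [expDensity_of_notMem hY]; simp
      · rw [expDensity_of_notMem hX]; simp
  have hVeq : ∀ (x : G) (Z : E), (expDensity G O Z : ℂ) * W (x, lieExp Z) =
      if Z ∈ O then (densF G Z : ℂ) * phase ħ p Z * (kg (α Z, α Z * x) * kh (α Z * x, β Z))
      else 0 := fun x Z => by
    split_ifs with hZ
    · rw [hW1 _ _ (mem_image_of_mem _ hZ), expDensity_of_mem hZ]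
      simp only [w, hO.log_exp hZ]
      have h2 : ((|(dexp G O Z).det| : ℝ) : ℂ) ≠ 0 := by
        exact_mod_cast abs_ne_zero.2 (hO.dexp_det_ne_zero hZ)
      push_cast
      field_simp
    · rw [expDensity_of_notMem hZ, Complex.ofReal_zero, zero_mul]
  -- For Fubini: αx and β range over the supports of the kernels, which confines x and Z to compact
  -- sets.
  have hint : Integrable (fun z : G × E => (expDensity G O z.2 : ℂ) * W (z.1, lieExp z.2))
      (m.prod (algMeasure m)) := by
    have hS1 : IsCompact (Prod.fst '' tsupport kg) := hg.compact.isCompact.image continuous_fst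
    have hS2 : IsCompact (Prod.snd '' tsupport kg) := hg.compact.isCompact.image continuous_snd
    have hS3 : IsCompact (Prod.snd '' tsupport kh) := hh.compact.isCompact.image continuous_snd
    have hT : IsCompact ((Prod.fst '' tsupport kg)⁻¹ * (Prod.snd '' tsupport kh)) := hS1.inv.mul hS3
    let L : Set E := closure (lieLog O ''
      (((Prod.fst '' tsupport kg)⁻¹ * (Prod.snd '' tsupport kh)) ∩ lieExp '' O))
    have hL : IsCompact L := hO.isCompact_closure_log hT
    let Q : Set G := (Prod.fst '' tsupport kg)⁻¹ * (Prod.snd '' tsupport kg)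
    have hQ : IsCompact Q := hS1.inv.mul hS2
    obtain ⟨M1, hM1⟩ := hL.exists_bound_of_continuousOn hO.continuous_densF.continuousOn
    obtain ⟨M2, hM2⟩ := hg.compact.exists_bound_of_continuous hgc
    obtain ⟨M3, hM3⟩ := hh.compact.exists_bound_of_continuous hhc
    have hQL : MeasurableSet (Q ×ˢ L) := hQ.measurableSet.prod hL.measurableSet
    have hfin : (m.prod (algMeasure m)) (Q ×ˢ L) ≠ ⊤ := by
      rw [Measure.prod_prod]
      exact ENNReal.mul_ne_top hQ.measure_lt_top.ne hL.measure_lt_top.ne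
    have hm : Measurable fun z : G × E => (expDensity G O z.2 : ℂ) * W (z.1, lieExp z.2) :=
      (Complex.measurable_ofReal.comp (hO.measurable_expDensity.comp measurable_snd)).mul
        (hWm.comp (measurable_fst.prodMk (hO.measurable_exp.comp measurable_snd)))
    refine Integrable.mono ((integrable_indicator_iff hQL).2
      (integrableOn_const hfin (C := M1 * (M2 * M3)))) hm.aestronglyMeasurable
      (Eventually.of_forall fun ⟨x, Z⟩ => ?_)
    simp only [hVeq]
    split_ifs with hZ
    · by_cases h0 : kg (α Z, α Z * x) * kh (α Z * x, β Z) = 0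
      · rw [h0, mul_zero, norm_zero]; exact norm_nonneg _
      · have m1 := subset_tsupport kg (left_ne_zero_of_mul h0)
        have m2 := subset_tsupport kh (right_ne_zero_of_mul h0)
        have hx : x ∈ Q := ⟨(α Z)⁻¹, inv_mem_inv.2 ⟨_, m1, rfl⟩, α Z * x, ⟨_, m1, rfl⟩,
          by simp⟩
        have hZL : Z ∈ L := hO.mem_closure_log hZ ⟨(α Z)⁻¹, inv_mem_inv.2 ⟨_, m1, rfl⟩, β Z,
          ⟨_, m2, rfl⟩, by simp [hαβ]⟩
        rw [indicator_of_mem (show (x, Z) ∈ Q ×ˢ L from ⟨hx, hZL⟩)]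
        rw [norm_mul, norm_mul, norm_phase, mul_one, norm_mul, Complex.norm_real]
        refine le_trans ?_ (Real.le_norm_self _)
        have n1 := hM1 Z hZL
        have n2 := hM2 (α Z, α Z * x)
        have n3 := hM3 (α Z * x, β Z)
        have p1 : 0 ≤ M1 := (norm_nonneg _).trans n1
        have p2 : 0 ≤ M2 := (norm_nonneg _).trans n2
        gcongr
    · rw [norm_zero]; exact norm_nonneg _
  rw [hstep1, hshear, hO.integral_prod_haar_right m hWm, integral_prod_symm _ hint]
  refine integral_congr_ae (Eventually.of_forall fun Z => ?_)
  simp only [hVeq]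
  by_cases hZ : Z ∈ O
  · simp only [if_pos hZ, kernelSymbol_of_mem hZ]
    rw [integral_const_mul, integral_mul_left_eq_self (fun y => kg (α Z, y) * kh (y, β Z)) (α Z)]
    simp only [kernelComp, α, β]
    ring
  · simp only [if_neg hZ, kernelSymbol_of_notMem hZ, integral_zero, zero_mul]

theorem starProd_eq_ofKernel (hO : IsWeaklyExponential m O) {ħ : ℝ} (g h : testF m ħ O) :
    (hO.ofKernel ħ (hO.isTestKernel_kernelComp (isTestKernel_kernel g)
      (isTestKernel_kernel h))).1 = starProd g h :=
  funext fun x => (hO.starProd_eq g h x).symm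

end IsWeaklyExponential

end StarProduct

/-! ### Improper integrals over the phase space -/

section Improper

variable {E : Type*} [NormedAddCommGroup E] [NormedSpace ℝ E] [FiniteDimensional ℝ E]
  [MeasurableSpace E] [BorelSpace E]
  {G : Type*} [Group G] [TopologicalSpace G] [T2Space G] [SecondCountableTopology G]
  [ChartedSpace E G] [LieGroup 𝓘(ℝ, E) ∞ G] [MeasurableSpace G] [BorelSpace G]
  {m : Measure G} {O : Set E} {ħ : ℝ} {k k' : G × G → ℂ}

theorem HasImproperIntegral.unique {u : G × (E →L[ℝ] ℝ) → ℂ} {v v' : ℂ}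
    (h : HasImproperIntegral m u v) (h' : HasImproperIntegral m u v') : v = v' := by
  obtain ⟨χ, h1, h2, h3⟩ := IsWeaklyExponential.exists_cutoff (E := E)
  exact tendsto_nhds_unique (h χ h1 h2 h3).2 (h' χ h1 h2 h3).2

theorem HasImproperIntegral.add {u u' : G × (E →L[ℝ] ℝ) → ℂ} {v v' : ℂ}
    (h : HasImproperIntegral m u v) (h' : HasImproperIntegral m u' v') :
    HasImproperIntegral m (fun x => u x + u' x) (v + v') := by
  intro χ h1 h2 h3
  obtain ⟨hi, ht⟩ := h χ h1 h2 h3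
  obtain ⟨hi', ht'⟩ := h' χ h1 h2 h3
  refine ⟨fun ε hε => ?_, (ht.add ht').congr' ?_⟩
  · exact ((hi ε hε).add (hi' ε hε)).congr (Eventually.of_forall fun x => (mul_add _ _ _).symm)
  · filter_upwards [self_mem_nhdsWithin] with ε hε
    rw [← integral_add (hi ε hε) (hi' ε hε)]
    simp only [mul_add]

theorem HasImproperIntegral.const_mul {u : G × (E →L[ℝ] ℝ) → ℂ} {v : ℂ} (c : ℂ)
    (h : HasImproperIntegral m u v) : HasImproperIntegral m (fun x => c * u x) (c * v) := by
  intro χ h1 h2 h3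
  obtain ⟨hi, ht⟩ := h χ h1 h2 h3
  refine ⟨fun ε hε => ?_, (ht.const_mul c).congr fun ε => ?_⟩
  · simpa only [mul_left_comm] using (hi ε hε).const_mul c
  · rw [← integral_const_mul]
    simp only [mul_left_comm]

/-- A function on the phase space defines a functional as soon as all the improper integrals
exist. -/
theorem exists_represents {u : G × (E →L[ℝ] ℝ) → ℂ}
    (hu : ∀ h : testF m ħ O, ∃ v, HasImproperIntegral m (fun x => u x * h.1 x) v) :
    ∃ T : Module.Dual ℂ (testF m ħ O), Represents u T := by
  choose T hT using hu
  refine ⟨{ toFun := T, map_add' := fun f g => ?_, map_smul' := fun c f => ?_ }, hT⟩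
  · refine (hT (f + g)).unique ?_
    simpa only [Submodule.coe_add, Pi.add_apply, mul_add] using (hT f).add (hT g)
  · refine (hT (c • f)).unique ?_
    simpa only [Submodule.coe_smul, Pi.smul_apply, smul_eq_mul, RingHom.id_apply, mul_left_comm]
      using (hT f).const_mul c

namespace IsWeaklyExponential

variable [IsTopologicalGroup G] [LocallyCompactSpace G] [m.IsHaarMeasure]

theorem integral_mul_right_haar (hO : IsWeaklyExponential m O) (f : G → ℂ) (b : G) :
    ∫ x, f (x * b) ∂m = ((modRoot O b ^ 2 : ℝ) : ℂ) * ∫ x, f x ∂m := by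
  have h1 := (MeasurableEquiv.mulRight b).measurableEmbedding.integral_map (μ := m) f
  have h2 : m.map (MeasurableEquiv.mulRight b) = ENNReal.ofReal (modRoot O b ^ 2) • m :=
    hO.map_mul_right b
  rw [h2, integral_smul_measure, ENNReal.toReal_ofReal (sq_nonneg _), Complex.real_smul] at h1
  exact h1.symm

theorem continuous_kernelSymbol_left (hO : IsWeaklyExponential m O) (hk : Continuous k) (X : E) :
    Continuous fun q => kernelSymbol O k (q, X) := by
  by_cases hX : X ∈ O
  · simp only [kernelSymbol_of_mem hX]
    have hexp := hO.continuous_exp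
    refine continuous_const.mul (hk.comp ?_)
    fun_prop
  · simp only [kernelSymbol_of_notMem hX]
    exact continuous_const

theorem integrable_kernelSymbol_prod (hO : IsWeaklyExponential m O) (hk : IsTestKernel E k) :
    Integrable (kernelSymbol O k) (m.prod (algMeasure m)) := by
  haveI := hO.isAddHaarMeasure_algMeasure
  obtain ⟨Q, L, M, hQ, hL, hM0, h0, hM⟩ := hO.exists_bound_kernelSymbol hk.smooth.continuous
    hk.compact
  have hQL : MeasurableSet (Q ×ˢ L) := hQ.measurableSet.prod hL.measurableSet
  have hfin : (m.prod (algMeasure m)) (Q ×ˢ L) ≠ ⊤ := by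
    rw [Measure.prod_prod]
    exact ENNReal.mul_ne_top hQ.measure_lt_top.ne hL.measure_lt_top.ne
  refine Integrable.mono ((integrable_indicator_iff hQL).2 (integrableOn_const hfin (C := M)))
    (hO.measurable_kernelSymbol hk.smooth.continuous).aestronglyMeasurable
    (Eventually.of_forall fun z => ?_)
  by_cases hz : z ∈ Q ×ˢ L
  · rw [indicator_of_mem hz, Real.norm_of_nonneg hM0]; exact hM _
  · rw [mem_prod, not_and_or] at hz
    rw [h0 z.1 z.2 hz, norm_zero]; exact norm_nonneg _

theorem continuous_fourier_kernelSymbol (hO : IsWeaklyExponential m O) (hk : IsTestKernel E k) :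
    Continuous fun x : G × (E →L[ℝ] ℝ) =>
      ∫ X, kernelSymbol O k (x.1, X) * phase ħ x.2 X ∂(algMeasure m) := by
  haveI := hO.isAddHaarMeasure_algMeasure
  obtain ⟨Q, L, M, hQ, hL, hM0, h0, hM⟩ := hO.exists_bound_kernelSymbol hk.smooth.continuous
    hk.compact
  refine continuous_of_dominated (bound := L.indicator fun _ => M)
    (fun x => (phase_integrable ħ x.2 (hO.integrable_kernelSymbol hk x.1)).1)
    (fun x => Eventually.of_forall fun X => ?_)
    ((integrable_indicator_iff hL.measurableSet).2 (integrableOn_const hL.measure_lt_top.ne))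
    (Eventually.of_forall fun X => ?_)
  · rw [norm_mul, norm_phase, mul_one]
    by_cases hX : X ∈ L
    · rw [indicator_of_mem hX]; exact hM _
    · rw [indicator_of_notMem hX, h0 _ _ (Or.inr hX), norm_zero]
  · exact ((hO.continuous_kernelSymbol_left hk.smooth.continuous X).comp continuous_fst).mul
      ((continuous_phase_left ħ X).comp continuous_snd)

theorem isHaar_liouville_parts (hO : IsWeaklyExponential m O) :
    (algMeasure m : Measure E).IsAddHaarMeasure ∧
      (dualMeasure m : Measure (E →L[ℝ] ℝ)).IsAddHaarMeasure :=
  ⟨hO.isAddHaarMeasure_algMeasure, hO.isAddHaarMeasure_dualMeasure⟩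

/-- Cut-offs of test functions, multiplied with continuous functions, are integrable. -/
theorem integrable_cutoff_mul (hO : IsWeaklyExponential m O) (hk : IsTestKernel E k)
    {f : G × (E →L[ℝ] ℝ) → ℂ}
    (hfa : ∀ x, f x = ∫ X, kernelSymbol O k (x.1, X) * phase ħ x.2 X ∂(algMeasure m)) {u : G × (E →L[ℝ] ℝ) → ℂ} (hu : Continuous u) {χ : (E →L[ℝ] ℝ) → ℝ} (hχ : Continuous χ)
    (hχc : HasCompactSupport χ) {ε : ℝ} (hε : 0 < ε) :
    Integrable (fun x : G × (E →L[ℝ] ℝ) => (χ (ε • x.2) : ℂ) * (u x * f x)) (liouville m) := by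
  obtain ⟨h1, h2⟩ := hO.isHaar_liouville_parts
  obtain ⟨Q, L, M, hQ, hL, hM0, h0, hM⟩ := hO.exists_bound_kernelSymbol hk.smooth.continuous
    hk.compact
  have hf : Continuous f := by
    rw [show f = fun x => _ from funext hfa]
    exact hO.continuous_fourier_kernelSymbol hk
  have hχε : HasCompactSupport fun p : E →L[ℝ] ℝ => χ (ε • p) :=
    hχc.comp_homeomorph (Homeomorph.smulOfNeZero ε hε.ne')
  rw [liouville]
  refine Continuous.integrable_of_hasCompactSupport ?_ ?_
  · exact (Complex.continuous_ofReal.comp (hχ.comp (by fun_prop))).mul (hu.mul hf)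
  · refine HasCompactSupport.of_support_subset_isCompact (hQ.prod hχε.isCompact) fun x hx => ?_
    have h3 := left_ne_zero_of_mul hx
    have h4 := right_ne_zero_of_mul (right_ne_zero_of_mul hx)
    refine ⟨?_, subset_tsupport (fun p : E →L[ℝ] ℝ => χ (ε • p)) (fun h => h3 (by
      change χ (ε • x.2) = 0 at h; simp [h]))⟩
    by_contra hq
    refine h4 ?_
    rw [hfa]
    simp [h0 x.1 _ (Or.inl hq)]

/-- The normalization constant of the Fourier transform. -/
theorem exists_fourier_const (hO : IsWeaklyExponential m O) (hħ : ħ ≠ 0) :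
    ∃ C : ℂ, ∀ χ : (E →L[ℝ] ℝ) → ℂ, ContDiff ℝ ∞ χ → HasCompactSupport χ →
      ∃ Ψ : SchwartzMap E ℂ, (∀ X, Ψ X = ∫ p, χ p * phase ħ p X ∂(dualMeasure m)) ∧
        ∫ X, Ψ X ∂(algMeasure m) = C * χ 0 := by
  obtain ⟨h1, h2⟩ := hO.isHaar_liouville_parts
  obtain ⟨C, -, hC⟩ := exists_schwartz_fourier hħ (algMeasure m : Measure E)
    (dualMeasure m : Measure (E →L[ℝ] ℝ))
  exact ⟨C, hC⟩

variable {C : ℂ}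

/-- The integral of the values of a kernel near the diagonal. -/
def fiberIntegral (m : Measure G) (c : G → ℂ) (k : G × G → ℂ) (X : E) : ℂ :=
  (densF G X : ℂ) * ∫ q, c q * k (q * lieExp (-(1 / 2 : ℝ) • X), q * lieExp ((1 / 2 : ℝ) • X)) ∂m

/-- For Y in the unit ball about X, only points q = a exp(Y/2) with (a, b) in the support of the
kernel contribute, so the integral has a common compact domain. Membership in `O` is needed only for
the smoothness of F. -/
theorem contDiffAt_fiberIntegral (hO : IsWeaklyExponential m O) {c : G → ℂ}
    (hc : ContMDiff 𝓘(ℝ, E) 𝓘(ℝ, ℂ) ∞ c) (hk : IsTestKernel E k) {X : E} (hX : X ∈ O) :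
    ContDiffAt ℝ ∞ (fiberIntegral m c k) X := by
  have hexp := hO.continuous_exp
  have hS : IsCompact ((fun z : (G × G) × E => z.1.1 * lieExp ((1 / 2 : ℝ) • z.2)) ''
      (tsupport k ×ˢ Metric.closedBall X 1)) :=
    (hk.compact.isCompact.prod (isCompact_closedBall X 1)).image (by fun_prop)
  refine (Complex.ofRealCLM.contDiff.contDiffAt.comp X (hO.contDiffAt_densF hX)).mul ?_
  refine (hO.contDiffOn_integral_haar Metric.isOpen_ball hS (fun Y hY q hq => ?_)
    (fun Y _ Z => ?_)).contDiffAt (Metric.ball_mem_nhds X one_pos)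
  · by_contra hne
    refine hq ⟨(_, Y), ⟨subset_tsupport k (right_ne_zero_of_mul hne),
      Metric.ball_subset_closedBall hY⟩, ?_⟩
    simp only
    rw [hO.exp_neg_half]; group
  · have hq : ContMDiffAt 𝓘(ℝ, E × E) 𝓘(ℝ, E) ∞ (fun z : E × E => (lieExp z.2 : G)) (Y, Z) :=
      hO.contMDiffAt_exp_comp contDiffAt_snd
    refine (contMDiffAt_iff_contDiffAt.1 (hc.contMDiffAt.comp (Y, Z) hq)).mul ?_
    exact contDiffAt_kernel_comp hk.smooth
      (hO.contMDiffAt_mul_exp hq (contDiffAt_const.smul contDiffAt_fst))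
      (hO.contMDiffAt_mul_exp hq (contDiffAt_const.smul contDiffAt_fst))

/-- The distribution defined by a monomial `c(q) ⟨p, Y⟩ˡ`. -/
theorem hasImproperIntegral_monomial (hO : IsWeaklyExponential m O) (hħ : ħ ≠ 0)
    (hC : ∀ χ : (E →L[ℝ] ℝ) → ℂ, ContDiff ℝ ∞ χ → HasCompactSupport χ →
      ∃ Ψ : SchwartzMap E ℂ, (∀ X, Ψ X = ∫ p, χ p * phase ħ p X ∂(dualMeasure m)) ∧
        ∫ X, Ψ X ∂(algMeasure m) = C * χ 0)
    {c : G → ℂ} (hc : ContMDiff 𝓘(ℝ, E) 𝓘(ℝ, ℂ) ∞ c) (Y : E) (l : ℕ) (f : testF m ħ O) :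
    HasImproperIntegral m (fun x => (c x.1 * ((x.2 Y : ℝ) : ℂ) ^ l) * f.1 x)
      (C * ((-(Complex.I * ħ)) ^ l *
        iteratedDeriv l (fun t : ℝ => fiberIntegral m c (kernel f) (t • Y)) 0)) := by
  obtain ⟨hμ, hν⟩ := hO.isHaar_liouville_parts
  have hk := isTestKernel_kernel f
  set k := kernel f with hkdef
  obtain ⟨Q, L, M, hQ, hL, hM0, h0, hM⟩ := hO.exists_bound_kernelSymbol hk.smooth.continuous
    hk.compact
  obtain ⟨M', hM'⟩ := hQ.exists_bound_of_continuousOn hc.continuous.continuousOn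
  let M'' : ℝ := max M' 0
  -- `A` is bounded and integrable on all of `E`, and near 0 it coincides with the smooth function
  -- `fiberIntegral m c k`; these are the hypotheses of `tendsto_integral_pow_mul_fourier`.
  let A : E → ℂ := fun X => ∫ q, c q * kernelSymbol O k (q, X) ∂m
  have hcφm : Measurable fun z : G × E => c z.1 * kernelSymbol O k z :=
    (hc.continuous.measurable.comp measurable_fst).mul
      (hO.measurable_kernelSymbol hk.smooth.continuous)
  have hcφ : Integrable (fun z : G × E => c z.1 * kernelSymbol O k z) (m.prod (algMeasure m)) := by
    refine Integrable.mono ((hO.integrable_kernelSymbol_prod hk).norm.const_mul M'')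
      hcφm.aestronglyMeasurable (Eventually.of_forall fun z => ?_)
    by_cases hz : z.1 ∈ Q
    · rw [norm_mul, norm_mul, norm_norm, Real.norm_of_nonneg (le_max_right _ _)]
      gcongr
      exact (hM' _ hz).trans (le_max_left _ _)
    · rw [h0 z.1 z.2 (Or.inl hz), mul_zero, norm_zero]; exact norm_nonneg _
  have hAi : Integrable A (algMeasure m) := hcφ.integral_prod_right
  have hAb : ∀ X, ‖A X‖ ≤ ∫ q, Q.indicator (fun _ => M'' * M) q ∂m := fun X => by
    refine norm_integral_le_of_norm_le ((integrable_indicator_iff hQ.measurableSet).2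
      (integrableOn_const hQ.measure_lt_top.ne)) (Eventually.of_forall fun q => ?_)
    by_cases hq : q ∈ Q
    · rw [indicator_of_mem hq, norm_mul]
      exact mul_le_mul ((hM' _ hq).trans (le_max_left _ _)) (hM _) (norm_nonneg _)
        (le_max_right _ _)
    · rw [indicator_of_notMem hq, h0 q X (Or.inl hq), mul_zero, norm_zero]
  have hAeq : A =ᶠ[𝓝 0] fiberIntegral m c k := by
    filter_upwards [hO.mem_nhds] with X hX
    simp only [A, fiberIntegral, kernelSymbol_of_mem hX]
    rw [← integral_const_mul]
    simp only [mul_left_comm]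
  have hA0 : ContDiffAt ℝ ∞ A 0 :=
    (hO.contDiffAt_fiberIntegral hc hk hO.zero_mem).congr_of_eventuallyEq hAeq
  intro χ hχ hχc hχ1
  have hu : Continuous fun x : G × (E →L[ℝ] ℝ) => c x.1 * ((x.2 Y : ℝ) : ℂ) ^ l := by
    have := hc.continuous
    have h1 : Continuous fun x : G × (E →L[ℝ] ℝ) => x.2 Y :=
      (ContinuousLinearMap.apply ℝ ℝ Y).continuous.comp continuous_snd
    fun_prop
  refine ⟨fun ε hε => hO.integrable_cutoff_mul hk (hO.testF_apply f) hu hχ.continuous hχc hε, ?_⟩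
  let χ' : (E →L[ℝ] ℝ) → ℂ := fun p => (χ p : ℂ)
  have hlim := tendsto_integral_pow_mul_fourier (μ := (algMeasure m : Measure E))
    (ν := (dualMeasure m : Measure (E →L[ℝ] ℝ))) hħ hC (χ := χ')
    (Complex.ofRealCLM.contDiff.comp hχ) (hχc.comp_left (g := fun x : ℝ => (x : ℂ)) (by simp))
    hAi hAb hA0 Y l
  have hloc : iteratedDeriv l (fun t : ℝ => A (t • Y)) 0 =
      iteratedDeriv l (fun t : ℝ => fiberIntegral m c k (t • Y)) 0 := by
    have hct : Continuous fun t : ℝ => t • Y := by fun_prop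
    have hev : (fun t : ℝ => A (t • Y)) =ᶠ[𝓝 0] fun t : ℝ => fiberIntegral m c k (t • Y) :=
      (hct.tendsto' 0 0 (by simp)).eventually hAeq
    rw [hev.iteratedDeriv_eq]
  simp only [χ', hχ1, Complex.ofReal_one, mul_one, hloc] at hlim
  refine hlim.congr' ?_
  filter_upwards [self_mem_nhdsWithin] with ε hε
  have hint := hO.integrable_cutoff_mul hk (hO.testF_apply f) hu hχ.continuous hχc hε
  rw [liouville] at hint ⊢
  rw [integral_prod_symm _ hint]
  refine integral_congr_ae (Eventually.of_forall fun p => ?_)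
  simp only [hO.testF_apply f, ← hkdef]
  have hsw : Integrable (uncurry fun (q : G) (X : E) =>
      c q * kernelSymbol O k (q, X) * phase ħ p X) (m.prod (algMeasure m)) := by
    refine hcφ.mul_bdd (c := 1) (g := fun z : G × E => phase ħ p z.2)
      ((continuous_phase_right ħ p).comp continuous_snd).aestronglyMeasurable
      (Eventually.of_forall fun z => (norm_phase _ _ _).le)
  calc _ = (χ (ε • p) : ℂ) * ((p Y : ℝ) : ℂ) ^ l *
        ∫ X, ∫ q, c q * kernelSymbol O k (q, X) * phase ħ p X ∂m ∂(algMeasure m) := by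
        simp only [integral_mul_const, A]
    _ = (χ (ε • p) : ℂ) * ((p Y : ℝ) : ℂ) ^ l *
        ∫ q, ∫ X, c q * kernelSymbol O k (q, X) * phase ħ p X ∂(algMeasure m) ∂m := by
        rw [← integral_integral_swap hsw]
    _ = _ := by
        rw [← integral_const_mul]
        refine integral_congr_ae (Eventually.of_forall fun q => ?_)
        simp only [mul_assoc (c q), integral_const_mul]
        ring

/-- Substitute b = a exp X and then a = q exp(-X/2). The Jacobian of exp and the modular factor of
the translation combine to F(X)², one factor F for each symbol, while the sign of X exchanges the
arguments of the second kernel. -/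
theorem integral_kernelSymbol_mul (hO : IsWeaklyExponential m O) (hkf : IsTestKernel E k)
    (hkh : IsTestKernel E k') :
    ∫ q, ∫ X, kernelSymbol O k (q, X) * kernelSymbol O k' (q, -X) ∂(algMeasure m) ∂m =
      ∫ a, ∫ b, k (a, b) * k' (b, a) ∂m ∂m := by
  obtain ⟨hμ, hν⟩ := hO.isHaar_liouville_parts
  have hkc := hkf.smooth.continuous
  have hkc' := hkh.smooth.continuous
  obtain ⟨Q', L', M', -, -, -, -, hM'⟩ := hO.exists_bound_kernelSymbol hkc' hkh.compact
  have hi1 : Integrable (uncurry fun (q : G) (X : E) =>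
      kernelSymbol O k (q, X) * kernelSymbol O k' (q, -X)) (m.prod (algMeasure m)) := by
    refine (hO.integrable_kernelSymbol_prod hkf).mul_bdd (c := M')
      (g := fun z : G × E => kernelSymbol O k' (z.1, -z.2))
      ((hO.measurable_kernelSymbol hkc').comp (by fun_prop)).aestronglyMeasurable
      (Eventually.of_forall fun z => hM' _)
  have hc2 : Continuous fun z : G × G => k (z.1, z.1 * z.2) * k' (z.1 * z.2, z.1) :=
    (hkc.comp (by fun_prop)).mul (hkc'.comp (by fun_prop))
  have hi2 : Integrable (uncurry fun a x : G => k (a, a * x) * k' (a * x, a)) (m.prod m) := by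
    refine hc2.integrable_of_hasCompactSupport ?_
    refine HasCompactSupport.mul_right ?_
    exact hkf.compact.comp_homeomorph (Homeomorph.shearMulRight G)
  rw [integral_integral_swap hi1]
  have e1 : ∫ a, ∫ b, k (a, b) * k' (b, a) ∂m ∂m =
      ∫ a, ∫ x, k (a, a * x) * k' (a * x, a) ∂m ∂m :=
    integral_congr_ae (Eventually.of_forall fun a =>
      (integral_mul_left_eq_self (fun b => k (a, b) * k' (b, a)) a).symm)
  have e8 : ∫ a, ∫ x, k (a, a * x) * k' (a * x, a) ∂m ∂m =
      ∫ x, ∫ a, k (a, a * x) * k' (a * x, a) ∂m ∂m := integral_integral_swap hi2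
  have hi3 : AEStronglyMeasurable (fun x => ∫ a, k (a, a * x) * k' (a * x, a) ∂m) m :=
    hi2.integral_prod_right.aestronglyMeasurable
  rw [e1, e8, hO.integral_eq_setIntegral_exp hi3, ← integral_indicator hO.isOpen.measurableSet]
  refine integral_congr_ae (Eventually.of_forall fun X => ?_)
  by_cases hX : X ∈ O
  · have hX' : -X ∈ O := hO.neg_mem hX
    simp only [indicator_of_mem hX, kernelSymbol_of_mem hX, kernelSymbol_of_mem hX', densF_neg]
    have e2 := hO.integral_mul_right_haar
      (fun a => k (a, a * lieExp X) * k' (a * lieExp X, a)) (lieExp (-(1 / 2 : ℝ) • X))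
    have e3 : ∀ q : G, q * lieExp (-(1 / 2 : ℝ) • X) * lieExp X = q * lieExp ((1 / 2 : ℝ) • X) :=
      fun q => by rw [hO.exp_neg_half, ← hO.exp_half_mul_half X]; group
    simp only [e3] at e2
    have e4 : modRoot O (lieExp X : G) * modRoot O (lieExp (-(1 / 2 : ℝ) • X) : G) ^ 2 = 1 := by
      rw [hO.exp_neg_half, hO.modRoot_inv, ← hO.exp_half_mul_half X, hO.modRoot_mul]
      have := (hO.modRoot_pos (lieExp ((1 / 2 : ℝ) • X) : G)).ne'
      field_simp
    have e5 := hO.densF_sq X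
    have e6 : densF G X ^ 2 * modRoot O (lieExp (-(1 / 2 : ℝ) • X) : G) ^ 2 =
        |(dexp G O X).det| := by
      rw [e5]; linear_combination |(dexp G O X).det| * e4
    rw [← e6]
    have e7 : ∀ q : G, (densF G X : ℂ) * k (q * lieExp (-(1 / 2 : ℝ) • X),
          q * lieExp ((1 / 2 : ℝ) • X)) * ((densF G X : ℂ) *
          k' (q * lieExp (-(1 / 2 : ℝ) • -X), q * lieExp ((1 / 2 : ℝ) • -X))) =
        (densF G X : ℂ) ^ 2 * (k (q * lieExp (-(1 / 2 : ℝ) • X), q * lieExp ((1 / 2 : ℝ) • X)) *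
          k' (q * lieExp ((1 / 2 : ℝ) • X), q * lieExp (-(1 / 2 : ℝ) • X))) := fun q => by
      rw [neg_smul_neg, smul_neg, ← neg_smul]; ring
    simp only [e7]
    rw [integral_const_mul, e2]
    push_cast
    ring
  · simp only [indicator_of_notMem hX, kernelSymbol_of_notMem hX, zero_mul, integral_zero]

/-- The trace formula. -/
theorem hasImproperIntegral_mul (hO : IsWeaklyExponential m O)
    (hC : ∀ χ : (E →L[ℝ] ℝ) → ℂ, ContDiff ℝ ∞ χ → HasCompactSupport χ →
      ∃ Ψ : SchwartzMap E ℂ, (∀ X, Ψ X = ∫ p, χ p * phase ħ p X ∂(dualMeasure m)) ∧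
        ∫ X, Ψ X ∂(algMeasure m) = C * χ 0)
    (hkf : IsTestKernel E k) (hkh : IsTestKernel E k') {f h : G × (E →L[ℝ] ℝ) → ℂ}
    (hfa : ∀ x, f x = ∫ X, kernelSymbol O k (x.1, X) * phase ħ x.2 X ∂(algMeasure m))
    (hha : ∀ x, h x = ∫ X, kernelSymbol O k' (x.1, X) * phase ħ x.2 X ∂(algMeasure m)) :
    HasImproperIntegral m (fun x => f x * h x) (C * ∫ a, ∫ b, k (a, b) * k' (b, a) ∂m ∂m) := by
  obtain ⟨hμ, hν⟩ := hO.isHaar_liouville_parts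
  have hkc := hkf.smooth.continuous
  have hkc' := hkh.smooth.continuous
  obtain ⟨Q', L', M', -, -, -, -, hM'⟩ := hO.exists_bound_kernelSymbol hkc' hkh.compact
  have hfc : Continuous f := by
    rw [show f = fun x => _ from funext hfa]
    exact hO.continuous_fourier_kernelSymbol hkf
  have hhc : Continuous h := by
    rw [show h = fun x => _ from funext hha]
    exact hO.continuous_fourier_kernelSymbol hkh
  have htrace := hO.integral_kernelSymbol_mul hkf hkh
  intro χ hχ hχc hχ1
  refine ⟨fun ε hε => hO.integrable_cutoff_mul hkh hha hfc hχ.continuous hχc hε, ?_⟩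
  obtain ⟨χ', hχ'⟩ : ∃ χ' : (E →L[ℝ] ℝ) → ℂ, ∀ p, χ' p = (χ p : ℂ) := ⟨_, fun p => rfl⟩
  have hχ'e : χ' = fun p => (χ p : ℂ) := funext hχ'
  have hχ's : ContDiff ℝ ∞ χ' := by rw [hχ'e]; exact Complex.ofRealCLM.contDiff.comp hχ
  have hχ'c : HasCompactSupport χ' := by
    rw [hχ'e]; exact hχc.comp_left (g := fun x : ℝ => (x : ℂ)) (by simp)
  obtain ⟨Ψ, hΨ, hΨ0⟩ := hC χ' hχ's hχ'c
  have hχ'0 : χ' 0 = 1 := by simp [hχ', hχ1]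
  rw [hχ'0, mul_one] at hΨ0
  -- Only the first factor is written through its symbol; the p-integral of the second against the
  -- phase tends to C times its symbol at -X. No decay of either function in p is required.
  let Ω : ℝ → G → E → ℂ := fun ε q X =>
    ∫ p, χ' (ε • p) * phase ħ p X * h (q, p) ∂(dualMeasure m)
  have hΩ : ∀ ε : ℝ, 0 < ε → ∀ q X,
      Ω ε q X = ∫ Z, kernelSymbol O k' (q, ε • Z - X) * Ψ Z ∂(algMeasure m) := fun ε hε q X => by
    rw [← integral_cutoff_mul_fourier hχ's.continuous hχ'c hΨ
      (hO.integrable_kernelSymbol hkh q) X hε]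
    simp only [Ω, hha]
  -- This bound does not depend on ε, q or X, which permits dominated convergence first in X and
  -- then in q.
  let B : ℝ := M' * ∫ Z, ‖Ψ Z‖ ∂(algMeasure m)
  have hΩb : ∀ ε : ℝ, 0 < ε → ∀ q X, ‖Ω ε q X‖ ≤ B := fun ε hε q X => by
    rw [hΩ ε hε]
    exact norm_integral_cutoff_le (A := fun Z => kernelSymbol O k' (q, Z)) (fun Z => hM' (q, Z)) Ψ
      (fun Z => ε • Z - X)
  have hpint : ∀ ε : ℝ, 0 < ε → ∀ q, Integrable (fun p => χ' (ε • p) * h (q, p)) (dualMeasure m) :=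
    fun ε hε q => by
      have h1 : Continuous fun p : E →L[ℝ] ℝ => h (q, p) := hhc.comp (Continuous.prodMk_right q)
      have h2 : Continuous fun p : E →L[ℝ] ℝ => χ' (ε • p) :=
        hχ's.continuous.comp (continuous_const_smul ε)
      have h3 : HasCompactSupport fun p : E →L[ℝ] ℝ => χ' (ε • p) :=
        hχ'c.comp_homeomorph (Homeomorph.smulOfNeZero ε hε.ne')
      have h4 : HasCompactSupport fun p : E →L[ℝ] ℝ => χ' (ε • p) * h (q, p) := h3.mul_right
      exact (h2.mul h1).integrable_of_hasCompactSupport h4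
  have hIeq : ∀ ε : ℝ, 0 < ε → ∀ q, ∫ p, χ' (ε • p) * (f (q, p) * h (q, p)) ∂(dualMeasure m) =
      ∫ X, kernelSymbol O k (q, X) * Ω ε q X ∂(algMeasure m) := fun ε hε q => by
    have hsw : Integrable (uncurry fun (p : E →L[ℝ] ℝ) (X : E) =>
        kernelSymbol O k (q, X) * (χ' (ε • p) * phase ħ p X * h (q, p)))
        ((dualMeasure m).prod (algMeasure m)) := by
      have h1 := ((hpint ε hε q).mul_prod (hO.integrable_kernelSymbol hkf q)).mul_bdd (c := 1)
        (g := fun z : (E →L[ℝ] ℝ) × E => phase ħ z.1 z.2)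
        (continuous_phase ħ).aestronglyMeasurable
        (Eventually.of_forall fun z => (norm_phase _ _ _).le)
      refine h1.congr (Eventually.of_forall fun z => ?_)
      simp only [uncurry]; ring
    simp only [Ω]
    calc _ = ∫ p, ∫ X, kernelSymbol O k (q, X) * (χ' (ε • p) * phase ħ p X * h (q, p))
          ∂(algMeasure m) ∂(dualMeasure m) := by
          refine integral_congr_ae (Eventually.of_forall fun p => ?_)
          simp only [hfa]
          rw [← integral_mul_const, ← integral_const_mul]
          refine integral_congr_ae (Eventually.of_forall fun X => ?_)
          simp only; ring
      _ = _ := by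
          rw [integral_integral_swap hsw]
          simp only [integral_const_mul]
  have hXlim : ∀ q, Tendsto (fun ε => ∫ X, kernelSymbol O k (q, X) * Ω ε q X ∂(algMeasure m))
      (𝓝[>] 0) (𝓝 (∫ X, kernelSymbol O k (q, X) * (kernelSymbol O k' (q, -X) * C)
        ∂(algMeasure m))) := fun q => by
    refine tendsto_integral_filter_of_dominated_convergence
      (fun X => ‖kernelSymbol O k (q, X)‖ * B) ?_ ?_
      ((hO.integrable_kernelSymbol hkf q).norm.mul_const B) (Eventually.of_forall fun X => ?_)
    · filter_upwards [self_mem_nhdsWithin] with ε hε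
      refine (hO.integrable_kernelSymbol hkf q).1.mul ?_
      have : Continuous fun X => Ω ε q X := by
        refine continuous_of_dominated (bound := fun p => ‖χ' (ε • p) * h (q, p)‖)
          (fun X => ?_) (fun X => Eventually.of_forall fun p => ?_) (hpint ε hε q).norm
          (Eventually.of_forall fun p => ?_)
        · have h1 : Continuous fun p : E →L[ℝ] ℝ => h (q, p) :=
            hhc.comp (Continuous.prodMk_right q)
          have h2 : Continuous fun p : E →L[ℝ] ℝ => χ' (ε • p) :=
            hχ's.continuous.comp (continuous_const_smul ε)
          exact ((h2.mul (continuous_phase_left ħ X)).mul h1).aestronglyMeasurable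
        · rw [norm_mul, norm_mul, norm_mul, norm_phase, mul_one]
        · exact (continuous_const.mul (continuous_phase_right ħ p)).mul continuous_const
      exact this.aestronglyMeasurable
    · filter_upwards [self_mem_nhdsWithin] with ε hε
      refine Eventually.of_forall fun X => ?_
      rw [norm_mul]
      exact mul_le_mul_of_nonneg_left (hΩb ε hε q X) (norm_nonneg _)
    -- On `O` the symmetry of `O` makes -X a continuity point of the second symbol; off `O` the
    -- first symbol vanishes.
    · by_cases hX : X ∈ O
      · refine Tendsto.const_mul _ ?_
        have h1 := tendsto_integral_cutoff (μ := (algMeasure m : Measure E))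
          (A := fun Z => kernelSymbol O k' (q, Z))
          ((hO.measurable_kernelSymbol hkc').comp measurable_prodMk_left) (fun Z => hM' (q, Z))
          (X₀ := X) (hO.kernelSymbol_continuousAt hkc' q (hO.neg_mem hX)) Ψ
        rw [hΨ0] at h1
        refine h1.congr' ?_
        filter_upwards [self_mem_nhdsWithin] with ε hε
        exact (hΩ ε hε q X).symm
      · simp only [kernelSymbol_of_notMem hX, zero_mul]
        exact tendsto_const_nhds
  have hqlim : Tendsto (fun ε => ∫ q, ∫ X, kernelSymbol O k (q, X) * Ω ε q X ∂(algMeasure m) ∂m)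
      (𝓝[>] 0) (𝓝 (∫ q, ∫ X, kernelSymbol O k (q, X) * (kernelSymbol O k' (q, -X) * C)
        ∂(algMeasure m) ∂m)) := by
    refine tendsto_integral_filter_of_dominated_convergence
      (fun q => ∫ X, ‖kernelSymbol O k (q, X)‖ * B ∂(algMeasure m)) ?_ ?_
      ?_ (Eventually.of_forall hXlim)
    · filter_upwards [self_mem_nhdsWithin] with ε hε
      simp only [← hIeq ε hε]
      have hcc : Continuous (uncurry fun (q : G) (p : E →L[ℝ] ℝ) =>
          χ' (ε • p) * (f (q, p) * h (q, p))) :=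
        (hχ's.continuous.comp (by fun_prop)).mul (hfc.mul hhc)
      exact (hcc.stronglyMeasurable.integral_prod_right).aestronglyMeasurable
    · filter_upwards [self_mem_nhdsWithin] with ε hε
      refine Eventually.of_forall fun q => ?_
      refine norm_integral_le_of_norm_le
        ((hO.integrable_kernelSymbol hkf q).norm.mul_const B) (Eventually.of_forall fun X => ?_)
      rw [norm_mul]
      exact mul_le_mul_of_nonneg_left (hΩb ε hε q X) (norm_nonneg _)
    · simp only [integral_mul_const]
      exact (hO.integrable_kernelSymbol_prod hkf).norm.integral_prod_left.mul_const B
  have hval : ∫ q, ∫ X, kernelSymbol O k (q, X) * (kernelSymbol O k' (q, -X) * C)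
        ∂(algMeasure m) ∂m = C * ∫ a, ∫ b, k (a, b) * k' (b, a) ∂m ∂m := by
    rw [← htrace]
    simp only [← mul_assoc, integral_mul_const]
    rw [mul_comm]
  rw [← hval]
  refine hqlim.congr' ?_
  filter_upwards [self_mem_nhdsWithin] with ε hε
  have hint := hO.integrable_cutoff_mul hkh hha hfc hχ.continuous hχc hε
  rw [liouville] at hint ⊢
  rw [integral_prod _ hint]
  refine integral_congr_ae (Eventually.of_forall fun q => ?_)
  simp only [← hχ']
  exact (hIeq ε hε q).symm

end IsWeaklyExponential

end Improper

/-! ### Families of kernels depending on a real parameter -/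

section Families

variable {E : Type*} [NormedAddCommGroup E] [NormedSpace ℝ E] [FiniteDimensional ℝ E]
  [MeasurableSpace E] [BorelSpace E]
  {G : Type*} [Group G] [TopologicalSpace G] [T2Space G] [SecondCountableTopology G]
  [ChartedSpace E G] [LieGroup 𝓘(ℝ, E) ∞ G] [MeasurableSpace G] [BorelSpace G]
  {m : Measure G} {O : Set E} {g h : G × G → ℂ} {U : Set ℝ} {W : ℝ → G × G → ℂ}

theorem contDiffAt_iteratedDeriv {P : Type*} [NormedAddCommGroup P] [NormedSpace ℝ P]
    {F : Type*} [NormedAddCommGroup F] [NormedSpace ℝ F] (l : ℕ) {H : P → ℝ → F} {p₀ : P} {t₀ : ℝ}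
    (hH : ContDiffAt ℝ ∞ (uncurry H) (p₀, t₀)) :
    ContDiffAt ℝ ∞ (fun z : P × ℝ => iteratedDeriv l (H z.1) z.2) (p₀, t₀) := by
  induction l generalizing H with
  | zero =>
    simp only [iteratedDeriv_zero]
    exact hH
  | succ l ih =>
    simp only [iteratedDeriv_succ']
    refine ih (H := fun p => deriv (H p)) ?_
    refine contDiffAt_partialDeriv (P := P × ℝ) (H := fun z t => H z.1 t) (t₀ := fun z => z.2)
      ?_ contDiffAt_snd
    exact ContDiffAt.comp (f := fun w : (P × ℝ) × ℝ => (w.1.1, w.2)) (g := uncurry H)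
      ((p₀, t₀), t₀) hH (by fun_prop)

/-- A family of functions on `G × G` that depends smoothly on a parameter in `U`, with supports in
a common compact set. -/
structure IsKernelFamily (E : Type*) [NormedAddCommGroup E] [NormedSpace ℝ E] {G : Type*} [Group G]
    [TopologicalSpace G] [ChartedSpace E G] (U : Set ℝ) (W : ℝ → G × G → ℂ) : Prop where
  contDiffAt : ∀ t ∈ U, ∀ (a b : G) (z : E × E), ContDiffAt ℝ ∞
    (fun w : ℝ × E × E => W w.1 (a * lieExp w.2.1, b * lieExp w.2.2)) (t, z)
  compact : ∃ S : Set (G × G), IsCompact S ∧ ∀ t ∈ U, ∀ x ∉ S, W t x = 0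

namespace IsWeaklyExponential

variable [IsTopologicalGroup G] [LocallyCompactSpace G] [m.IsHaarMeasure]

/-- Supports are controlled uniformly on an open set of t, hence the same compact set serves the
t-derivatives. -/
theorem isTestKernel_iteratedDeriv (hO : IsWeaklyExponential m O) (hU : IsOpen U)
    (hW : IsKernelFamily E U W) (l : ℕ) {t : ℝ} (ht : t ∈ U) :
    IsTestKernel E fun x => iteratedDeriv l (fun t => W t x) t := by
  obtain ⟨S, hS, hS0⟩ := hW.compact
  refine ⟨hO.contMDiff_of_comp_exp_prod fun a b => ?_, ?_⟩
  · have h1 := contDiffAt_iteratedDeriv l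
      (H := fun (z : E × E) t => W t (a * lieExp z.1, b * lieExp z.2)) (p₀ := 0) (t₀ := t)
      (ContDiffAt.comp (f := fun w : (E × E) × ℝ => (w.2, w.1))
        (g := fun w : ℝ × E × E => W w.1 (a * lieExp w.2.1, b * lieExp w.2.2)) (0, t)
        (hW.contDiffAt t ht a b 0) (by fun_prop))
    exact ContDiffAt.comp (f := fun z : E × E => (z, t)) (g := fun z : (E × E) × ℝ =>
      iteratedDeriv l (fun t => W t (a * lieExp z.1.1, b * lieExp z.1.2)) z.2) 0 h1 (by fun_prop)
  · refine HasCompactSupport.of_support_subset_isCompact hS fun x hx => ?_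
    by_contra hxS
    refine hx ?_
    have h1 : (fun t => W t x) =ᶠ[𝓝 t] fun _ => 0 := by
      filter_upwards [hU.mem_nhds ht] with s hs using hS0 s hs x hxS
    simp only [h1.iteratedDeriv_eq]
    cases l <;> simp

/-- Differentiation passes through the outer integral and then the inner one; the first passage
needs the inner integral to be smooth jointly in t and a. -/
theorem iteratedDeriv_integral_family (hO : IsWeaklyExponential m O) (hU : IsOpen U)
    (hW : IsKernelFamily E U W) (hh : IsTestKernel E h) (l : ℕ) {t : ℝ} (ht : t ∈ U) :
    iteratedDeriv l (fun t => ∫ a, ∫ b, W t (a, b) * h (b, a) ∂m ∂m) t =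
      ∫ a, ∫ b, iteratedDeriv l (fun t => W t (a, b)) t * h (b, a) ∂m ∂m := by
  obtain ⟨S, hS, hS0⟩ := hW.compact
  have hS1 : IsCompact (Prod.fst '' S) := hS.image continuous_fst
  have hS2 : IsCompact (Prod.snd '' S) := hS.image continuous_snd
  have h01 : ∀ s ∈ U, ∀ a ∉ Prod.fst '' S, ∀ b, W s (a, b) = 0 := fun s hs a ha b =>
    hS0 s hs _ fun hx => ha ⟨_, hx, rfl⟩
  have h02 : ∀ s ∈ U, ∀ a, ∀ b ∉ Prod.snd '' S, W s (a, b) = 0 := fun s hs a b hb =>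
    hS0 s hs _ fun hx => hb ⟨_, hx, rfl⟩
  rw [hO.iteratedDeriv_integral_haar hU hS1 l (K := fun t a => ∫ b, W t (a, b) * h (b, a) ∂m)
    (fun s hs a ha => by simp [h01 s hs a ha]) (fun s hs X => ?_) ht]
  · refine integral_congr_ae (Eventually.of_forall fun a => ?_)
    simp only
    rw [hO.iteratedDeriv_integral_haar hU hS2 l (K := fun t b => W t (a, b) * h (b, a))
      (fun s hs b hb => by simp [h02 s hs a b hb]) (fun s hs X => ?_) ht]
    · simp only [iteratedDeriv_mul_const_field]
    · refine ContDiffAt.mul ?_ ?_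
      · have h1 := ContDiffAt.comp (f := fun w : ℝ × E => (w.1, (0 : E), w.2)) (s, X)
          (hW.contDiffAt s hs a 1 (0, X)) (by fun_prop)
        simpa only [Function.comp_def, lieExp_zero, mul_one, one_mul] using h1
      · exact contDiffAt_kernel_comp hh.smooth (hO.contMDiffAt_exp_comp contDiffAt_snd)
          contMDiffAt_const
  · refine (hO.contDiffOn_integral_haar (P := ℝ × E) (hU.prod isOpen_univ) hS2
      (K := fun z b => W z.1 (lieExp z.2, b) * h (b, lieExp z.2))
      (fun z hz b hb => by rw [h02 _ hz.1 _ b hb, zero_mul]) fun z hz Z => ?_).contDiffAt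
      ((hU.prod isOpen_univ).mem_nhds ⟨hs, mem_univ _⟩)
    refine ContDiffAt.mul ?_ ?_
    · have h1 := ContDiffAt.comp (f := fun w : (ℝ × E) × E => (w.1.1, w.1.2, w.2)) (z, Z)
        (hW.contDiffAt z.1 hz.1 1 1 (z.2, Z)) (by fun_prop)
      simpa only [Function.comp_def, one_mul] using h1
    · exact contDiffAt_kernel_comp hh.smooth (hO.contMDiffAt_exp_comp contDiffAt_snd)
        (hO.contMDiffAt_exp_comp (contDiffAt_snd.comp _ contDiffAt_fst))

theorem contDiff_modRoot_exp (hO : IsWeaklyExponential m O) :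
    ContDiff ℝ ∞ fun X : E => modRoot O (lieExp X : G) := by
  have h1 : (fun X : E => modRoot O (lieExp X : G)) =
      fun X => Real.sqrt |(Ad O (lieExp ((1 / 2 : ℝ) • (2 : ℝ) • X) : G)).det| := by
    funext X
    rw [modRoot, smul_smul]; norm_num
  rw [h1, contDiff_iff_contDiffAt]
  intro X
  have h2 : ContDiffAt ℝ ∞
      (fun X : E => (Ad O (lieExp ((1 / 2 : ℝ) • (2 : ℝ) • X) : G)).det) X :=
    (contDiff_clm_det.comp (hO.contDiff_Ad_exp_half.comp (contDiff_const_smul (2 : ℝ)))).contDiffAt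
  exact (h2.abs (hO.Ad_det_ne_zero _)).sqrt (abs_pos.2 (hO.Ad_det_ne_zero _)).ne'

/-- The density factor of the kernels of the products with monomials. -/
def lineDensity (G : Type*) [Group G] [TopologicalSpace G] [ChartedSpace E G]
    [LieGroup 𝓘(ℝ, E) ∞ G] (O : Set E) (Y : E) (t : ℝ) : ℂ :=
  ((densF G (t • Y) * modRoot O (lieExp (t • Y) : G) : ℝ) : ℂ)

theorem contDiffAt_lineDensity (hO : IsWeaklyExponential m O) {Y : E} {t : ℝ} (ht : t • Y ∈ O) :
    ContDiffAt ℝ ∞ (lineDensity G O Y) t := by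
  have h1 : ContDiffAt ℝ ∞ (fun t : ℝ => t • Y) t := contDiffAt_id.smul contDiffAt_const
  have h2 : ContDiffAt ℝ ∞ (fun t : ℝ => densF G (t • Y)) t :=
    ContDiffAt.comp (f := fun t : ℝ => t • Y) (g := densF G) t (hO.contDiffAt_densF ht) h1
  have h3 : ContDiffAt ℝ ∞ (fun t : ℝ => modRoot O (lieExp (t • Y) : G)) t :=
    ContDiffAt.comp (f := fun t : ℝ => t • Y) (g := fun X => modRoot O (lieExp X : G)) t
      hO.contDiff_modRoot_exp.contDiffAt h1
  exact Complex.ofRealCLM.contDiff.contDiffAt.comp t (h2.mul h3)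

/-- The parameters for which the one-parameter subgroup is parametrized by `O`. -/
theorem exists_line_domain (hO : IsWeaklyExponential m O) (Y : E) :
    ∃ r > 0, ∀ t ∈ Metric.ball (0 : ℝ) r, t • Y ∈ O := by
  have hc : Continuous fun t : ℝ => t • Y := by fun_prop
  have h1 : (fun t : ℝ => t • Y) ⁻¹' O ∈ 𝓝 (0 : ℝ) :=
    (hc.tendsto' 0 0 (by simp)) hO.mem_nhds
  obtain ⟨r, hr, hb⟩ := Metric.mem_nhds_iff.1 h1
  exact ⟨r, hr, hb⟩

theorem exp_smul_half_sq (hO : IsWeaklyExponential m O) (t : ℝ) (Y : E) :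
    (lieExp ((1 / 2 : ℝ) • t • Y) : G) * lieExp ((1 / 2 : ℝ) • t • Y) = lieExp (t • Y) :=
  hO.exp_half_mul_half _

theorem modRoot_half_sq (hO : IsWeaklyExponential m O) (X : E) :
    modRoot O (lieExp ((1 / 2 : ℝ) • X) : G) ^ 2 = modRoot O (lieExp X : G) := by
  rw [← hO.exp_half_mul_half X, hO.modRoot_mul, sq]

/-- The family of kernels that gives the product of a monomial with a test function. -/
def rightFamily (O : Set E) (c : G → ℂ) (Y : E) (g : G × G → ℂ) (t : ℝ) (x : G × G) : ℂ :=
  lineDensity G O Y t * (c (x.1 * lieExp (-(1 / 2 : ℝ) • t • Y)) * g (x.1 * lieExp (-t • Y), x.2))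

/-- The family of kernels that gives the product of a test function with a monomial. -/
def leftFamily (O : Set E) (c : G → ℂ) (Y : E) (g : G × G → ℂ) (t : ℝ) (x : G × G) : ℂ :=
  lineDensity G O Y (-t) * (c (x.2 * lieExp ((1 / 2 : ℝ) • t • Y)) * g (x.1, x.2 * lieExp (t • Y)))

variable {c : G → ℂ} {Y : E} {r : ℝ}

theorem isKernelFamily_right (hO : IsWeaklyExponential m O)
    (hc : ContMDiff 𝓘(ℝ, E) 𝓘(ℝ, ℂ) ∞ c) (hg : IsTestKernel E g)
    (hr : ∀ t ∈ Metric.ball (0 : ℝ) r, t • Y ∈ O) :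
    IsKernelFamily E (Metric.ball 0 r) (rightFamily O c Y g) := by
  refine ⟨fun t ht a b z => ?_, ?_⟩
  · have ha : ContMDiffAt 𝓘(ℝ, ℝ × E × E) 𝓘(ℝ, E) ∞
        (fun w : ℝ × E × E => a * lieExp w.2.1) (t, z) :=
      hO.contMDiffAt_mul_exp contMDiffAt_const (by fun_prop)
    have hb : ContMDiffAt 𝓘(ℝ, ℝ × E × E) 𝓘(ℝ, E) ∞
        (fun w : ℝ × E × E => b * lieExp w.2.2) (t, z) :=
      hO.contMDiffAt_mul_exp contMDiffAt_const (by fun_prop)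
    refine ContDiffAt.mul ?_ (ContDiffAt.mul ?_ ?_)
    · exact ContDiffAt.comp (f := fun w : ℝ × E × E => w.1) (t, z)
        (hO.contDiffAt_lineDensity (hr t ht)) contDiffAt_fst
    · exact contMDiffAt_iff_contDiffAt.1 (hc.contMDiffAt.comp (t, z)
        (hO.contMDiffAt_mul_exp ha (by fun_prop)))
    · exact contDiffAt_kernel_comp hg.smooth (hO.contMDiffAt_mul_exp ha (by fun_prop)) hb
  · have hexp := hO.continuous_exp
    refine ⟨(fun z : (G × G) × ℝ => (z.1.1 * lieExp (z.2 • Y), z.1.2)) ''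
      (tsupport g ×ˢ Metric.closedBall 0 r),
      (hg.compact.isCompact.prod (isCompact_closedBall _ _)).image (by fun_prop),
      fun t ht x hx => ?_⟩
    by_contra hne
    refine hx ⟨(_, t), ⟨subset_tsupport g (right_ne_zero_of_mul (right_ne_zero_of_mul hne)),
      Metric.ball_subset_closedBall ht⟩, ?_⟩
    refine Prod.ext ?_ rfl
    simp only
    rw [neg_smul, hO.exp_neg]; group

theorem isKernelFamily_left (hO : IsWeaklyExponential m O)
    (hc : ContMDiff 𝓘(ℝ, E) 𝓘(ℝ, ℂ) ∞ c) (hg : IsTestKernel E g)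
    (hr : ∀ t ∈ Metric.ball (0 : ℝ) r, t • Y ∈ O) :
    IsKernelFamily E (Metric.ball 0 r) (leftFamily O c Y g) := by
  refine ⟨fun t ht a b z => ?_, ?_⟩
  · have ha : ContMDiffAt 𝓘(ℝ, ℝ × E × E) 𝓘(ℝ, E) ∞
        (fun w : ℝ × E × E => a * lieExp w.2.1) (t, z) :=
      hO.contMDiffAt_mul_exp contMDiffAt_const (by fun_prop)
    have hb : ContMDiffAt 𝓘(ℝ, ℝ × E × E) 𝓘(ℝ, E) ∞
        (fun w : ℝ × E × E => b * lieExp w.2.2) (t, z) :=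
      hO.contMDiffAt_mul_exp contMDiffAt_const (by fun_prop)
    refine ContDiffAt.mul ?_ (ContDiffAt.mul ?_ ?_)
    · refine ContDiffAt.comp (f := fun w : ℝ × E × E => -w.1) (g := lineDensity G O Y) (t, z)
        (hO.contDiffAt_lineDensity ?_) (by fun_prop)
      simpa using hO.neg_mem (hr t ht)
    · exact contMDiffAt_iff_contDiffAt.1 (hc.contMDiffAt.comp (t, z)
        (hO.contMDiffAt_mul_exp hb (by fun_prop)))
    · exact contDiffAt_kernel_comp hg.smooth ha (hO.contMDiffAt_mul_exp hb (by fun_prop))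
  · have hexp := hO.continuous_exp
    refine ⟨(fun z : (G × G) × ℝ => (z.1.1, z.1.2 * lieExp (-z.2 • Y))) ''
      (tsupport g ×ˢ Metric.closedBall 0 r),
      (hg.compact.isCompact.prod (isCompact_closedBall _ _)).image (by fun_prop),
      fun t ht x hx => ?_⟩
    by_contra hne
    refine hx ⟨(_, t), ⟨subset_tsupport g (right_ne_zero_of_mul (right_ne_zero_of_mul hne)),
      Metric.ball_subset_closedBall ht⟩, ?_⟩
    refine Prod.ext rfl ?_
    simp only
    rw [neg_smul, hO.exp_neg]; group

/-- Put q = a exp(-tY/2) in the fiber integral. The kernels become g(a exp(-tY), b) and h(b, a), so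
all dependence on t falls on `g` and `c`, and `h` is left as the test function of a trace. The right
translation costs the factor `modRoot` at exp(tY). -/
theorem fiberIntegral_kernelComp_right (hO : IsWeaklyExponential m O) (t : ℝ) :
    fiberIntegral m c (kernelComp m g h) (t • Y) =
      ∫ a, ∫ b, rightFamily O c Y g t (a, b) * h (b, a) ∂m ∂m := by
  have h1 := hO.integral_mul_right_haar (fun q => c q *
    kernelComp m g h (q * lieExp (-(1 / 2 : ℝ) • t • Y), q * lieExp ((1 / 2 : ℝ) • t • Y)))
    (lieExp (-(1 / 2 : ℝ) • t • Y))
  have e1 : ∀ q : G, q * lieExp (-(1 / 2 : ℝ) • t • Y) * lieExp (-(1 / 2 : ℝ) • t • Y) =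
      q * lieExp (-t • Y) := fun q => by
    rw [hO.exp_neg_half, neg_smul, hO.exp_neg, ← hO.exp_smul_half_sq t Y]; group
  have e2 : ∀ q : G, q * lieExp (-(1 / 2 : ℝ) • t • Y) * lieExp ((1 / 2 : ℝ) • t • Y) = q :=
    fun q => by rw [hO.exp_neg_half]; group
  have e3 : modRoot O (lieExp (t • Y) : G) * modRoot O (lieExp (-(1 / 2 : ℝ) • t • Y) : G) ^ 2 = 1 := by
    rw [hO.exp_neg_half, hO.modRoot_inv, inv_pow, hO.modRoot_half_sq]
    exact mul_inv_cancel₀ (hO.modRoot_pos _).ne'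
  simp only [e1, e2] at h1
  have e4 := congrArg (fun r : ℝ => (r : ℂ)) e3
  simp only [Complex.ofReal_mul, Complex.ofReal_one] at e4
  have h2 : ∀ a, ∫ b, rightFamily O c Y g t (a, b) * h (b, a) ∂m = lineDensity G O Y t *
      (c (a * lieExp (-(1 / 2 : ℝ) • t • Y)) * kernelComp m g h (a * lieExp (-t • Y), a)) := fun a => by
    simp only [rightFamily, kernelComp, mul_assoc, integral_const_mul]
  simp only [h2]
  rw [integral_const_mul, h1, fiberIntegral, lineDensity]
  push_cast at e4 ⊢
  linear_combination (-(densF G (t • Y) : ℂ) * ∫ q, c q * kernelComp m g h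
    (q * lieExp (-(1 / 2 : ℝ) • t • Y), q * lieExp ((1 / 2 : ℝ) • t • Y)) ∂m) * e4

/-- The mirror image, with q = b exp(tY/2) and `modRoot` at exp(-tY); F is even. The two
integrations now come in the opposite order, and Fubini requires the conditions on `c`, `g` and `h`.
-/
theorem fiberIntegral_kernelComp_left (hO : IsWeaklyExponential m O)
    (hc : ContMDiff 𝓘(ℝ, E) 𝓘(ℝ, ℂ) ∞ c) (hg : IsTestKernel E g) (hh : IsTestKernel E h) (t : ℝ) :
    fiberIntegral m c (kernelComp m h g) (t • Y) =
      ∫ a, ∫ b, leftFamily O c Y g t (a, b) * h (b, a) ∂m ∂m := by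
  have h1 := hO.integral_mul_right_haar (fun q => c q *
    kernelComp m h g (q * lieExp (-(1 / 2 : ℝ) • t • Y), q * lieExp ((1 / 2 : ℝ) • t • Y)))
    (lieExp ((1 / 2 : ℝ) • t • Y))
  have e1 : ∀ q : G, q * lieExp ((1 / 2 : ℝ) • t • Y) * lieExp ((1 / 2 : ℝ) • t • Y) =
      q * lieExp (t • Y) := fun q => by rw [mul_assoc, hO.exp_smul_half_sq]
  have e2 : ∀ q : G, q * lieExp ((1 / 2 : ℝ) • t • Y) * lieExp (-(1 / 2 : ℝ) • t • Y) = q :=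
    fun q => by rw [hO.exp_neg_half]; group
  have e3 : modRoot O (lieExp (-t • Y) : G) * modRoot O (lieExp ((1 / 2 : ℝ) • t • Y) : G) ^ 2 = 1 := by
    rw [hO.modRoot_half_sq, neg_smul, hO.exp_neg, hO.modRoot_inv]
    exact inv_mul_cancel₀ (hO.modRoot_pos _).ne'
  simp only [e1, e2] at h1
  have e4 := congrArg (fun r : ℝ => (r : ℂ)) e3
  simp only [Complex.ofReal_mul, Complex.ofReal_one] at e4
  have hint : Integrable (uncurry fun a b : G => leftFamily O c Y g t (a, b) * h (b, a))
      (m.prod m) := by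
    refine Continuous.integrable_of_hasCompactSupport ?_ ?_
    · have hcc := hc.continuous
      have hgc := hg.smooth.continuous
      have hhc := hh.smooth.continuous
      have h3 : Continuous fun x : G × G => c (x.2 * lieExp ((1 / 2 : ℝ) • t • Y)) := by fun_prop
      have h4 : Continuous fun x : G × G => g (x.1, x.2 * lieExp (t • Y)) :=
        hgc.comp (by fun_prop)
      have h5 : Continuous fun x : G × G => h (x.2, x.1) := hhc.comp (by fun_prop)
      exact (continuous_const.mul (h3.mul h4)).mul h5
    · refine HasCompactSupport.mul_left (f' := fun x : G × G => h (x.2, x.1)) ?_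
      exact hh.compact.comp_homeomorph (Homeomorph.prodComm G G)
  have h2 : ∀ b, ∫ a, leftFamily O c Y g t (a, b) * h (b, a) ∂m = lineDensity G O Y (-t) *
      (c (b * lieExp ((1 / 2 : ℝ) • t • Y)) * kernelComp m h g (b, b * lieExp (t • Y))) := fun b => by
    simp only [leftFamily, kernelComp]
    rw [← integral_const_mul, ← integral_const_mul]
    refine integral_congr_ae (Eventually.of_forall fun a => ?_)
    simp only; ring
  rw [integral_integral_swap hint]
  simp only [h2]
  have e5 : densF G (-t • Y) = densF G (t • Y) := by rw [neg_smul, densF_neg]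
  rw [integral_const_mul, h1, fiberIntegral, lineDensity, e5]
  push_cast at e4 ⊢
  linear_combination (-(densF G (t • Y) : ℂ) * ∫ q, c q * kernelComp m h g
    (q * lieExp (-(1 / 2 : ℝ) • t • Y), q * lieExp ((1 / 2 : ℝ) • t • Y)) ∂m) * e4

/-- The kernel is the l-th derivative of `rightFamily` at t = 0, which does not involve `h`. -/
theorem exists_kernel_right (hO : IsWeaklyExponential m O)
    (hc : ContMDiff 𝓘(ℝ, E) 𝓘(ℝ, ℂ) ∞ c) (Y : E) (l : ℕ) (hg : IsTestKernel E g) :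
    ∃ κ : G × G → ℂ, IsTestKernel E κ ∧ ∀ h : G × G → ℂ, IsTestKernel E h →
      iteratedDeriv l (fun t : ℝ => fiberIntegral m c (kernelComp m g h) (t • Y)) 0 =
        ∫ a, ∫ b, κ (a, b) * h (b, a) ∂m ∂m := by
  obtain ⟨r, hr, hrO⟩ := hO.exists_line_domain Y
  have hW := hO.isKernelFamily_right hc hg hrO
  refine ⟨_, hO.isTestKernel_iteratedDeriv Metric.isOpen_ball hW l (Metric.mem_ball_self hr),
    fun h hh => ?_⟩
  rw [← hO.iteratedDeriv_integral_family Metric.isOpen_ball hW hh l (Metric.mem_ball_self hr)]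
  simp only [hO.fiberIntegral_kernelComp_right]

theorem exists_kernel_left (hO : IsWeaklyExponential m O)
    (hc : ContMDiff 𝓘(ℝ, E) 𝓘(ℝ, ℂ) ∞ c) (Y : E) (l : ℕ) (hg : IsTestKernel E g) :
    ∃ κ : G × G → ℂ, IsTestKernel E κ ∧ ∀ h : G × G → ℂ, IsTestKernel E h →
      iteratedDeriv l (fun t : ℝ => fiberIntegral m c (kernelComp m h g) (t • Y)) 0 =
        ∫ a, ∫ b, κ (a, b) * h (b, a) ∂m ∂m := by
  obtain ⟨r, hr, hrO⟩ := hO.exists_line_domain Y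
  have hW := hO.isKernelFamily_left hc hg hrO
  refine ⟨_, hO.isTestKernel_iteratedDeriv Metric.isOpen_ball hW l (Metric.mem_ball_self hr),
    fun h hh => ?_⟩
  rw [← hO.iteratedDeriv_integral_family Metric.isOpen_ball hW hh l (Metric.mem_ball_self hr)]
  simp only [hO.fiberIntegral_kernelComp_left hc hg hh]

end IsWeaklyExponential

end Families

/-! ### Ordered products of generators that span a Lie algebra -/

section OrderedWords

variable {R A ι : Type*} [CommRing R] [Ring A] [Algebra R A] {z : ι → A}

/-- The span of the products of fewer than `N` of the elements `z i`. -/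
def wordSpan (R : Type*) {A ι : Type*} [CommRing R] [Ring A] [Algebra R A] (z : ι → A) (N : ℕ) :
    Submodule R A :=
  Submodule.span R {a | ∃ w : List ι, w.length < N ∧ (w.map z).prod = a}

theorem wordSpan_mono {M N : ℕ} (h : M ≤ N) : wordSpan R z M ≤ wordSpan R z N :=
  Submodule.span_mono fun _ ⟨w, hw, ha⟩ => ⟨w, hw.trans_le h, ha⟩

theorem mul_mem_wordSpan (i : ι) {N : ℕ} {a : A} (ha : a ∈ wordSpan R z N) :
    z i * a ∈ wordSpan R z (N + 1) := by
  induction ha using Submodule.span_induction with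
  | mem a h =>
    obtain ⟨w, hw, rfl⟩ := h
    exact Submodule.subset_span ⟨i :: w, by simpa using hw, by simp⟩
  | zero => simp
  | add a b _ _ ha hb => rw [mul_add]; exact add_mem ha hb
  | smul c a _ ha => rw [mul_smul_comm]; exact Submodule.smul_mem _ c ha

theorem mul_prod_mem_wordSpan {w : List ι} {a : A} (ha : a ∈ Submodule.span R (range z)) :
    a * (w.map z).prod ∈ wordSpan R z (w.length + 2) := by
  induction ha using Submodule.span_induction with
  | mem a h =>
    obtain ⟨i, rfl⟩ := h
    exact Submodule.subset_span ⟨i :: w, by simp, by simp⟩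
  | zero => simp
  | add a b _ _ ha hb => rw [add_mul]; exact add_mem ha hb
  | smul c a _ ha => rw [smul_mul_assoc]; exact Submodule.smul_mem _ c ha

/-- Adjacent transpositions generate all permutations, and each one costs a commutator, which
replaces two letters by a combination of single ones. -/
theorem prod_sub_prod_mem_wordSpan (hz : ∀ i j, z i * z j - z j * z i ∈ Submodule.span R (range z))
    {w v : List ι} (h : w.Perm v) : (w.map z).prod - (v.map z).prod ∈ wordSpan R z w.length := by
  induction h with
  | nil => simp
  | cons i _ ih =>
    simp only [List.map_cons, List.prod_cons, ← mul_sub, List.length_cons]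
    exact mul_mem_wordSpan i ih
  | swap i j l =>
    simp only [List.map_cons, List.prod_cons, ← mul_assoc, ← sub_mul, List.length_cons]
    exact mul_prod_mem_wordSpan (hz _ _)
  | trans h1 _ ih1 ih2 =>
    rw [← h1.length_eq] at ih2
    simpa using add_mem ih1 ih2

/-- A product of generators that commute up to linear combinations of generators is a linear
combination of ordered products. -/
theorem wordSpan_le_span_ordered [DecidableEq ι]
    (hz : ∀ i j, z i * z j - z j * z i ∈ Submodule.span R (range z))
    {is : List ι} (hn : is.Nodup) (hmem : ∀ i, i ∈ is) (N : ℕ) :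
    wordSpan R z N ≤
      Submodule.span R (range fun k : ι → ℕ => (is.map fun i => z i ^ k i).prod) := by
  induction N with
  | zero => exact Submodule.span_le.2 fun a ⟨w, hw, _⟩ => absurd hw (by simp)
  | succ N ih =>
    refine Submodule.span_le.2 ?_
    rintro a ⟨w, hw, rfl⟩
    -- The letters of `w`, sorted in the order of `is`.
    let v : List ι := is.flatMap fun i => List.replicate (w.count i) i
    have hv : w.Perm v := by
      rw [List.perm_iff_count]
      intro j
      have h1 : ∀ l : List ι, l.Nodup → (l.flatMap fun i => List.replicate (w.count i) i).count j =
          if j ∈ l then w.count j else 0 := by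
        intro l hl
        induction l with
        | nil => simp
        | cons i l ihl =>
          rw [List.nodup_cons] at hl
          rw [List.flatMap_cons, List.count_append, ihl hl.2, List.count_replicate]
          by_cases hij : j = i
          · subst hij; simp [hl.1]
          · simp [hij, Ne.symm hij]
      rw [h1 is hn, if_pos (hmem j)]
    have h2 : (v.map z).prod = (is.map fun i => z i ^ w.count i).prod := by
      have h3 : ∀ l : List ι, ((l.flatMap fun i => List.replicate (w.count i) i).map z).prod =
          (l.map fun i => z i ^ w.count i).prod := by
        intro l
        induction l with
        | nil => simp
        | cons i l ihl =>
          rw [List.flatMap_cons, List.map_append, List.prod_append, ihl]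
          simp
      exact h3 is
    have h4 := add_mem (ih (wordSpan_mono (Nat.lt_succ_iff.1 hw) (prod_sub_prod_mem_wordSpan hz hv)))
      (Submodule.subset_span (mem_range_self (fun i => w.count i)) : _ ∈ Submodule.span R (range fun k : ι → ℕ => (is.map fun i => z i ^ k i).prod))
    rw [h2] at h4
    simpa using h4

/-- The spanning half of the Poincaré–Birkhoff–Witt theorem: the generated algebra is spanned by
words, and induction on the length sorts them. -/
theorem adjoin_le_span_ordered [DecidableEq ι]
    (hz : ∀ i j, z i * z j - z j * z i ∈ Submodule.span R (range z))
    {is : List ι} (hn : is.Nodup) (hmem : ∀ i, i ∈ is) {a : A}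
    (ha : a ∈ Algebra.adjoin R (range z)) :
    a ∈ Submodule.span R (range fun k : ι → ℕ => (is.map fun i => z i ^ k i).prod) := by
  rw [← Subalgebra.mem_toSubmodule, Algebra.adjoin_eq_span] at ha
  refine Submodule.span_le.2 (fun b hb => ?_) ha
  obtain ⟨l, hl, rfl⟩ := Submonoid.exists_list_of_mem_closure hb
  have h1 : ∃ w : List ι, w.map z = l := by
    induction l with
    | nil => exact ⟨[], rfl⟩
    | cons b l ihl =>
      obtain ⟨i, rfl⟩ := hl b (by simp)
      obtain ⟨w, rfl⟩ := ihl (fun c hc => hl c (by simp [hc])) (by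
        exact list_prod_mem fun c hc => Submonoid.subset_closure (hl c (by simp [hc])))
      exact ⟨i :: w, rfl⟩
  obtain ⟨w, rfl⟩ := h1
  exact wordSpan_le_span_ordered hz hn hmem (w.length + 1)
    (Submodule.subset_span ⟨w, Nat.lt_succ_self _, rfl⟩)

end OrderedWords

/-! ### Left invariant differential operators on `G × G` -/

section Operators

variable {E : Type*} [NormedAddCommGroup E] [NormedSpace ℝ E] [FiniteDimensional ℝ E]
  [MeasurableSpace E] [BorelSpace E]
  {G : Type*} [Group G] [TopologicalSpace G] [T2Space G] [SecondCountableTopology G]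
  [ChartedSpace E G] [LieGroup 𝓘(ℝ, E) ∞ G] [MeasurableSpace G] [BorelSpace G]
  {m : Measure G} {O : Set E}

/-- The smooth functions on `G × G`. -/
def smoothFn (E : Type*) [NormedAddCommGroup E] [NormedSpace ℝ E] (G : Type*)
    [TopologicalSpace G] [ChartedSpace E G] : Submodule ℝ (G × G → ℂ) where
  carrier := {k | ContMDiff (𝓘(ℝ, E).prod 𝓘(ℝ, E)) 𝓘(ℝ, ℂ) ∞ k}
  add_mem' h h' := ContMDiff.add h h'
  zero_mem' := contMDiff_const
  smul_mem' c _ h := (contDiff_const_smul c).contMDiff.comp h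

namespace IsWeaklyExponential

theorem contDiff_pull (hO : IsWeaklyExponential m O) {k : G × G → ℂ} (hk : k ∈ smoothFn E G)
    (x : G × G) : ContDiff ℝ ∞ fun z : E × E => k (x.1 * lieExp z.1, x.2 * lieExp z.2) :=
  contDiff_iff_contDiffAt.2 fun _ => contDiffAt_kernel_comp hk
    (hO.contMDiffAt_mul_exp contMDiffAt_const contDiffAt_fst)
    (hO.contMDiffAt_mul_exp contMDiffAt_const contDiffAt_snd)

/-- The left invariant vector field on `G × G` that corresponds to a pair of elements of the Lie
algebra. -/
def pairField (hO : IsWeaklyExponential m O) : E × E →ₗ[ℝ] Module.End ℝ (smoothFn E G) where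
  toFun Z :=
    { toFun := fun k => ⟨fun x =>
        fderiv ℝ (fun z : E × E => k.1 (x.1 * lieExp z.1, x.2 * lieExp z.2)) 0 Z, by
        refine hO.contMDiff_of_comp_exp_prod fun a b => ?_
        have h1 : ContDiffAt ℝ ∞ (uncurry fun w z : E × E =>
            k.1 (a * lieExp w.1 * lieExp z.1, b * lieExp w.2 * lieExp z.2)) (0, 0) :=
          contDiffAt_kernel_comp k.2
            (hO.contMDiffAt_mul_exp (hO.contMDiffAt_mul_exp contMDiffAt_const (by fun_prop))
              (by fun_prop))
            (hO.contMDiffAt_mul_exp (hO.contMDiffAt_mul_exp contMDiffAt_const (by fun_prop))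
              (by fun_prop))
        exact (ContDiffAt.fderiv (m := ∞) (n := ∞) (g := fun _ : E × E => (0 : E × E)) h1
          contDiffAt_const (by simp)).clm_apply contDiffAt_const⟩
      map_add' := fun k k' => by
        ext x
        have h1 := fderiv_add (𝕜 := ℝ) (x := (0 : E × E))
          ((hO.contDiff_pull k.2 x).differentiable (by simp)).differentiableAt
          ((hO.contDiff_pull k'.2 x).differentiable (by simp)).differentiableAt
        exact congrArg (fun L => L Z) h1
      map_smul' := fun c k => by
        ext x
        have h1 := fderiv_const_smul (𝕜 := ℝ) (x := (0 : E × E))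
          ((hO.contDiff_pull k.2 x).differentiable (by simp)).differentiableAt c
        exact congrArg (fun L => L Z) h1 }
  map_add' Z Z' := by ext k x; simp
  map_smul' c Z := by ext k x; simp

theorem hasDerivAt_pairField (hO : IsWeaklyExponential m O) (X Y : E) (k : smoothFn E G)
    (x : G × G) (t : ℝ) :
    HasDerivAt (fun t : ℝ => k.1 (x.1 * lieExp (t • X), x.2 * lieExp (t • Y)))
      ((hO.pairField (X, Y) k).1 (x.1 * lieExp (t • X), x.2 * lieExp (t • Y))) t := by
  have h1 : HasDerivAt (fun s : ℝ => (s • X, s • Y)) (X, Y) (0 : ℝ) := by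
    simpa using ((hasDerivAt_id (0 : ℝ)).smul_const X).prodMk ((hasDerivAt_id (0 : ℝ)).smul_const Y)
  have h2 := ((hO.contDiff_pull k.2 (x.1 * lieExp (t • X), x.2 * lieExp (t • Y))).differentiable
    (by simp)).differentiableAt (x := (0 : E × E)) |>.hasFDerivAt
  have h3 := HasFDerivAt.comp_hasDerivAt_of_eq (0 : ℝ) h2 h1 (by simp only [zero_smul]; rfl)
  have h4 : HasDerivAt (fun s : ℝ => s - t) 1 t := by simpa using (hasDerivAt_id t).sub_const t
  have h5 := HasDerivAt.scomp_of_eq t h3 h4 (by simp)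
  rw [one_smul] at h5
  refine h5.congr_of_eventuallyEq (Eventually.of_forall fun s => ?_)
  have h6 : ∀ Z : E, (lieExp (t • Z) : G) * lieExp ((s - t) • Z) = lieExp (s • Z) := fun Z => by
    rw [← hO.exp_add_smul]; congr 1; ring_nf
  simp only [Function.comp_apply, mul_assoc, h6]

theorem pairField_left (hO : IsWeaklyExponential m O) (X : E) (k : smoothFn E G) (x : G × G) :
    (hO.pairField (X, 0) k).1 x = lder X (fun a => k.1 (a, x.2)) x.1 := by
  have h := hO.hasDerivAt_pairField X 0 k x 0
  simp only [smul_zero, zero_smul, lieExp_zero, mul_one] at h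
  exact h.deriv.symm

theorem pairField_right (hO : IsWeaklyExponential m O) (Y : E) (k : smoothFn E G) (x : G × G) :
    (hO.pairField (0, Y) k).1 x = lder Y (fun b => k.1 (x.1, b)) x.2 := by
  have h := hO.hasDerivAt_pairField 0 Y k x 0
  simp only [smul_zero, zero_smul, lieExp_zero, mul_one] at h
  exact h.deriv.symm

theorem contMDiff_left {k : G × G → ℂ} (hk : k ∈ smoothFn E G) (b : G) :
    ContMDiff 𝓘(ℝ, E) 𝓘(ℝ, ℂ) ∞ fun a => k (a, b) :=
  ContMDiff.comp (g := k) hk (contMDiff_id.prodMk contMDiff_const)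

theorem contMDiff_right {k : G × G → ℂ} (hk : k ∈ smoothFn E G) (a : G) :
    ContMDiff 𝓘(ℝ, E) 𝓘(ℝ, ℂ) ∞ fun b => k (a, b) :=
  ContMDiff.comp (g := k) hk (contMDiff_const.prodMk contMDiff_id)

theorem field₁_eq (hO : IsWeaklyExponential m O) (X : E) (k : smoothFn E G) :
    field₁ X k.1 = (hO.pairField (X, 0) k).1 := by
  funext x
  rw [hO.pairField_left, hO.lder_eq_mfderiv ((contMDiff_left k.2 x.2).mdifferentiable (by simp) _)]
  rfl

theorem field₂_eq (hO : IsWeaklyExponential m O) (Y : E) (k : smoothFn E G) :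
    field₂ Y k.1 = (hO.pairField (0, Y) k).1 := by
  funext x
  rw [hO.pairField_right, hO.lder_eq_mfderiv ((contMDiff_right k.2 x.1).mdifferentiable (by simp) _)]
  rfl

theorem pairField_comm_left (hO : IsWeaklyExponential m O) (X Y : E) :
    hO.pairField (X, 0) * hO.pairField (Y, 0) - hO.pairField (Y, 0) * hO.pairField (X, 0) =
      hO.pairField (G := G) (lieAd G X Y, 0) := by
  ext k x
  have h := hO.lder_comm (contMDiff_left k.2 x.2) X Y x.1
  rw [hO.pairField_left, ← h]
  change (hO.pairField (X, 0) (hO.pairField (Y, 0) k)).1 x -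
    (hO.pairField (Y, 0) (hO.pairField (X, 0) k)).1 x = _
  simp only [hO.pairField_left]

theorem pairField_comm_right (hO : IsWeaklyExponential m O) (X Y : E) :
    hO.pairField (0, X) * hO.pairField (0, Y) - hO.pairField (0, Y) * hO.pairField (0, X) =
      hO.pairField (G := G) (0, lieAd G X Y) := by
  ext k x
  have h := hO.lder_comm (contMDiff_right k.2 x.1) X Y x.2
  rw [hO.pairField_right, ← h]
  change (hO.pairField (0, X) (hO.pairField (0, Y) k)).1 x -
    (hO.pairField (0, Y) (hO.pairField (0, X) k)).1 x = _
  simp only [hO.pairField_right]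

theorem pairField_comm_left_right (hO : IsWeaklyExponential m O) (X Y : E) :
    hO.pairField (G := G) (X, 0) * hO.pairField (0, Y) =
      hO.pairField (0, Y) * hO.pairField (X, 0) := by
  ext k x
  change (hO.pairField (X, 0) (hO.pairField (0, Y) k)).1 x =
    (hO.pairField (0, Y) (hO.pairField (X, 0) k)).1 x
  simp only [hO.pairField_left, hO.pairField_right, lder]
  refine deriv_deriv_comm (H := fun s t => k.1 (x.1 * lieExp (s • X), x.2 * lieExp (t • Y))) ?_
  have h1 : ContDiff ℝ ∞ fun z : ℝ × ℝ => k.1 (x.1 * lieExp (z.1 • X), x.2 * lieExp (z.2 • Y)) :=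
    (hO.contDiff_pull k.2 x).comp (f := fun z : ℝ × ℝ => (z.1 • X, z.2 • Y)) (by fun_prop)
  exact (h1.of_le ENat.LEInfty.out).contDiffAt


variable {n : ℕ} (X : Module.Basis (Fin n) ℝ E)

/-- The vector fields of a basis, acting on the first and on the second variable. -/
def basisField (hO : IsWeaklyExponential m O) : Fin n ⊕ Fin n → Module.End ℝ (smoothFn E G) :=
  Sum.elim (fun i => hO.pairField (X i, 0)) (fun i => hO.pairField (0, X i))

theorem pairField_mem_span (hO : IsWeaklyExponential m O) (Z : E × E) :
    hO.pairField (G := G) Z ∈ Submodule.span ℝ (range (hO.basisField X)) := by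
  have h1 : Z = ∑ i, (X.repr Z.1 i • (X i, (0 : E)) + X.repr Z.2 i • ((0 : E), X i)) := by
    refine Prod.ext ?_ ?_
    · simp [Prod.fst_sum, X.sum_repr]
    · simp [Prod.snd_sum, X.sum_repr]
  rw [h1, map_sum]
  refine sum_mem fun i _ => ?_
  rw [map_add, map_smul, map_smul]
  exact add_mem (Submodule.smul_mem _ _ (Submodule.subset_span ⟨Sum.inl i, rfl⟩))
    (Submodule.smul_mem _ _ (Submodule.subset_span ⟨Sum.inr i, rfl⟩))

/-- Fields in different variables commute, and within one variable the commutator is the field of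
the Lie bracket, a combination of basis fields. This is what the reordering of words requires. -/
theorem basisField_comm_mem_span (hO : IsWeaklyExponential m O) (i j : Fin n ⊕ Fin n) :
    hO.basisField (G := G) X i * hO.basisField X j - hO.basisField X j * hO.basisField X i ∈
      Submodule.span ℝ (range (hO.basisField X)) := by
  rcases i with i | i <;> rcases j with j | j <;> simp only [basisField, Sum.elim_inl, Sum.elim_inr]
  · rw [hO.pairField_comm_left]; exact hO.pairField_mem_span X _
  · have h := sub_eq_zero_of_eq (hO.pairField_comm_left_right (G := G) (X i) (X j))
    rw [h]; exact Submodule.zero_mem _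
  · have h := sub_eq_zero_of_eq (hO.pairField_comm_left_right (G := G) (X j) (X i)).symm
    rw [h]; exact Submodule.zero_mem _
  · rw [hO.pairField_comm_right]; exact hO.pairField_mem_span X _

/-- The ordered product of powers of the basis fields that corresponds to `diffOp`. -/
def orderedOp (hO : IsWeaklyExponential m O) (e : Fin n ⊕ Fin n → ℕ) :
    Module.End ℝ (smoothFn E G) :=
  (((List.finRange n).map Sum.inl ++ (List.finRange n).map Sum.inr).map fun i =>
    hO.basisField X i ^ e i).prod

theorem adjoin_basisField_le_span (hO : IsWeaklyExponential m O) {a : Module.End ℝ (smoothFn E G)}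
    (ha : a ∈ Algebra.adjoin ℝ (range (hO.basisField X))) :
    a ∈ Submodule.span ℝ (range (hO.orderedOp X)) := by
  refine adjoin_le_span_ordered (z := hO.basisField X) (hO.basisField_comm_mem_span X)
    (is := (List.finRange n).map Sum.inl ++ (List.finRange n).map Sum.inr) ?_ ?_ ha
  · refine List.Nodup.append ((List.nodup_finRange n).map Sum.inl_injective)
      ((List.nodup_finRange n).map Sum.inr_injective) ?_
    intro x h1 h2
    obtain ⟨i, -, rfl⟩ := List.mem_map.1 h1
    obtain ⟨j, -, h⟩ := List.mem_map.1 h2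
    exact absurd h (by simp)
  · rintro (i | i) <;> simp

theorem iterate_eq_pow_apply {f : (G × G → ℂ) → G × G → ℂ} {D : Module.End ℝ (smoothFn E G)}
    (h : ∀ k : smoothFn E G, f k.1 = (D k).1) (j : ℕ) (k : smoothFn E G) :
    f^[j] k.1 = ((D ^ j) k).1 := by
  induction j generalizing k with
  | zero => rfl
  | succ j ih => rw [iterate_succ_apply, h, ih, pow_succ]; rfl

theorem foldr_iterate_eq_prod_apply {f : Fin n → (G × G → ℂ) → G × G → ℂ}
    {D : Fin n → Module.End ℝ (smoothFn E G)} (h : ∀ i, ∀ k : smoothFn E G, f i k.1 = (D i k).1)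
    (e : Fin n → ℕ) (L : List (Fin n)) (k : smoothFn E G) :
    L.foldr (fun i => (f i)^[e i]) k.1 = ((L.map fun i => D i ^ e i).prod k).1 := by
  induction L with
  | nil => rfl
  | cons i L ih =>
    rw [List.foldr_cons, ih, iterate_eq_pow_apply (h i), List.map_cons, List.prod_cons]; rfl

/-- Recasts the iterated operators of the semi-norms as an ordered product in an endomorphism
algebra, to which the reordering of words applies. -/
theorem diffOp_eq (hO : IsWeaklyExponential m O) (e : Fin n ⊕ Fin n → ℕ) (k : smoothFn E G) :
    diffOp X (e ∘ Sum.inl) (e ∘ Sum.inr) k.1 = (hO.orderedOp X e k).1 := by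
  rw [diffOp, foldr_iterate_eq_prod_apply (fun i => hO.field₂_eq (X i)),
    foldr_iterate_eq_prod_apply (fun i => hO.field₁_eq (X i)), orderedOp, List.map_append,
    List.prod_append, List.map_map, List.map_map]
  rfl

end IsWeaklyExponential

end Operators
/-! ### Continuity of distributions on compact groups -/

section Continuity

variable {E : Type*} [NormedAddCommGroup E] [NormedSpace ℝ E] [FiniteDimensional ℝ E]
  [MeasurableSpace E] [BorelSpace E]
  {G : Type*} [Group G] [TopologicalSpace G] [T2Space G] [SecondCountableTopology G]
  [ChartedSpace E G] [LieGroup 𝓘(ℝ, E) ∞ G] [MeasurableSpace G] [BorelSpace G]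
  {m : Measure G} {O : Set E} {ħ : ℝ} {n : ℕ} {X : Module.Basis (Fin n) ℝ E}
  {p p' : testF m ħ O → ℝ}

theorem snorm_nonneg (k l : Fin n → ℕ) (f : testF m ħ O) : 0 ≤ snorm X k l f :=
  Real.iSup_nonneg fun _ => norm_nonneg _

/-- `p` is bounded by a multiple of a finite sum of semi-norms. -/
def IsDominated (X : Module.Basis (Fin n) ℝ E) (p : testF m ħ O → ℝ) : Prop :=
  ∃ s : Finset (Fin n ⊕ Fin n → ℕ), ∃ C : ℝ, 0 ≤ C ∧
    ∀ f, p f ≤ C * ∑ e ∈ s, snorm X (e ∘ Sum.inl) (e ∘ Sum.inr) f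

theorem IsDominated.mono (hp : IsDominated X p) (h : ∀ f, p' f ≤ p f) : IsDominated X p' := by
  obtain ⟨s, C, hC, hs⟩ := hp
  exact ⟨s, C, hC, fun f => (h f).trans (hs f)⟩

theorem isDominated_zero : IsDominated X fun _ : testF m ħ O => 0 :=
  ⟨∅, 0, le_rfl, fun f => by simp⟩

theorem IsDominated.add (hp : IsDominated X p) (hp' : IsDominated X p') :
    IsDominated X fun f => p f + p' f := by
  classical
  obtain ⟨s, C, hC, hs⟩ := hp
  obtain ⟨s', C', hC', hs'⟩ := hp'
  refine ⟨s ∪ s', C + C', by positivity, fun f => ?_⟩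
  rw [add_mul]
  refine add_le_add ((hs f).trans ?_) ((hs' f).trans ?_)
  · exact mul_le_mul_of_nonneg_left (Finset.sum_le_sum_of_subset_of_nonneg
      Finset.subset_union_left fun _ _ _ => snorm_nonneg _ _ _) hC
  · exact mul_le_mul_of_nonneg_left (Finset.sum_le_sum_of_subset_of_nonneg
      Finset.subset_union_right fun _ _ _ => snorm_nonneg _ _ _) hC'

theorem IsDominated.const_mul (hp : IsDominated X p) {c : ℝ} (hc : 0 ≤ c) :
    IsDominated X fun f => c * p f := by
  obtain ⟨s, C, hC, hs⟩ := hp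
  exact ⟨s, c * C, by positivity, fun f => by
    rw [mul_assoc]; exact mul_le_mul_of_nonneg_left (hs f) hc⟩

theorem IsDominated.sum {ι : Type*} (s : Finset ι) {p : ι → testF m ħ O → ℝ}
    (hp : ∀ i ∈ s, IsDominated X (p i)) : IsDominated X fun f => ∑ i ∈ s, p i f := by
  classical
  induction s using Finset.induction_on with
  | empty => simpa using isDominated_zero
  | insert i s hi ih =>
    simp only [Finset.sum_insert hi]
    exact (hp i (Finset.mem_insert_self i s)).add
      (ih fun j hj => hp j (Finset.mem_insert_of_mem hj))

namespace IsWeaklyExponential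

/-- The integral kernel of a test function, as a smooth function. -/
def smoothKernel (f : testF m ħ O) : smoothFn E G := ⟨kernel f, (isTestKernel_kernel f).smooth⟩

theorem snorm_zero (hO : IsWeaklyExponential m O) [IsTopologicalGroup G] [LocallyCompactSpace G]
    [m.IsHaarMeasure] (hħ : ħ ≠ 0) (e : Fin n ⊕ Fin n → ℕ) :
    snorm X (e ∘ Sum.inl) (e ∘ Sum.inr) (0 : testF m ħ O) = 0 := by
  have h1 : smoothKernel (0 : testF m ħ O) = 0 := by
    refine Subtype.ext ?_
    have h2 := hO.kernel_smul hħ 0 (0 : testF m ħ O)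
    rw [zero_smul, zero_smul] at h2
    exact h2
  have h3 := hO.diffOp_eq X e (0 : smoothFn E G)
  rw [map_zero] at h3
  have h4 : kernel (0 : testF m ħ O) = (0 : smoothFn E G).1 := congrArg Subtype.val h1
  rw [snorm, h4, h3]
  simp

/-- The functions f ↦ ‖f - g‖_{k,l} are continuous and vanish at f = g, the latter because the
kernel of 0 is 0; so they squeeze T(f - g) to 0. -/
theorem continuous_of_isDominated (hO : IsWeaklyExponential m O) [IsTopologicalGroup G]
    [LocallyCompactSpace G] [m.IsHaarMeasure] (hħ : ħ ≠ 0) (T : Module.Dual ℂ (testF m ħ O))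
    (hT : IsDominated X fun f => ‖T f‖) : @Continuous _ _ (testTopology X) inferInstance T := by
  letI : TopologicalSpace (testF m ħ O) := testTopology X
  obtain ⟨s, C, hC, hs⟩ := hT
  refine continuous_iff_continuousAt.2 fun g => ?_
  have h1 : ∀ k l, Continuous fun f : testF m ħ O => snorm X k l (f - g) := fun k l =>
    continuous_iff_le_induced.2 ((iInf_le _ k).trans ((iInf_le _ l).trans (iInf_le _ g)))
  have h2 : Tendsto (fun f : testF m ħ O =>
      C * ∑ e ∈ s, snorm X (e ∘ Sum.inl) (e ∘ Sum.inr) (f - g)) (𝓝 g) (𝓝 0) := by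
    have h3 : Continuous fun f : testF m ħ O =>
        C * ∑ e ∈ s, snorm X (e ∘ Sum.inl) (e ∘ Sum.inr) (f - g) :=
      continuous_const.mul (continuous_finsetSum _ fun e _ => h1 _ _)
    refine h3.tendsto' g 0 ?_
    simp only [sub_self, hO.snorm_zero hħ, Finset.sum_const_zero, mul_zero]
  rw [ContinuousAt, tendsto_iff_norm_sub_tendsto_zero]
  refine squeeze_zero (fun _ => norm_nonneg _) (fun f => ?_) h2
  rw [← map_sub]
  exact hs _

variable [CompactSpace G]

theorem norm_le_iSup (k : smoothFn E G) (x : G × G) : ‖k.1 x‖ ≤ ⨆ x, ‖k.1 x‖ :=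
  le_ciSup (isCompact_range (ContMDiff.continuous k.2).norm).bddAbove x

/-- The supremum of the image of the kernel under a left invariant differential operator. -/
def opNorm (a : Module.End ℝ (smoothFn E G)) (f : testF m ħ O) : ℝ :=
  ⨆ x, ‖(a (smoothKernel f)).1 x‖

/-- The semi-norms see only ordered products of basis fields; sorting extends the bound to the whole
algebra they generate, including powers of an arbitrary invariant field. Compactness keeps the
suprema finite. -/
theorem isDominated_opNorm (hO : IsWeaklyExponential m O) {a : Module.End ℝ (smoothFn E G)}
    (ha : a ∈ Algebra.adjoin ℝ (range (hO.basisField X))) :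
    IsDominated X (opNorm (m := m) (ħ := ħ) (O := O) a) := by
  have h1 := hO.adjoin_basisField_le_span X ha
  clear ha
  induction h1 using Submodule.span_induction with
  | mem a h =>
    obtain ⟨e, rfl⟩ := h
    refine ⟨{e}, 1, zero_le_one, fun f => ?_⟩
    rw [Finset.sum_singleton, one_mul, opNorm, ← hO.diffOp_eq]
    rfl
  | zero =>
    refine isDominated_zero.mono fun f => ciSup_le fun x => ?_
    simp
  | add a b _ _ ha hb =>
    refine (ha.add hb).mono fun f => ciSup_le fun x => ?_
    exact (norm_add_le ((a (smoothKernel f)).1 x) ((b (smoothKernel f)).1 x)).trans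
      (add_le_add (norm_le_iSup _ x) (norm_le_iSup _ x))
  | smul c a _ ha =>
    refine (ha.const_mul (norm_nonneg c)).mono fun f => ciSup_le fun x => ?_
    exact (norm_smul c ((a (smoothKernel f)).1 x)).le.trans
      (mul_le_mul_of_nonneg_left (norm_le_iSup _ x) (norm_nonneg c))

theorem pairField_mem_adjoin (hO : IsWeaklyExponential m O) (Z : E × E) :
    hO.pairField (G := G) Z ∈ Algebra.adjoin ℝ (range (hO.basisField X)) :=
  Algebra.span_le_adjoin ℝ _ (hO.pairField_mem_span X Z)

theorem iteratedDeriv_pairField (hO : IsWeaklyExponential m O) (Y Z : E) (k : smoothFn E G)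
    (x : G × G) (j : ℕ) :
    iteratedDeriv j (fun t : ℝ => k.1 (x.1 * lieExp (t • Y), x.2 * lieExp (t • Z))) =
      fun t => ((hO.pairField (Y, Z) ^ j) k).1 (x.1 * lieExp (t • Y), x.2 * lieExp (t • Z)) := by
  induction j with
  | zero => rw [iteratedDeriv_zero]; rfl
  | succ j ih =>
    rw [iteratedDeriv_succ, ih, pow_succ']
    funext t
    exact (hO.hasDerivAt_pairField Y Z ((hO.pairField (Y, Z) ^ j) k) x t).deriv

variable [IsTopologicalGroup G] [LocallyCompactSpace G] [m.IsHaarMeasure] {c : G → ℂ}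

theorem norm_integral_mul_le (hc : Continuous c) {φ : G → ℂ} {C : ℝ} (h : ∀ q, ‖φ q‖ ≤ C) :
    ‖∫ q, c q * φ q ∂m‖ ≤ (∫ q, ‖c q‖ ∂m) * C := by
  rw [← integral_mul_const]
  refine norm_integral_le_of_norm_le ?_ (Eventually.of_forall fun q => ?_)
  · exact (hc.norm.integrable_of_hasCompactSupport (HasCompactSupport.of_compactSpace _)).mul_const C
  · rw [norm_mul]
    exact mul_le_mul_of_nonneg_left (h q) (norm_nonneg _)

/-- The path t ↦ (q exp(-tY/2), q exp(tY/2)) is an orbit of a one-parameter subgroup of G × G, so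
the t-derivatives of the kernel along it at 0 are powers of the field `P`, evaluated on the
diagonal. Leibniz' rule accounts for the factor F(tY). -/
theorem isDominated_fiberIntegral (hO : IsWeaklyExponential m O)
    (hc : ContMDiff 𝓘(ℝ, E) 𝓘(ℝ, ℂ) ∞ c) (Y : E) (l : ℕ) :
    IsDominated X fun f : testF m ħ O =>
      ‖iteratedDeriv l (fun t : ℝ => fiberIntegral m c (kernel f) (t • Y)) 0‖ := by
  let P := hO.pairField (G := G) (-(1 / 2 : ℝ) • Y, (1 / 2 : ℝ) • Y)
  let D : ℝ → ℂ := fun t => (densF G (t • Y) : ℂ)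
  have hD : ContDiffAt ℝ l D 0 := by
    have h1 : ContDiffAt ℝ ∞ (fun t : ℝ => densF G (t • Y)) 0 :=
      ContDiffAt.comp (f := fun t : ℝ => t • Y) (g := densF G) 0
        (hO.contDiffAt_densF (by simpa using hO.zero_mem)) (by fun_prop)
    exact (Complex.ofRealCLM.contDiff.contDiffAt.comp 0 h1).of_le (by exact_mod_cast le_top)
  have h1 : ∀ j, IsDominated X (opNorm (m := m) (ħ := ħ) (O := O) (P ^ j)) := fun j =>
    hO.isDominated_opNorm (pow_mem (hO.pairField_mem_adjoin _) j)
  refine (IsDominated.sum (Finset.range (l + 1)) (p := fun i f =>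
    (‖(l.choose i : ℂ) * iteratedDeriv i D 0‖ * ∫ q, ‖c q‖ ∂m) * opNorm (P ^ (l - i)) f)
    fun i _ => (h1 (l - i)).const_mul (by positivity)).mono fun f => ?_
  let K : ℝ → G → ℂ := fun t q => c q * (smoothKernel f).1
    (q * lieExp (t • -(1 / 2 : ℝ) • Y), q * lieExp (t • (1 / 2 : ℝ) • Y))
  have hK : ∀ t : ℝ, ∀ Z : E, ContDiffAt ℝ ∞ (fun z : ℝ × E => K z.1 (lieExp z.2)) (t, Z) := by
    intro t Z
    have ha : ContMDiffAt 𝓘(ℝ, ℝ × E) 𝓘(ℝ, E) ∞ (fun z : ℝ × E => (lieExp z.2 : G)) (t, Z) :=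
      hO.contMDiffAt_exp_comp contDiffAt_snd
    refine ContDiffAt.mul (contMDiffAt_iff_contDiffAt.1 (hc.contMDiffAt.comp (t, Z) ha)) ?_
    exact contDiffAt_kernel_comp (smoothKernel f).2 (hO.contMDiffAt_mul_exp ha (by fun_prop))
      (hO.contMDiffAt_mul_exp ha (by fun_prop))
  have hV : ContDiffAt ℝ l (fun t => ∫ q, K t q ∂m) 0 :=
    (((hO.contDiffOn_integral_haar isOpen_univ isCompact_univ (K := K)
      (fun _ _ q hq => absurd (mem_univ q) hq) fun t _ Z => hK t Z).contDiffAt univ_mem)).of_le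
      (by exact_mod_cast le_top)
  have h2 : (fun t : ℝ => fiberIntegral m c (kernel f) (t • Y)) =
      fun t => D t * ∫ q, K t q ∂m := by
    funext t
    simp only [fiberIntegral, D, K, smoothKernel, smul_comm t]
  rw [h2, iteratedDeriv_fun_mul hD hV]
  refine (norm_sum_le _ _).trans (Finset.sum_le_sum fun i _ => ?_)
  rw [norm_mul, mul_assoc]
  refine mul_le_mul_of_nonneg_left ?_ (norm_nonneg _)
  rw [hO.iteratedDeriv_integral_haar isOpen_univ isCompact_univ (l - i) (K := K)
    (fun _ _ q hq => absurd (mem_univ q) hq) (fun t _ Z => hK t Z) (mem_univ 0)]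
  have h3 : ∀ q, iteratedDeriv (l - i) (fun t => K t q) 0 =
      c q * ((P ^ (l - i)) (smoothKernel f)).1 (q, q) := fun q => by
    have h4 := hO.iteratedDeriv_pairField (-(1 / 2 : ℝ) • Y) ((1 / 2 : ℝ) • Y) (smoothKernel f)
      (q, q) (l - i)
    simp only [K]
    rw [iteratedDeriv_const_mul_field, h4]
    simp only [zero_smul, lieExp_zero, mul_one]
    rfl
  simp only [h3]
  exact norm_integral_mul_le hc.continuous fun q => norm_le_iSup _ (q, q)

/-- The identity operator already suffices: the trace is at most the integral of |κ| times the
supremum of the kernel. -/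
theorem isDominated_integral_mul (hO : IsWeaklyExponential m O) {κ : G × G → ℂ}
    (hκ : IsTestKernel E κ) : IsDominated X fun f : testF m ħ O =>
      ‖∫ a, ∫ b, κ (a, b) * kernel f (b, a) ∂m ∂m‖ := by
  refine ((hO.isDominated_opNorm (m := m) (ħ := ħ) (Subalgebra.one_mem _)).const_mul
    (c := ∫ a, ∫ b, ‖κ (a, b)‖ ∂m ∂m) (by positivity)).mono fun f => ?_
  have hκc := hκ.smooth.continuous
  rw [← integral_mul_const]
  refine norm_integral_le_of_norm_le ?_ (Eventually.of_forall fun a => ?_)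
  · exact (hκc.norm.integrable_of_hasCompactSupport (μ := m.prod m)
      (HasCompactSupport.of_compactSpace _)).integral_prod_left.mul_const _
  · exact norm_integral_mul_le (hκc.comp (Continuous.prodMk_right a)) fun b =>
      norm_le_iSup (smoothKernel f) (b, a)

end IsWeaklyExponential

end Continuity
/-! ### Fiber polynomials -/

section Polarization

variable {R : Type*} [CommRing R]

/-- Inclusion-exclusion: if some i is not in `S₀`, the terms of S and S ∪ {i} cancel. -/
theorem sum_powerset_neg_one_pow_mul_ite_subset {α : Type*} [Fintype α] [DecidableEq α]
    (S₀ : Finset α) :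
    ∑ S ∈ (Finset.univ : Finset α).powerset, (-1 : R) ^ S.card * (if S₀ ⊆ S then 1 else 0) =
      if S₀ = Finset.univ then (-1) ^ Fintype.card α else 0 := by
  by_cases h : S₀ = Finset.univ
  · subst h
    simp only [Finset.univ_subset_iff, mul_ite, mul_one, mul_zero, if_true]
    rw [Finset.sum_ite_eq' (Finset.univ : Finset α).powerset Finset.univ]
    simp
  · rw [if_neg h]
    obtain ⟨i, hi⟩ : ∃ i, i ∉ S₀ := by
      by_contra! hall
      exact h (Finset.eq_univ_iff_forall.2 hall)
    rw [← Finset.insert_erase (Finset.mem_univ i),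
      Finset.sum_powerset_insert (Finset.notMem_erase i _), ← Finset.sum_add_distrib]
    refine Finset.sum_eq_zero fun S hS => ?_
    have hiS : i ∉ S := fun h => Finset.notMem_erase i _ (Finset.mem_powerset.1 hS h)
    have h1 : S₀ ⊆ insert i S ↔ S₀ ⊆ S := Finset.subset_insert_iff_of_notMem hi
    rw [Finset.card_insert_of_notMem hiS, pow_succ]
    simp only [h1]
    ring

/-- Polarization: a product of `l` elements is a combination of `l`-th powers of their sums. -/
theorem exists_polarization (l : ℕ) : ∃ N : ℕ, N ≠ 0 ∧ ∀ x : Fin l → R, (N : R) * ∏ t, x t =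
    (-1) ^ l * ∑ S ∈ (Finset.univ : Finset (Fin l)).powerset,
      (-1) ^ S.card * (∑ t ∈ S, x t) ^ l := by
  classical
  -- `N` counts the surjections of `Fin l` onto itself; only N ≠ 0 matters, and the identity map
  -- ensures it.
  refine ⟨(Finset.univ.filter fun p : Fin l → Fin l => Finset.univ.image p = Finset.univ).card,
    ?_, fun x => ?_⟩
  · exact Finset.card_ne_zero_of_mem (a := id) (by simp)
  -- The power is expanded over maps p with values in S; the alternating sum over S then keeps only
  -- the p with full image, the permutations, each of which gives the whole product.
  have h1 : ∀ S : Finset (Fin l), (∑ t ∈ S, x t) ^ l =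
      ∑ p : Fin l → Fin l, (if Finset.univ.image p ⊆ S then 1 else 0) * ∏ j, x (p j) := by
    intro S
    have h2 : ∑ t ∈ S, x t = ∑ t, if t ∈ S then x t else 0 := by simp
    rw [h2, Fintype.sum_pow]
    refine Finset.sum_congr rfl fun p _ => ?_
    by_cases hp : Finset.univ.image p ⊆ S
    · have h3 : ∀ j, p j ∈ S := fun j => hp (Finset.mem_image_of_mem p (Finset.mem_univ j))
      simp [h3, hp]
    · rw [if_neg hp, zero_mul]
      obtain ⟨j, hj⟩ : ∃ j, p j ∉ S := by
        by_contra! hall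
        exact hp (Finset.image_subset_iff.2 fun j _ => hall j)
      exact Finset.prod_eq_zero (Finset.mem_univ j) (if_neg hj)
  have h4 : ∀ p : Fin l → Fin l, (if Finset.univ.image p = Finset.univ then (1 : R) else 0) *
      ∏ j, x (p j) = (if Finset.univ.image p = Finset.univ then (1 : R) else 0) * ∏ j, x j := by
    intro p
    by_cases hp : Finset.univ.image p = Finset.univ
    · have h5 : Function.Surjective p := fun j => by
        simpa using (Finset.ext_iff.1 hp j).2 (Finset.mem_univ j)
      rw [Function.Bijective.prod_comp (Finite.injective_iff_surjective.2 h5 |>.bijective_of_finite) x]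
    · simp [hp]
  simp only [h1, Finset.mul_sum]
  rw [Finset.sum_comm]
  have h6 : ∀ p : Fin l → Fin l, ∑ S ∈ (Finset.univ : Finset (Fin l)).powerset,
      (-1 : R) ^ l * ((-1) ^ S.card * ((if Finset.univ.image p ⊆ S then 1 else 0) * ∏ j, x (p j)))
      = (if Finset.univ.image p = Finset.univ then (1 : R) else 0) * ∏ j, x j := by
    intro p
    rw [← h4]
    have h7 := sum_powerset_neg_one_pow_mul_ite_subset (R := R) (Finset.univ.image p)
    calc _ = ((-1 : R) ^ l * ∑ S ∈ (Finset.univ : Finset (Fin l)).powerset,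
          (-1 : R) ^ S.card * (if Finset.univ.image p ⊆ S then 1 else 0)) * ∏ j, x (p j) := by
            rw [Finset.mul_sum, Finset.sum_mul]
            exact Finset.sum_congr rfl fun S _ => by ring
      _ = _ := by
        rw [h7, Fintype.card_fin]
        congr 1
        split_ifs
        · rw [← mul_pow]; simp
        · simp
  simp only [h6]
  rw [← Finset.sum_mul, Finset.sum_boole]

end Polarization

/-! ### Membership in the star algebra -/

section StarAlgebra

variable {E : Type*} [NormedAddCommGroup E] [NormedSpace ℝ E] [FiniteDimensional ℝ E]
  [MeasurableSpace E] [BorelSpace E]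
  {G : Type*} [Group G] [TopologicalSpace G] [T2Space G] [SecondCountableTopology G]
  [ChartedSpace E G] [LieGroup 𝓘(ℝ, E) ∞ G] [MeasurableSpace G] [BorelSpace G]
  {m : Measure G} {O : Set E} {ħ : ℝ} {n : ℕ} {X : Module.Basis (Fin n) ℝ E}
  {u v : G × (E →L[ℝ] ℝ) → ℂ} {S T S' T' : Module.Dual ℂ (testF m ħ O)}

theorem Represents.add (h : Represents u T) (h' : Represents v T') :
    Represents (fun x => u x + v x) (T + T') := fun f => by
  simp only [add_mul]
  exact (h f).add (h' f)

theorem add_mem_distributions (h : T ∈ distributions X m ħ O) (h' : T' ∈ distributions X m ħ O) :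
    T + T' ∈ distributions X m ħ O := fun hG => by
  letI : TopologicalSpace (testF m ħ O) := testTopology X
  exact (h hG).add (h' hG)

/-- A test function is determined by its values, so both definitions refer to the same star-product.
-/
theorem IsStarRight.add {g : testF m ħ O} (h : IsStarRight T g S) (h' : IsStarRight T' g S') :
    IsStarRight (T + T') g (S + S') := fun f => by
  obtain ⟨w, hw, hS⟩ := h f
  obtain ⟨w', hw', hS'⟩ := h' f
  obtain rfl : w = w' := Subtype.ext (hw.trans hw'.symm)
  exact ⟨w, hw, congrArg₂ (· + ·) hS hS'⟩

theorem IsStarLeft.add {g : testF m ħ O} (h : IsStarLeft T g S) (h' : IsStarLeft T' g S') :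
    IsStarLeft (T + T') g (S + S') := fun f => by
  obtain ⟨w, hw, hS⟩ := h f
  obtain ⟨w', hw', hS'⟩ := h' f
  obtain rfl : w = w' := Subtype.ext (hw.trans hw'.symm)
  exact ⟨w, hw, congrArg₂ (· + ·) hS hS'⟩

theorem MemStarAlgebra.add (hu : MemStarAlgebra X m ħ O u) (hv : MemStarAlgebra X m ħ O v) :
    MemStarAlgebra X m ħ O fun x => u x + v x := by
  obtain ⟨T, ⟨hT, hTg⟩, hTu⟩ := hu
  obtain ⟨T', ⟨hT', hTg'⟩, hTv⟩ := hv
  refine ⟨T + T', ⟨add_mem_distributions hT hT', fun g => ?_⟩, hTu.add hTv⟩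
  obtain ⟨⟨S₁, h1, h2, k₁, h3⟩, S₂, h4, h5, k₂, h6⟩ := hTg g
  obtain ⟨⟨S₁', h1', h2', k₁', h3'⟩, S₂', h4', h5', k₂', h6'⟩ := hTg' g
  exact ⟨⟨S₁ + S₁', add_mem_distributions h1 h1', h2.add h2', k₁ + k₁', h3.add h3'⟩,
    S₂ + S₂', add_mem_distributions h4 h4', h5.add h5', k₂ + k₂', h6.add h6'⟩

namespace IsWeaklyExponential

variable [IsTopologicalGroup G] [LocallyCompactSpace G] [m.IsHaarMeasure] {c : G → ℂ} {C : ℂ}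

/-- The trace formula evaluates a test function as a distribution, and also bounds it by the
supremum of the kernel, which gives continuity for compact G. -/
theorem ofKernel_represents (hO : IsWeaklyExponential m O) (hħ : ħ ≠ 0)
    (hC : ∀ χ : (E →L[ℝ] ℝ) → ℂ, ContDiff ℝ ∞ χ → HasCompactSupport χ →
      ∃ Ψ : SchwartzMap E ℂ, (∀ X, Ψ X = ∫ p, χ p * phase ħ p X ∂(dualMeasure m)) ∧
        ∫ X, Ψ X ∂(algMeasure m) = C * χ 0) (X : Module.Basis (Fin n) ℝ E)
    {κ : G × G → ℂ} (hκ : IsTestKernel E κ) :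
    ∃ S ∈ distributions X m ħ O, Represents (hO.ofKernel ħ hκ).1 S ∧
      ∀ h, S h = C * ∫ a, ∫ b, κ (a, b) * kernel h (b, a) ∂m ∂m := by
  have h1 : ∀ h : testF m ħ O, HasImproperIntegral m (fun x => (hO.ofKernel ħ hκ).1 x * h.1 x)
      (C * ∫ a, ∫ b, κ (a, b) * kernel h (b, a) ∂m ∂m) := fun h =>
    hO.hasImproperIntegral_mul hC hκ (isTestKernel_kernel h) (hO.ofKernel_apply hκ)
      (hO.testF_apply h)
  obtain ⟨S, hS⟩ := exists_represents fun h => ⟨_, h1 h⟩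
  have h2 : ∀ h, S h = C * ∫ a, ∫ b, κ (a, b) * kernel h (b, a) ∂m ∂m := fun h =>
    (hS h).unique (h1 h)
  refine ⟨S, fun hG => ?_, hS, h2⟩
  refine hO.continuous_of_isDominated hħ S ?_
  simp only [h2, norm_mul]
  exact (hO.isDominated_integral_mul hκ).const_mul (norm_nonneg C)

/-- Since g ⋆ h has the composed kernel, pairing it with the monomial is, by `exists_kernel_right`,
a trace of `h` against a kernel independent of `h`; the trace formula recognizes this as a test
function. Both formulas carry the same constant C, so its value is irrelevant. -/
theorem memStarAlgebra_monomial (hO : IsWeaklyExponential m O) (hħ : ħ ≠ 0)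
    (X : Module.Basis (Fin n) ℝ E) (hc : ContMDiff 𝓘(ℝ, E) 𝓘(ℝ, ℂ) ∞ c) (Y : E) (l : ℕ) :
    MemStarAlgebra X m ħ O fun x => c x.1 * ((x.2 Y : ℝ) : ℂ) ^ l := by
  obtain ⟨C, hC⟩ := hO.exists_fourier_const hħ
  have h1 := hO.hasImproperIntegral_monomial hħ hC hc Y l
  obtain ⟨T, hT⟩ := exists_represents fun h => ⟨_, h1 h⟩
  have h2 : ∀ f, T f = C * ((-(Complex.I * ħ)) ^ l *
      iteratedDeriv l (fun t : ℝ => fiberIntegral m c (kernel f) (t • Y)) 0) := fun f =>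
    (hT f).unique (h1 f)
  refine ⟨T, ⟨fun hG => ?_, fun g => ⟨?_, ?_⟩⟩, hT⟩
  · refine hO.continuous_of_isDominated hħ T ?_
    simp only [h2, norm_mul, norm_pow, ← mul_assoc]
    exact (hO.isDominated_fiberIntegral hc Y l).const_mul (by positivity)
  · obtain ⟨κ, hκ, hκh⟩ := hO.exists_kernel_right hc Y l (isTestKernel_kernel g)
    obtain ⟨S, hS, hSr, hSv⟩ := hO.ofKernel_represents hħ hC X (hκ.smul ((-(Complex.I * ħ)) ^ l))
    refine ⟨S, hS, fun h => ⟨_, hO.starProd_eq_ofKernel g h, ?_⟩, _, hSr⟩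
    rw [h2, hSv, hO.kernel_ofKernel hħ, hκh _ (isTestKernel_kernel h)]
    simp only [Pi.smul_apply, smul_eq_mul, mul_assoc, integral_const_mul]
  · obtain ⟨κ, hκ, hκh⟩ := hO.exists_kernel_left hc Y l (isTestKernel_kernel g)
    obtain ⟨S, hS, hSr, hSv⟩ := hO.ofKernel_represents hħ hC X (hκ.smul ((-(Complex.I * ħ)) ^ l))
    refine ⟨S, hS, fun h => ⟨_, hO.starProd_eq_ofKernel h g, ?_⟩, _, hSr⟩
    rw [h2, hSv, hO.kernel_ofKernel hħ, hκh _ (isTestKernel_kernel h)]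
    simp only [Pi.smul_apply, smul_eq_mul, mul_assoc, integral_const_mul]

theorem memStarAlgebra_sum (hO : IsWeaklyExponential m O) (hħ : ħ ≠ 0)
    (X : Module.Basis (Fin n) ℝ E) {ι : Type*} (s : Finset ι) {u : ι → G × (E →L[ℝ] ℝ) → ℂ}
    (hu : ∀ i ∈ s, MemStarAlgebra X m ħ O (u i)) :
    MemStarAlgebra X m ħ O fun x => ∑ i ∈ s, u i x := by
  classical
  induction s using Finset.induction_on with
  | empty =>
    simpa using hO.memStarAlgebra_monomial hħ X (c := fun _ => 0) contMDiff_const 0 0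
  | insert i s hi ih =>
    simp only [Finset.sum_insert hi]
    exact (hu i (Finset.mem_insert_self i s)).add
      (ih fun j hj => hu j (Finset.mem_insert_of_mem hj))

/-- Polarization writes the product as a combination of l-th powers of ⟨p, ∑ Y_t⟩ over subsets of
indices, and the scalars are absorbed in the coefficient. -/
theorem memStarAlgebra_mul_prod (hO : IsWeaklyExponential m O) (hħ : ħ ≠ 0)
    (X : Module.Basis (Fin n) ℝ E) (hc : ContMDiff 𝓘(ℝ, E) 𝓘(ℝ, ℂ) ∞ c) {l : ℕ}
    (Y : Fin l → E) :
    MemStarAlgebra X m ħ O fun x => c x.1 * ∏ t, ((x.2 (Y t) : ℝ) : ℂ) := by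
  obtain ⟨N, hN, hP⟩ := exists_polarization (R := ℂ) l
  have h1 : (fun x : G × (E →L[ℝ] ℝ) => c x.1 * ∏ t, ((x.2 (Y t) : ℝ) : ℂ)) =
      fun x => ∑ S ∈ (Finset.univ : Finset (Fin l)).powerset,
        (((N : ℂ)⁻¹ * (-1) ^ l * (-1) ^ S.card) * c x.1) *
          ((x.2 (∑ t ∈ S, Y t) : ℝ) : ℂ) ^ l := by
    funext x
    have h2 := hP fun t => ((x.2 (Y t) : ℝ) : ℂ)
    have hN' : (N : ℂ) ≠ 0 := Nat.cast_ne_zero.2 hN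
    have h3 : ∏ t, ((x.2 (Y t) : ℝ) : ℂ) = (N : ℂ)⁻¹ * ((N : ℂ) * ∏ t, ((x.2 (Y t) : ℝ) : ℂ)) := by
      rw [inv_mul_cancel_left₀ hN']
    rw [h3, h2, Finset.mul_sum, Finset.mul_sum, Finset.mul_sum]
    refine Finset.sum_congr rfl fun S _ => ?_
    rw [map_sum, Complex.ofReal_sum]
    ring
  rw [h1]
  exact hO.memStarAlgebra_sum hħ X _ fun S _ =>
    hO.memStarAlgebra_monomial hħ X
      ((contDiff_const.mul contDiff_id).contMDiff.comp hc) _ l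

end IsWeaklyExponential

end StarAlgebra

end StarLie

end

theorem theorem2 {E : Type*} [NormedAddCommGroup E] [NormedSpace ℝ E] [FiniteDimensional ℝ E]
    [MeasurableSpace E] [BorelSpace E]
    {G : Type*} [Group G] [TopologicalSpace G] [T2Space G] [SecondCountableTopology G]
    [ChartedSpace E G] [LieGroup 𝓘(ℝ, E) ∞ G] [MeasurableSpace G] [BorelSpace G]
    (m : Measure G) [m.IsHaarMeasure] (O : Set E) (hO : StarLie.IsWeaklyExponential m O)
    (ħ : ℝ) (hħ : ħ ≠ 0) {n : ℕ} (X : Module.Basis (Fin n) ℝ E) :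
    (∀ f : G → ℂ, ContMDiff 𝓘(ℝ, E) 𝓘(ℝ, ℂ) ∞ f →
      StarLie.MemStarAlgebra X m ħ O (fun x => f x.1)) ∧
    (∀ j : Fin n, StarLie.MemStarAlgebra X m ħ O (StarLie.fiberVar G X j)) ∧
    (∀ u : G × (E →L[ℝ] ℝ) → ℂ, StarLie.IsFiberPolynomial X u →
      StarLie.MemStarAlgebra X m ħ O u) := by
  haveI : IsTopologicalGroup G := topologicalGroup_of_lieGroup 𝓘(ℝ, E) ∞
  haveI : LocallyCompactSpace G := Manifold.locallyCompact_of_finiteDimensional 𝓘(ℝ, E)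
  refine ⟨fun f hf => ?_, fun j => ?_, fun u ⟨d, c, hc, hu⟩ => ?_⟩
  -- Degree zero, where the direction of the monomial is immaterial.
  · simpa using hO.memStarAlgebra_monomial hħ X hf 0 0
  · have h := hO.memStarAlgebra_monomial hħ X (c := fun _ => 1) contMDiff_const (X j) 1
    simp only [one_mul, pow_one] at h
    exact h
  · rw [funext hu]
    exact hO.memStarAlgebra_sum hħ X _ fun l _ => hO.memStarAlgebra_sum hħ X _ fun i _ =>
      hO.memStarAlgebra_mul_prod hħ X (hc l i) fun t => X (i t)
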